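/- **Logic.** Work in ordinary first-order logic with equality, with individual variables $v_0,v_1,\dots$ and relation symbols of finite rank only. A theory $T$ is a set of formulas of a language $\mathcal L$ (a set of relation symbols); $T\models\varphi$ means that $\varphi$ is true, under all assignments, in every non-empty model of $T$. A translation $\mathrm{tr}:\mathrm{Fm}_1\to\mathrm{Fm}_2$ is a map of formulas that fixes the equations $v_i=v_j$ and commutes with $\neg$, $\wedge$ and every $\exists v_i$; it is an interpretation of $T_1$ into $T_2$ if $T_1\models\varphi$ implies $T_2\models\mathrm{tr}(\varphi)$. $T_1$ and $T_2$ are *definitionally equivalent* if there are interpretations $\mathrm{tr}_{12}$, $\mathrm{tr}_{21}$ between them with $T_1\models\mathrm{tr}_{21}(\mathrm{tr}_{12}(\varphi))\leftrightarrow\varphi$ and $T_2\models\mathrm{tr}_{12}(\mathrm{tr}_{21}(\psi))\leftrightarrow\psi$ for all $\varphi\in\mathrm{Fm}_1$, $\psi\in\mathrm{Fm}_2$. $T_2$ is a *conservative extension* of $T_1$ if $\mathcal L_1\subseteq\mathcal L_2$ and $T_2\models\varphi\iff T_1\models\varphi$ for all $\varphi\in\mathrm{Fm}_1$. $T'$ is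 a *one-concept-extension* of $T$ if $\mathcal L'=\mathcal L\cup\{R\}$ for some relation symbol $R$ and $T'$ is a conservative extension of $T$. The *conceptual distance* $\mathrm{Cd}(T,T')\in\mathbb N\cup\{\infty\}$ is the least number of one-concept steps in a finite sequence of theories from $T$ to $T'$ in which any two neighbours are either definitionally equivalent (cost $0$) or one of them is a one-concept-extension of the other (a one-concept step, cost $1$); it is $\infty$ if there is no such sequence. **Kinematics.** The language has unary symbols $B$ (bodies), $Q$ (quantities), $\mathsf{IOb}$ (inertial observers), $\mathsf{Ph}$ (light signals), ternary symbols for the graphs of $+$ and $\cdot$, binary $\le$, and a 6-ary $\mathsf W$, where $\mathsf W(k,b,\bar x)$, $\bar x=(x_0,\dots,x_3)$, says that $k$ coordinatizes body $b$ at time $x_0$ and place $(x_1,x_2,x_3)$. Write $\mathrm{ev}_k(\bar x)=\{b:\mathsf W(k,b,\bar x)\}$, $\mathrm{time}(\bar x,\bar y)=|x_0-y_0|$, and $\mathrm{space}(\bar x,\bar y)$ for the Euclidean distance of the spatial parts. In the axioms $k,k',h,e$ range over inertial observers, and $\bar x,\bar y,\bar x',\bar y',\bar z$ over $Q^4$.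 *Common axioms:* - every object is either a body or a quantity and not both; the relations respect the sorts; $+$ and $\cdot$ are total operations on $Q$; inertial observers and light signals are bodies, and no body is both; - $(Q,+,\cdot,\le)$ is a Euclidean field (a linearly ordered field in which non-negative elements have square roots); - for all $k,h,\bar x$ there is $\bar y$ with $\mathrm{ev}_k(\bar x)=\mathrm{ev}_h(\bar y)$; - $\mathsf W(k,k,\bar x)\leftrightarrow x_1=x_2=x_3=0$; - if $\mathrm{ev}_k(\bar x)=\mathrm{ev}_{k'}(\bar x')$, $\mathrm{ev}_k(\bar y)=\mathrm{ev}_{k'}(\bar y')$ and $\mathrm{time}(\bar x,\bar y)=\mathrm{time}(\bar x',\bar y')=0$, then $\mathrm{space}(\bar x,\bar y)=\mathrm{space}(\bar x',\bar y')$; - if $\mathsf W(k,h,\bar x)$, $\mathsf W(k,h,\bar y)$ and $\mathsf W(k,h,\bar z)$, then $\bar x,\bar y,\bar z$ are collinear; - for every $k$ and every map $T:Q^4\to Q^4$ that is the product of a translation of time and an isometry of space (a translation composed with an orthogonal linear map) there is $k'$ such that, for all $\bar x,\bar y$, $\mathrm{ev}_k(\bar x)=\mathrm{ev}_{k'}(\bar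 y)\leftrightarrow\bar y=T(\bar x)$; - if $\mathsf W(k,b,\bar x)$ for bodies $k,b$, then $\mathsf{IOb}(k)$. Say that *light has speed $c$ for $k$* if $c\in Q$, $c>0$ and, for all $\bar x,\bar y$, there is a light signal $p$ with $\mathsf W(k,p,\bar x)$ and $\mathsf W(k,p,\bar y)$ if and only if $\mathrm{space}(\bar x,\bar y)=c\cdot\mathrm{time}(\bar x,\bar y)$. *$\mathsf{ClassicalKin}$* consists of the common axioms and: some inertial observer has some light speed $c$; if $\mathrm{ev}_k(\bar x)=\mathrm{ev}_{k'}(\bar x')$ and $\mathrm{ev}_k(\bar y)=\mathrm{ev}_{k'}(\bar y')$ then $\mathrm{time}(\bar x,\bar y)=\mathrm{time}(\bar x',\bar y')$; there is an inertial observer, and if $x_0\ne y_0$ then for every $k$ there is $k'$ with $\mathsf W(k,k',\bar x)$ and $\mathsf W(k,k',\bar y)$. *$\mathsf{SpecRel}$* consists of the common axioms and: there is one $c$ such that light has speed $c$ for every inertial observer; there is an inertial observer, and if light has speed $c$ for $k$ and $\mathrm{space}(\bar x,\bar y)<c\cdot\mathrm{time}(\bar x,\bar y)$ then there is $k'$ with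 $\mathsf W(k,k',\bar x)$ and $\mathsf W(k,k',\bar y)$. *$\mathsf{SpecRel}^E$* is the theory in the language of $\mathsf{SpecRel}$ with one new unary symbol $E$ whose axioms are those of $\mathsf{SpecRel}$ and $$\exists v_0\big[\mathsf{IOb}(v_0)\wedge\forall v_1\big(E(v_1)\leftrightarrow[\mathsf{IOb}(v_1)\wedge\varphi(v_0,v_1)]\big)\big],$$ where $\varphi(k,h)$ says that $k$ and $h$ are stationary with respect to each other: any $\bar x,\bar y$ with $\mathsf W(k,h,\bar x)$ and $\mathsf W(k,h,\bar y)$ have the same spatial part. **Theorem.** $\mathrm{Cd}(\mathsf{ClassicalKin},\mathsf{SpecRel})=1$, where the distance is taken on the class of all theories. Moreover $\mathsf{SpecRel}^E$, whose language is that of $\mathsf{SpecRel}$ together with the one new unary symbol $E$, is a conservative extension of $\mathsf{SpecRel}$ and is definitionally equivalent to $\mathsf{ClassicalKin}$. -/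

import Mathlib

universe u

/-! ### Ordinary first-order logic with named variables and relation symbols only -/

/-- The relation symbols of the two theories of kinematics (`B`, `Q`, …, `W`), and the additional
symbol `E` for absolute rest. -/
inductive KinSymbol : Type
  | B | Q | IOb | Ph | plus | times | le | W | E

/-- `B`: bodies, `Q`: quantities, `IOb`: inertial observers, `Ph`: light signals,
`plus x y z`: `x + y = z`, `times x y z`: `x · y = z`, `le x y`: `x ≤ y`,
`W k b t x y z`: observer `k` coordinatizes body `b` at `(t, x, y, z)`. -/
def KinSymbol.rank : KinSymbol → ℕ
  | .B => 1
  | .Q => 1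
  | .IOb => 1
  | .Ph => 1
  | .plus => 3
  | .times => 3
  | .le => 2
  | .W => 6
  | .E => 1

/-- The supply of relation symbols: the symbols of kinematics and, for every `s : S` and every
`n : ℕ`, a further symbol of rank `n`. The type `S` is arbitrary. -/
inductive RelSymbol (S : Type u) : Type u
  | kin (s : KinSymbol)
  | other (s : S) (n : ℕ)

def RelSymbol.rank {S : Type u} : RelSymbol S → ℕ
  | .kin s => s.rank
  | .other _ n => n

/-- A language is a set of relation symbols. -/
abbrev RelLanguage (S : Type u) : Type u := Set (RelSymbol S)

/-- Formulas of the language `L` in the individual variables `v_i`, `i : ℕ`. -/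
inductive Formula {S : Type u} (L : RelLanguage S) : Type u
  | eq (i j : ℕ) : Formula L
  | rel (R : L) (args : Fin R.1.rank → ℕ) : Formula L
  | and (φ ψ : Formula L) : Formula L
  | not (φ : Formula L) : Formula L
  | ex (i : ℕ) (φ : Formula L) : Formula L

namespace Formula

variable {S : Type u} {L : RelLanguage S}

def or (φ ψ : Formula L) : Formula L := not (and (not φ) (not ψ))

def imp (φ ψ : Formula L) : Formula L := not (and φ (not ψ))

def iff (φ ψ : Formula L) : Formula L := and (imp φ ψ) (imp ψ φ)

def all (i : ℕ) (φ : Formula L) : Formula L := not (ex i (not φ))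

/-- The inclusion of formulas given by an inclusion of languages. -/
def incl {L L' : RelLanguage S} (h : L ⊆ L') : Formula L → Formula L'
  | eq i j => eq i j
  | rel R args => rel ⟨R.1, h R.2⟩ args
  | and φ ψ => and (incl h φ) (incl h ψ)
  | not φ => not (incl h φ)
  | ex i φ => ex i (incl h φ)

end Formula

/-- The relations of a model for the language `L` with underlying set `M`. -/
abbrev Interp {S : Type u} (L : RelLanguage S) (M : Type u) : Type u :=
  ∀ R : L, Set (Fin R.1.rank → M)

/-- Satisfaction of a formula in a model under an assignment. -/
def Sat {S : Type u} {L : RelLanguage S} {M : Type u} (I : Interp L M) :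
    (ℕ → M) → Formula L → Prop
  | τ, .eq i j => τ i = τ j
  | τ, .rel R args => (fun m => τ (args m)) ∈ I R
  | τ, .and φ ψ => Sat I τ φ ∧ Sat I τ ψ
  | τ, .not φ => ¬ Sat I τ φ
  | τ, .ex i φ => ∃ a : M, Sat I (Function.update τ i a) φ

/-- A formula is true in a model iff it is satisfied under every assignment. -/
def TrueIn {S : Type u} {L : RelLanguage S} {M : Type u} (I : Interp L M) (φ : Formula L) : Prop :=
  ∀ τ : ℕ → M, Sat I τ φ

/-- A theory: a language together with a set of formulas of it. -/
structure Theory (S : Type u) : Type u where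
  lang : RelLanguage S
  axs : Set (Formula lang)

namespace Theory

variable {S : Type u}

def IsModel (T : Theory S) {M : Type u} (I : Interp T.lang M) : Prop :=
  ∀ ψ ∈ T.axs, TrueIn I ψ

/-- `T ⊨ φ`: the formula `φ` is true in every (non-empty) model of `T`. -/
def Entails (T : Theory S) (φ : Formula T.lang) : Prop :=
  ∀ (M : Type u) [Nonempty M] (I : Interp T.lang M), T.IsModel I → TrueIn I φ

end Theory

/-! ### Definitional equivalence and conservative extensions -/

structure IsTranslation {S : Type u} {L₁ L₂ : RelLanguage S} (tr : Formula L₁ → Formula L₂) :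
    Prop where
  map_eq : ∀ i j, tr (.eq i j) = .eq i j
  map_not : ∀ φ, tr (.not φ) = .not (tr φ)
  map_and : ∀ φ ψ, tr (.and φ ψ) = .and (tr φ) (tr ψ)
  map_ex : ∀ i φ, tr (.ex i φ) = .ex i (tr φ)

structure IsInterpretation {S : Type u} (T₁ T₂ : Theory S)
    (tr : Formula T₁.lang → Formula T₂.lang) : Prop where
  isTranslation : IsTranslation tr
  entails : ∀ φ, T₁.Entails φ → T₂.Entails (tr φ)

/-- `tr` is a definitional equivalence between `T₁` and `T₂`. -/
def IsDefinitionalEquivalence {S : Type u} (T₁ T₂ : Theory S)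
    (tr : Formula T₁.lang → Formula T₂.lang) : Prop :=
  IsInterpretation T₁ T₂ tr ∧
    ∃ tr' : Formula T₂.lang → Formula T₁.lang, IsInterpretation T₂ T₁ tr' ∧
      (∀ φ, T₁.Entails (.iff (tr' (tr φ)) φ)) ∧ (∀ ψ, T₂.Entails (.iff (tr (tr' ψ)) ψ))

def DefinitionallyEquivalent {S : Type u} (T₁ T₂ : Theory S) : Prop :=
  ∃ tr, IsDefinitionalEquivalence T₁ T₂ tr

/-- `T₂` is a conservative extension of `T₁`. -/
def ConservativeExtension {S : Type u} (T₁ T₂ : Theory S) : Prop :=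
  ∃ h : T₁.lang ⊆ T₂.lang, ∀ φ : Formula T₁.lang, T₂.Entails (φ.incl h) ↔ T₁.Entails φ

/-- `T'` is a one-concept-extension of `T`. -/
def OneConceptExtension {S : Type u} (T T' : Theory S) : Prop :=
  (∃ R : RelSymbol S, T'.lang = insert R T.lang) ∧ ConservativeExtension T T'

/-- `T` and `T'` are separated by at most one concept. -/
def SeparatedByAtMostOne {S : Type u} (T T' : Theory S) : Prop :=
  OneConceptExtension T T' ∨ OneConceptExtension T' T

theorem sat_iff {S : Type u} {L : RelLanguage S} {M : Type u} (I : Interp L M) (τ : ℕ → M)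
    (φ ψ : Formula L) : Sat I τ (.iff φ ψ) ↔ (Sat I τ φ ↔ Sat I τ ψ) := by
  simp only [Formula.iff, Formula.imp, Sat]
  tauto

theorem IsTranslation.map_iff {S : Type u} {L₁ L₂ : RelLanguage S} {tr : Formula L₁ → Formula L₂}
    (h : IsTranslation tr) (φ ψ : Formula L₁) : tr (.iff φ ψ) = .iff (tr φ) (tr ψ) := by
  simp only [Formula.iff, Formula.imp, h.map_and, h.map_not]

theorem Theory.Entails.iff_trans {S : Type u} {T : Theory S} {φ ψ χ : Formula T.lang}
    (h₁ : T.Entails (.iff φ ψ)) (h₂ : T.Entails (.iff ψ χ)) : T.Entails (.iff φ χ) :=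
  fun M _ I hI τ => (sat_iff I τ φ χ).2
    (((sat_iff I τ φ ψ).1 (h₁ M I hI τ)).trans ((sat_iff I τ ψ χ).1 (h₂ M I hI τ)))

theorem IsInterpretation.comp {S : Type u} {T₁ T₂ T₃ : Theory S}
    {f : Formula T₁.lang → Formula T₂.lang} {g : Formula T₂.lang → Formula T₃.lang}
    (hf : IsInterpretation T₁ T₂ f) (hg : IsInterpretation T₂ T₃ g) :
    IsInterpretation T₁ T₃ (g ∘ f) where
  isTranslation :=
    { map_eq := fun i j => by
        simp only [Function.comp, hf.isTranslation.map_eq, hg.isTranslation.map_eq]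
      map_not := fun φ => by
        simp only [Function.comp, hf.isTranslation.map_not, hg.isTranslation.map_not]
      map_and := fun φ ψ => by
        simp only [Function.comp, hf.isTranslation.map_and, hg.isTranslation.map_and]
      map_ex := fun i φ => by
        simp only [Function.comp, hf.isTranslation.map_ex, hg.isTranslation.map_ex] }
  entails := fun φ h => hg.entails _ (hf.entails φ h)

theorem definitionallyEquivalent_equivalence (S : Type u) :
    Equivalence (DefinitionallyEquivalent (S := S)) where
  refl T := by
    have hid : IsInterpretation T T id :=
      ⟨⟨fun _ _ => rfl, fun _ => rfl, fun _ _ => rfl, fun _ _ => rfl⟩, fun _ h => h⟩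
    exact ⟨id, hid, id, hid, fun φ M _ I _ τ => (sat_iff I τ _ _).2 Iff.rfl,
      fun φ M _ I _ τ => (sat_iff I τ _ _).2 Iff.rfl⟩
  symm := by
    rintro T₁ T₂ ⟨f, hf, g, hg, h₁, h₂⟩
    exact ⟨g, hg, f, hf, h₂, h₁⟩
  trans := by
    rintro T₁ T₂ T₃ ⟨f, hf, f', hf', h₁, h₂⟩ ⟨g, hg, g', hg', h₃, h₄⟩
    refine ⟨g ∘ f, hf.comp hg, f' ∘ g', hg'.comp hf', fun φ => ?_, fun ψ => ?_⟩
    · have h := hf'.entails _ (h₃ (f φ))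
      rw [hf'.isTranslation.map_iff] at h
      exact h.iff_trans (h₁ φ)
    · have h := hg.entails _ (h₂ (g' ψ))
      rw [hg.isTranslation.map_iff] at h
      exact h.iff_trans (h₄ ψ)

/-! ### Step distance and conceptual distance -/

/-- A cluster network: an equivalence relation `E` and a symmetric relation `S` on `X`. -/
structure ClusterNetwork (X : Type u) where
  E : X → X → Prop
  S : X → X → Prop
  equivalence : Equivalence E
  symm : ∀ x y, S x y → S y x

/-- `N.IsPath T T' b`: the sequence `b` of zeros (`false`) and ones (`true`) is a path leading
from `T` to `T'`; a zero is a step along `E`, a one is a step along `S`. -/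
inductive ClusterNetwork.IsPath {X : Type u} (N : ClusterNetwork X) : X → X → List Bool → Prop
  | nil (T : X) : IsPath N T T []
  | zero {T T₁ T' : X} {b : List Bool} (h : N.E T T₁) (p : IsPath N T₁ T' b) :
      IsPath N T T' (false :: b)
  | one {T T₁ T' : X} {b : List Bool} (h : N.S T T₁) (p : IsPath N T₁ T' b) :
      IsPath N T T' (true :: b)

/-- The step distance: the least length (number of ones) of a path, and `⊤` if there is none. -/
noncomputable def ClusterNetwork.stepDistance {X : Type u} (N : ClusterNetwork X) (T T' : X) :
    ℕ∞ :=
  sInf {d : ℕ∞ | ∃ b : List Bool, N.IsPath T T' b ∧ d = (b.count true : ℕ)}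

/-- The cluster network of all theories. -/
def conceptualNetwork (S : Type u) : ClusterNetwork (Theory S) where
  E := DefinitionallyEquivalent
  S := SeparatedByAtMostOne
  equivalence := definitionallyEquivalent_equivalence S
  symm := fun _ _ h => h.symm

/-- The conceptual distance on the class of all theories. -/
noncomputable def conceptualDistance {S : Type u} (T T' : Theory S) : ℕ∞ :=
  (conceptualNetwork S).stepDistance T T'

/-! ### Writing formulas in the language of kinematics -/

/-- The common language of the two theories of kinematics. -/
def kinLang (S : Type u) : RelLanguage S := {R | ∃ s : KinSymbol, s ≠ .E ∧ R = .kin s}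

/-- The language of kinematics with the additional unary symbol `E`. -/
def kinLangE (S : Type u) : RelLanguage S := insert (.kin .E) (kinLang S)

theorem kinLang_subset_kinLangE (S : Type u) : kinLang S ⊆ kinLangE S :=
  Set.subset_insert _ _

/-- A formula given as a function of a number `n` such that no variable `v_m` with `m ≥ n` has been
used so far: every quantifier binds the variable `v_n` and passes on `n + 1`. -/
abbrev KForm (S : Type u) : Type u := ℕ → Formula (kinLang S)

namespace KForm

variable {S : Type u}

def atom (s : KinSymbol) (h : s ≠ .E) (args : Fin s.rank → ℕ) : KForm S :=
  fun _ => .rel ⟨.kin s, s, h, rfl⟩ args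

def isB (i : ℕ) : KForm S := atom .B (by simp) (![i] : Fin 1 → ℕ)
def isQ (i : ℕ) : KForm S := atom .Q (by simp) (![i] : Fin 1 → ℕ)
def IOb (i : ℕ) : KForm S := atom .IOb (by simp) (![i] : Fin 1 → ℕ)
def Ph (i : ℕ) : KForm S := atom .Ph (by simp) (![i] : Fin 1 → ℕ)
def plus (i j k : ℕ) : KForm S := atom .plus (by simp) (![i, j, k] : Fin 3 → ℕ)
def times (i j k : ℕ) : KForm S := atom .times (by simp) (![i, j, k] : Fin 3 → ℕ)
def le (i j : ℕ) : KForm S := atom .le (by simp) (![i, j] : Fin 2 → ℕ)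
def W (k b : ℕ) (x : Fin 4 → ℕ) : KForm S :=
  atom .W (by simp) (![k, b, x 0, x 1, x 2, x 3] : Fin 6 → ℕ)

def same (i j : ℕ) : KForm S := fun _ => .eq i j
def neg (φ : KForm S) : KForm S := fun n => .not (φ n)
def conj (φ ψ : KForm S) : KForm S := fun n => .and (φ n) (ψ n)
def disj (φ ψ : KForm S) : KForm S := fun n => .or (φ n) (ψ n)
def impl (φ ψ : KForm S) : KForm S := fun n => .imp (φ n) (ψ n)
def equi (φ ψ : KForm S) : KForm S := fun n => .iff (φ n) (ψ n)

/-- Unrestricted quantifiers. -/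
def all (f : ℕ → KForm S) : KForm S := fun n => .all n (f n (n + 1))
def ex (f : ℕ → KForm S) : KForm S := fun n => .ex n (f n (n + 1))

end KForm

infixr:35 " ⋏ " => KForm.conj
infixr:30 " ⋎ " => KForm.disj
infixr:25 " ⇒ᶠ " => KForm.impl
infix:20 " ⇔ᶠ " => KForm.equi

namespace KForm

variable {S : Type u}

/-- Quantifiers over bodies. -/
def allB (f : ℕ → KForm S) : KForm S := all fun i => isB i ⇒ᶠ f i
def exB (f : ℕ → KForm S) : KForm S := ex fun i => isB i ⋏ f i

/-- Quantifiers over inertial observers. -/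
def allO (f : ℕ → KForm S) : KForm S := allB fun i => IOb i ⇒ᶠ f i
def exO (f : ℕ → KForm S) : KForm S := exB fun i => IOb i ⋏ f i

/-- Quantifiers over quantities. -/
def allQ (f : ℕ → KForm S) : KForm S := all fun i => isQ i ⇒ᶠ f i
def exQ (f : ℕ → KForm S) : KForm S := ex fun i => isQ i ⋏ f i

/-- Quantifiers over triples of quantities. -/
def allQ3 (f : (Fin 3 → ℕ) → KForm S) : KForm S :=
  allQ fun a => allQ fun b => allQ fun c => f ![a, b, c]

/-- Quantifiers over quadruples of quantities (coordinate points). -/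
def allQ4 (f : (Fin 4 → ℕ) → KForm S) : KForm S :=
  allQ fun a => allQ fun b => allQ fun c => allQ fun d => f ![a, b, c, d]
def exQ4 (f : (Fin 4 → ℕ) → KForm S) : KForm S :=
  exQ fun a => exQ fun b => exQ fun c => exQ fun d => f ![a, b, c, d]

end KForm

/-- Terms of sort quantity. -/
inductive Tm : Type
  | v (i : ℕ)
  | zero
  | one
  | add (s t : Tm)
  | sub (s t : Tm)
  | mul (s t : Tm)

namespace Tm

instance : Zero Tm := ⟨zero⟩
instance : One Tm := ⟨one⟩
instance : Add Tm := ⟨add⟩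
instance : Sub Tm := ⟨sub⟩
instance : Mul Tm := ⟨mul⟩

variable {S : Type u}

/-- The formula saying that the value of the term `t` is `v_z`. Here `0` is the additive idempotent
and `1` is the multiplicative idempotent other than `0`. -/
def valueIs : Tm → ℕ → KForm S
  | v i, z => KForm.same i z
  | zero, z => KForm.plus z z z
  | one, z => KForm.times z z z ⋏ KForm.neg (KForm.plus z z z)
  | add s t, z => KForm.exQ fun a => KForm.exQ fun b =>
      valueIs s a ⋏ valueIs t b ⋏ KForm.plus a b z
  | sub s t, z => KForm.exQ fun a => KForm.exQ fun b =>
      valueIs s a ⋏ valueIs t b ⋏ KForm.plus z b a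
  | mul s t, z => KForm.exQ fun a => KForm.exQ fun b =>
      valueIs s a ⋏ valueIs t b ⋏ KForm.times a b z

/-- `s = t` -/
def eqF (s t : Tm) : KForm S := KForm.exQ fun a => valueIs s a ⋏ valueIs t a

/-- `s ≤ t` -/
def leF (s t : Tm) : KForm S := KForm.exQ fun a => KForm.exQ fun b =>
  valueIs s a ⋏ valueIs t b ⋏ KForm.le a b

/-- `s < t` -/
def ltF (s t : Tm) : KForm S := leF s t ⋏ KForm.neg (eqF s t)

def sq (t : Tm) : Tm := t * t

end Tm

infix:50 " ≐ " => Tm.eqF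
infix:50 " ≼ᶠ " => Tm.leF
infix:50 " ≺ᶠ " => Tm.ltF

/-! ### The axioms of kinematics -/

namespace Kin

open KForm Tm

variable {S : Type u}

/-- The square of the time difference `|x₀ - y₀|` of two coordinate points. -/
def time2 (x y : Fin 4 → ℕ) : Tm := sq (v (x 0) - v (y 0))

/-- The square of the spatial distance of two coordinate points. -/
def space2 (x y : Fin 4 → ℕ) : Tm :=
  sq (v (x 1) - v (y 1)) + sq (v (x 2) - v (y 2)) + sq (v (x 3) - v (y 3))

/-- `ev_k(x) = ev_h(y)`, where the event `ev_k(x)` is the set of the bodies that `k` coordinatizes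
at `x`. -/
def sameEvent (k : ℕ) (x : Fin 4 → ℕ) (h : ℕ) (y : Fin 4 → ℕ) : KForm S :=
  allB fun b => W k b x ⇔ᶠ W h b y

/-- Two-sorted logic inside one-sorted logic: every object is either a body or a quantity, the
relations respect the sorts, addition and multiplication are total operations on the quantities.
Inertial observers and light signals are two kinds of bodies: no body is both. -/
def axSorts : KForm S :=
  (all fun x => (isB x ⇔ᶠ neg (isQ x))) ⋏
  (all fun x => IOb x ⇒ᶠ isB x) ⋏
  (all fun x => Ph x ⇒ᶠ isB x) ⋏
  (all fun x => neg (IOb x ⋏ Ph x)) ⋏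
  (all fun x => all fun y => all fun z => plus x y z ⇒ᶠ isQ x ⋏ isQ y ⋏ isQ z) ⋏
  (all fun x => all fun y => all fun z => times x y z ⇒ᶠ isQ x ⋏ isQ y ⋏ isQ z) ⋏
  (all fun x => all fun y => le x y ⇒ᶠ isQ x ⋏ isQ y) ⋏
  (all fun k => all fun b => all fun x₀ => all fun x₁ => all fun x₂ => all fun x₃ =>
    W k b ![x₀, x₁, x₂, x₃] ⇒ᶠ isB k ⋏ isB b ⋏ isQ x₀ ⋏ isQ x₁ ⋏ isQ x₂ ⋏ isQ x₃) ⋏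
  (allQ fun x => allQ fun y => exQ fun z => plus x y z ⋏ allQ fun w => plus x y w ⇒ᶠ same w z) ⋏
  (allQ fun x => allQ fun y => exQ fun z => times x y z ⋏ allQ fun w => times x y w ⇒ᶠ same w z)

/-- The quantities form a Euclidean field: a linearly ordered field in which every non-negative
element has a square root. -/
def axEField : KForm S :=
  exQ fun o => exQ fun e =>
    neg (same o e) ⋏
    (allQ fun x => allQ fun y => allQ fun z => (v x + v y) + v z ≐ v x + (v y + v z)) ⋏
    (allQ fun x => allQ fun y => v x + v y ≐ v y + v x) ⋏
    (allQ fun x => v x + v o ≐ v x) ⋏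
    (allQ fun x => exQ fun y => v x + v y ≐ v o) ⋏
    (allQ fun x => allQ fun y => allQ fun z => (v x * v y) * v z ≐ v x * (v y * v z)) ⋏
    (allQ fun x => allQ fun y => v x * v y ≐ v y * v x) ⋏
    (allQ fun x => v x * v e ≐ v x) ⋏
    (allQ fun x => neg (same x o) ⇒ᶠ exQ fun y => v x * v y ≐ v e) ⋏
    (allQ fun x => allQ fun y => allQ fun z => v x * (v y + v z) ≐ v x * v y + v x * v z) ⋏
    (allQ fun x => allQ fun y => le x y ⋎ le y x) ⋏
    (allQ fun x => allQ fun y => le x y ⋏ le y x ⇒ᶠ same x y) ⋏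
    (allQ fun x => allQ fun y => allQ fun z => le x y ⋏ le y z ⇒ᶠ le x z) ⋏
    (allQ fun x => allQ fun y => allQ fun z => le x y ⇒ᶠ v x + v z ≼ᶠ v y + v z) ⋏
    (allQ fun x => allQ fun y => le o x ⋏ le o y ⇒ᶠ v o ≼ᶠ v x * v y) ⋏
    (allQ fun x => le o x ⇒ᶠ exQ fun y => sq (v y) ≐ v x)

/-- All inertial observers coordinatize the same events. -/
def axEv : KForm S :=
  allO fun k => allO fun h => allQ4 fun x => exQ4 fun y => sameEvent k x h y

/-- Every inertial observer is stationary at the spatial origin according to himself. -/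
def axSelf : KForm S :=
  allO fun k => allQ4 fun x =>
    W k k x ⇔ᶠ (v (x 1) ≐ 0 ⋏ v (x 2) ≐ 0 ⋏ v (x 3) ≐ 0)

/-- Inertial observers agree as to the spatial distance between two events if these two events are
simultaneous for both of them. -/
def axSymD : KForm S :=
  allO fun k => allO fun k' => allQ4 fun x => allQ4 fun y => allQ4 fun x' => allQ4 fun y' =>
    time2 x y ≐ 0 ⋏ time2 x' y' ≐ 0 ⋏ sameEvent k x k' x' ⋏ sameEvent k y k' y' ⇒ᶠ
      space2 x y ≐ space2 x' y'

/-- `z - x = a (y - x)` for coordinate points `x`, `y`, `z`. -/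
def onLine (a : ℕ) (x y z : Fin 4 → ℕ) : KForm S :=
  (v (z 0) - v (x 0) ≐ v a * (v (y 0) - v (x 0))) ⋏
  (v (z 1) - v (x 1) ≐ v a * (v (y 1) - v (x 1))) ⋏
  (v (z 2) - v (x 2) ≐ v a * (v (y 2) - v (x 2))) ⋏
  (v (z 3) - v (x 3) ≐ v a * (v (y 3) - v (x 3)))

/-- The world lines of inertial observers are straight according to inertial observers. -/
def axLine : KForm S :=
  allO fun k => allO fun h => allQ4 fun x => allQ4 fun y => allQ4 fun z =>
    W k h x ⋏ W k h y ⋏ W k h z ⇒ᶠ exQ fun a => onLine a x y z ⋎ onLine a x z y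

def dot (a b : Fin 3 → ℕ) : Tm :=
  v (a 0) * v (b 0) + v (a 1) * v (b 1) + v (a 2) * v (b 2)

/-- The rows `a₁`, `a₂`, `a₃` form an orthogonal matrix. -/
def orthogonal (a₁ a₂ a₃ : Fin 3 → ℕ) : KForm S :=
  dot a₁ a₁ ≐ 1 ⋏ dot a₂ a₂ ≐ 1 ⋏ dot a₃ a₃ ≐ 1 ⋏
  dot a₁ a₂ ≐ 0 ⋏ dot a₁ a₃ ≐ 0 ⋏ dot a₂ a₃ ≐ 0

/-- `y = T(x)`, where `T` is the product of the translation by `d 0` of the time axis and the map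
`p ↦ a p + (d 1, d 2, d 3)` of space. -/
def trivImage (a₁ a₂ a₃ : Fin 3 → ℕ) (d x y : Fin 4 → ℕ) : KForm S :=
  (v (y 0) ≐ v (x 0) + v (d 0)) ⋏
  (v (y 1) ≐ dot a₁ ![x 1, x 2, x 3] + v (d 1)) ⋏
  (v (y 2) ≐ dot a₂ ![x 1, x 2, x 3] + v (d 2)) ⋏
  (v (y 3) ≐ dot a₃ ![x 1, x 2, x 3] + v (d 3))

/-- Every trivial transformation (an isometry of space together with a translation of time) of an
inertial coordinate system is an inertial coordinate system. -/
def axTriv : KForm S :=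
  allQ3 fun a₁ => allQ3 fun a₂ => allQ3 fun a₃ => allQ4 fun d => orthogonal a₁ a₂ a₃ ⇒ᶠ
    allO fun k => exO fun k' => allQ4 fun x => allQ4 fun y =>
      sameEvent k x k' y ⇔ᶠ trivImage a₁ a₂ a₃ d x y

/-- All observers are inertial. -/
def axNoAcc : KForm S :=
  allB fun k => allB fun b => allQ4 fun x => W k b x ⇒ᶠ IOb k

/-- For the observer `k` the speed of light is `c`, a positive quantity, everywhere and in every
direction: there is a light signal through `x` and `y` iff the spatial distance of `x` and `y` is
`c` times their time difference. -/
def lightSpeed (k c : ℕ) : KForm S :=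
  0 ≺ᶠ v c ⋏ allQ4 fun x => allQ4 fun y =>
    (exB fun p => Ph p ⋏ W k p x ⋏ W k p y) ⇔ᶠ space2 x y ≐ sq (v c) * time2 x y

/-- Ether observers: inertial observers for which the speed of light is the same everywhere and in
every direction. There is at least one of them. -/
def axEther : KForm S := exO fun e => exQ fun c => lightSpeed e c

/-- The time difference between two events is the same for all inertial observers. -/
def axAbsTime : KForm S :=
  allO fun k => allO fun k' => allQ4 fun x => allQ4 fun y => allQ4 fun x' => allQ4 fun y' =>
    sameEvent k x k' x' ⋏ sameEvent k y k' y' ⇒ᶠ time2 x y ≐ time2 x' y'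

/-- There are inertial observers, and they can move along any non-horizontal straight line. -/
def axThExpPlus : KForm S :=
  (exO fun h => same h h) ⋏
  allO fun k => allQ4 fun x => allQ4 fun y => neg (v (x 0) ≐ v (y 0)) ⇒ᶠ
    exO fun k' => W k k' x ⋏ W k k' y

/-- The speed of light is the same for all inertial observers, everywhere and in every
direction. -/
def axPhc : KForm S := exQ fun c => allO fun k => lightSpeed k c

/-- There are inertial observers, and they can move along any straight line of any speed less than
the speed of light. -/
def axThExp : KForm S :=
  (exO fun h => same h h) ⋏
  allO fun k => allQ fun c => lightSpeed k c ⇒ᶠ allQ4 fun x => allQ4 fun y =>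
    space2 x y ≺ᶠ sq (v c) * time2 x y ⇒ᶠ exO fun k' => W k k' x ⋏ W k k' y

/-- The observers `k` and `h` are stationary with respect to each other: the spatial coordinates
of `h` are constant according to `k`. -/
def stationary (k h : ℕ) : KForm S :=
  allQ4 fun x => allQ4 fun y => W k h x ⋏ W k h y ⇒ᶠ
    v (x 1) ≐ v (y 1) ⋏ v (x 2) ≐ v (y 2) ⋏ v (x 3) ≐ v (y 3)

/-- The common axioms of the two theories. -/
def common : Set (KForm S) :=
  {axSorts, axEField, axEv, axSelf, axSymD, axLine, axTriv, axNoAcc}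

end Kin

/-- Classical kinematics. -/
def classicalKin (S : Type u) : Theory S where
  lang := kinLang S
  axs := (fun φ : KForm S => φ 0) '' (Kin.common ∪ {Kin.axEther, Kin.axAbsTime, Kin.axThExpPlus})

/-- Relativistic kinematics. -/
def specRel (S : Type u) : Theory S where
  lang := kinLang S
  axs := (fun φ : KForm S => φ 0) '' (Kin.common ∪ {Kin.axPhc, Kin.axThExp})

/-- The formula `E(v_i)`. -/
def isE {S : Type u} (i : ℕ) : Formula (kinLangE S) :=
  .rel ⟨.kin .E, Set.mem_insert _ _⟩ (![i] : Fin 1 → ℕ)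

/-- `∃ v₀ [IOb(v₀) ∧ ∀ v₁ (E(v₁) ↔ [IOb(v₁) ∧ (v₀ and v₁ are mutually stationary)])]` -/
def axPrimitiveEther (S : Type u) : Formula (kinLangE S) :=
  .ex 0 (.and ((KForm.IOb 0 2).incl (kinLang_subset_kinLangE S))
    (.all 1 (.iff (isE 1)
      (.and ((KForm.IOb 1 2).incl (kinLang_subset_kinLangE S))
        ((Kin.stationary 0 1 2).incl (kinLang_subset_kinLangE S))))))

/-- Relativistic kinematics extended by the primitive concept `E` of absolute rest. -/
def specRelE (S : Type u) : Theory S where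
  lang := kinLangE S
  axs := Formula.incl (kinLang_subset_kinLangE S) '' (specRel S).axs ∪ {axPrimitiveEther S}

/-!
Both theories are theories of *frames*. With respect to an observer `e` for whom light has a speed
`c`, the coordinate system of an observer `k` is given by an origin `o k`, a velocity `w k` and a
"trivial" transformation `ρ k`, an isometry of time and space, and all that is left is a world line
for every body that is not an observer. In a relativistic model the coordinate transformation from
`k` to `e` is `x ↦ o k + lor c (w k) (ρ k x)`, where `lor c w` is the Lorentz involution that maps
the time axis to the world line with four-velocity `(γ, w)`; in a classical model it is
`x ↦ o k + gal (w k) (ρ k x)` with the Galilean involution of velocity `w`. Since the velocities in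
a frame range over all vectors of space, the same frames occur in both cases:

* Every frame yields a model of either theory (`Frame.Good.classicalAxioms`,
  `Frame.Good.relativisticAxioms`).
* Every model comes from a frame (`ClassicalAxioms.exists_frame`,
  `RelativisticAxioms.exists_frame`). In the relativistic case the transformations preserve the
  relation "connected by light", from which linearity follows over an arbitrary Euclidean field
  because straight world lines of observers and the distances of simultaneous events are preserved
  as well (`Coord.NullPreserving.exists_linear`).

So a model of one theory turns into a model of the other one by exchanging the two families of
boosts. The exchange is definable by formulas from the observer `e` (`Frame.Good.otherW_iff`), and
its result does not depend on the choice of `e` among the observers of velocity zero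
(`Frame.Good.exists_rebase`, because trivial transformations permute the boosts of either family).
In a classical model these observers are definable: they are the ether observers
(`Frame.Good.exists_lightSpeed_iff`). In a relativistic model they are singled out by the symbol
`E`. This gives the definitional equivalence `definitionallyEquivalent_specRelE_classicalKin`, and
as a rest frame can be chosen in every relativistic model, the extension by `E` is conservative.
Hence the distance is at most one.

The distance is not zero, as `classicalKin` and `specRel` are not definitionally equivalent.
Definitionally equivalent theories have models with the same automorphisms on the same sets
(`DefinitionallyEquivalent.exists_model`). In the relativistic model in which the observers are all
Poincaré transformations, some boost `x` maps a null vector to its double, so that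
`x y x⁻¹ = y ^ 2` for the translation `y` by this vector. Both are products of two involutive
automorphisms, and an involutive automorphism fixes all quantities, whatever the quantities of the
classical model on the same set are. In the classical model, `x` and `y` act on the coordinates of
an ether observer as isometries of time and space, for which the relation implies `y ^ 3 = 1`
(`Coord.IsTrivial.iterate_three_eq`). Thus `y ^ 3` preserves all events of the classical model, and
exchanging a body with its image under `y ^ 3` is an automorphism
(`isAut_swap_of_classicalKin`). In the relativistic model it is not.
-/

/-! ### Structures for the language of kinematics -/

/-- The relations of a structure for the language of kinematics with underlying set `M`. -/
@[ext]
structure KinStr (M : Type*) where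
  B : M → Prop
  Q : M → Prop
  IOb : M → Prop
  Ph : M → Prop
  plus : M → M → M → Prop
  times : M → M → M → Prop
  le : M → M → Prop
  W : M → M → M → M → M → M → Prop

namespace KinStr

variable {S M : Type u}

/-- The model with the relations of `A`. -/
def interp (S : Type u) (A : KinStr M) : Interp (kinLang S) M := fun R =>
  match R with
  | ⟨.kin .B, _⟩ => {a : Fin 1 → M | A.B (a 0)}
  | ⟨.kin .Q, _⟩ => {a : Fin 1 → M | A.Q (a 0)}
  | ⟨.kin .IOb, _⟩ => {a : Fin 1 → M | A.IOb (a 0)}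
  | ⟨.kin .Ph, _⟩ => {a : Fin 1 → M | A.Ph (a 0)}
  | ⟨.kin .plus, _⟩ => {a : Fin 3 → M | A.plus (a 0) (a 1) (a 2)}
  | ⟨.kin .times, _⟩ => {a : Fin 3 → M | A.times (a 0) (a 1) (a 2)}
  | ⟨.kin .le, _⟩ => {a : Fin 2 → M | A.le (a 0) (a 1)}
  | ⟨.kin .W, _⟩ => {a : Fin 6 → M | A.W (a 0) (a 1) (a 2) (a 3) (a 4) (a 5)}
  | ⟨.kin .E, _⟩ => ∅
  | ⟨.other _ _, _⟩ => ∅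

theorem kin_mem {s : KinSymbol} (h : s ≠ .E) : (RelSymbol.kin s : RelSymbol S) ∈ kinLang S :=
  ⟨s, h, rfl⟩

/-- The relations of a model. -/
def ofInterp (I : Interp (kinLang S) M) : KinStr M where
  B a := (![a] : Fin 1 → M) ∈ I ⟨.kin .B, kin_mem (by simp)⟩
  Q a := (![a] : Fin 1 → M) ∈ I ⟨.kin .Q, kin_mem (by simp)⟩
  IOb a := (![a] : Fin 1 → M) ∈ I ⟨.kin .IOb, kin_mem (by simp)⟩
  Ph a := (![a] : Fin 1 → M) ∈ I ⟨.kin .Ph, kin_mem (by simp)⟩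
  plus a b c := (![a, b, c] : Fin 3 → M) ∈ I ⟨.kin .plus, kin_mem (by simp)⟩
  times a b c := (![a, b, c] : Fin 3 → M) ∈ I ⟨.kin .times, kin_mem (by simp)⟩
  le a b := (![a, b] : Fin 2 → M) ∈ I ⟨.kin .le, kin_mem (by simp)⟩
  W k b x₀ x₁ x₂ x₃ := (![k, b, x₀, x₁, x₂, x₃] : Fin 6 → M) ∈ I ⟨.kin .W, kin_mem (by simp)⟩

theorem vec_eta₁ (a : Fin 1 → M) : ![a 0] = a := by ext i; fin_cases i; rfl
theorem vec_eta₂ (a : Fin 2 → M) : ![a 0, a 1] = a := by ext i; fin_cases i <;> rfl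
theorem vec_eta₃ (a : Fin 3 → M) : ![a 0, a 1, a 2] = a := by ext i; fin_cases i <;> rfl
theorem vec_eta₆ (a : Fin 6 → M) : ![a 0, a 1, a 2, a 3, a 4, a 5] = a := by
  ext i; fin_cases i <;> rfl

theorem interp_ofInterp (I : Interp (kinLang S) M) : interp S (ofInterp I) = I := by
  funext R
  obtain ⟨R, s, hs, rfl⟩ := R
  cases s
  case E => exact absurd rfl hs
  case B => ext a; exact iff_of_eq (congrArg (· ∈ I ⟨_, _⟩) (vec_eta₁ a))
  case Q => ext a; exact iff_of_eq (congrArg (· ∈ I ⟨_, _⟩) (vec_eta₁ a))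
  case IOb => ext a; exact iff_of_eq (congrArg (· ∈ I ⟨_, _⟩) (vec_eta₁ a))
  case Ph => ext a; exact iff_of_eq (congrArg (· ∈ I ⟨_, _⟩) (vec_eta₁ a))
  case plus => ext a; exact iff_of_eq (congrArg (· ∈ I ⟨_, _⟩) (vec_eta₃ a))
  case times => ext a; exact iff_of_eq (congrArg (· ∈ I ⟨_, _⟩) (vec_eta₃ a))
  case le => ext a; exact iff_of_eq (congrArg (· ∈ I ⟨_, _⟩) (vec_eta₂ a))
  case W => ext a; exact iff_of_eq (congrArg (· ∈ I ⟨_, _⟩) (vec_eta₆ a))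

end KinStr

/-! ### The meaning of the formulas of kinematics -/

section Semantics

open KForm

variable {S M : Type u} {I : Interp (kinLang S) M} {τ : ℕ → M} {n : ℕ}

theorem sat_conj {φ ψ : KForm S} : Sat I τ ((φ ⋏ ψ) n) ↔ Sat I τ (φ n) ∧ Sat I τ (ψ n) := Iff.rfl

theorem sat_neg {φ : KForm S} : Sat I τ (neg φ n) ↔ ¬ Sat I τ (φ n) := Iff.rfl

theorem sat_disj {φ ψ : KForm S} : Sat I τ ((φ ⋎ ψ) n) ↔ Sat I τ (φ n) ∨ Sat I τ (ψ n) := by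
  simp only [disj, Formula.or, Sat]; tauto

theorem sat_impl {φ ψ : KForm S} : Sat I τ ((φ ⇒ᶠ ψ) n) ↔ (Sat I τ (φ n) → Sat I τ (ψ n)) := by
  simp only [impl, Formula.imp, Sat]; tauto

theorem sat_equi {φ ψ : KForm S} : Sat I τ ((φ ⇔ᶠ ψ) n) ↔ (Sat I τ (φ n) ↔ Sat I τ (ψ n)) :=
  sat_iff I τ _ _

theorem sat_all {f : ℕ → KForm S} :
    Sat I τ (all f n) ↔ ∀ a, Sat I (Function.update τ n a) (f n (n + 1)) := by
  simp only [all, Formula.all, Sat]; push Not; rfl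

theorem sat_ex {f : ℕ → KForm S} :
    Sat I τ (KForm.ex f n) ↔ ∃ a, Sat I (Function.update τ n a) (f n (n + 1)) := Iff.rfl

theorem sat_same {i j : ℕ} : Sat I τ ((same i j : KForm S) n) ↔ τ i = τ j := Iff.rfl

variable {A : KinStr M} {i j k : ℕ}

theorem sat_isB : Sat (A.interp S) τ ((isB i : KForm S) n) ↔ A.B (τ i) := Iff.rfl
theorem sat_isQ : Sat (A.interp S) τ ((isQ i : KForm S) n) ↔ A.Q (τ i) := Iff.rfl
theorem sat_IOb : Sat (A.interp S) τ ((IOb i : KForm S) n) ↔ A.IOb (τ i) := Iff.rfl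
theorem sat_Ph : Sat (A.interp S) τ ((Ph i : KForm S) n) ↔ A.Ph (τ i) := Iff.rfl
theorem sat_plus : Sat (A.interp S) τ ((plus i j k : KForm S) n) ↔ A.plus (τ i) (τ j) (τ k) :=
  Iff.rfl
theorem sat_times : Sat (A.interp S) τ ((times i j k : KForm S) n) ↔ A.times (τ i) (τ j) (τ k) :=
  Iff.rfl
theorem sat_le : Sat (A.interp S) τ ((le i j : KForm S) n) ↔ A.le (τ i) (τ j) := Iff.rfl
theorem sat_W {x : Fin 4 → ℕ} : Sat (A.interp S) τ ((KForm.W k i x : KForm S) n) ↔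
    A.W (τ k) (τ i) (τ (x 0)) (τ (x 1)) (τ (x 2)) (τ (x 3)) := Iff.rfl

theorem sat_allB {f : ℕ → KForm S} : Sat (A.interp S) τ (allB f n) ↔
    ∀ a, A.B a → Sat (A.interp S) (Function.update τ n a) (f n (n + 1)) := by
  simp only [allB, sat_all, sat_impl, sat_isB, Function.update_self]

theorem sat_exB {f : ℕ → KForm S} : Sat (A.interp S) τ (exB f n) ↔
    ∃ a, A.B a ∧ Sat (A.interp S) (Function.update τ n a) (f n (n + 1)) := by
  simp only [exB, sat_ex, sat_conj, sat_isB, Function.update_self]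

theorem sat_allO {f : ℕ → KForm S} (hB : ∀ a, A.IOb a → A.B a) : Sat (A.interp S) τ (allO f n) ↔
    ∀ a, A.IOb a → Sat (A.interp S) (Function.update τ n a) (f n (n + 1)) := by
  simp only [allO, sat_allB, sat_impl, sat_IOb, Function.update_self]
  exact ⟨fun h a ha => h a (hB a ha) ha, fun h a _ ha => h a ha⟩

theorem sat_exO {f : ℕ → KForm S} (hB : ∀ a, A.IOb a → A.B a) : Sat (A.interp S) τ (exO f n) ↔
    ∃ a, A.IOb a ∧ Sat (A.interp S) (Function.update τ n a) (f n (n + 1)) := by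
  simp only [exO, sat_exB, sat_conj, sat_IOb, Function.update_self]
  exact ⟨fun ⟨a, _, ha⟩ => ⟨a, ha⟩, fun ⟨a, ha⟩ => ⟨a, hB a ha.1, ha⟩⟩

theorem sat_allQ {f : ℕ → KForm S} : Sat (A.interp S) τ (allQ f n) ↔
    ∀ a, A.Q a → Sat (A.interp S) (Function.update τ n a) (f n (n + 1)) := by
  simp only [allQ, sat_all, sat_impl, sat_isQ, Function.update_self]

theorem sat_exQ {f : ℕ → KForm S} : Sat (A.interp S) τ (exQ f n) ↔
    ∃ a, A.Q a ∧ Sat (A.interp S) (Function.update τ n a) (f n (n + 1)) := by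
  simp only [exQ, sat_ex, sat_conj, sat_isQ, Function.update_self]

end Semantics

/-! ### The field of quantities -/

/-- An isomorphism from `K`, with its addition, multiplication and order, onto the quantities of the
structure `A`. -/
structure Quantities {M : Type u} (A : KinStr M) (K : Type u) [Add K] [Mul K] [LE K] where
  ι : K → M
  inj : Function.Injective ι
  Q_iff : ∀ a, A.Q a ↔ ∃ x, ι x = a
  plus_iff : ∀ a b c, A.plus a b c ↔ ∃ x y, ι x = a ∧ ι y = b ∧ ι (x + y) = c
  times_iff : ∀ a b c, A.times a b c ↔ ∃ x y, ι x = a ∧ ι y = b ∧ ι (x * y) = c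
  le_iff : ∀ a b, A.le a b ↔ ∃ x y, ι x = a ∧ ι y = b ∧ x ≤ y

namespace Quantities

open KForm

variable {S M K : Type u} [Add K] [Mul K] [LE K] {A : KinStr M} (q : Quantities A K)

/-- The quantity as an element of `K`; a junk value for objects that are not quantities. -/
noncomputable def val [Nonempty K] (a : M) : K := Function.invFun q.ι a

@[simp] theorem val_ι [Nonempty K] (x : K) : q.val (q.ι x) = x :=
  Function.leftInverse_invFun q.inj x

theorem Q_ι (x : K) : A.Q (q.ι x) := (q.Q_iff _).2 ⟨x, rfl⟩

theorem ι_val [Nonempty K] {a : M} (h : A.Q a) : q.ι (q.val a) = a := by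
  obtain ⟨x, rfl⟩ := (q.Q_iff a).1 h
  simp

theorem forall_Q {p : M → Prop} : (∀ a, A.Q a → p a) ↔ ∀ x, p (q.ι x) :=
  ⟨fun h x => h _ (q.Q_ι x), fun h a ha => by obtain ⟨x, rfl⟩ := (q.Q_iff a).1 ha; exact h x⟩

theorem exists_Q {p : M → Prop} : (∃ a, A.Q a ∧ p a) ↔ ∃ x, p (q.ι x) :=
  ⟨fun ⟨a, ha, h⟩ => by obtain ⟨x, rfl⟩ := (q.Q_iff a).1 ha; exact ⟨x, h⟩,
    fun ⟨x, h⟩ => ⟨_, q.Q_ι x, h⟩⟩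

theorem plus_ι (x y z : K) : A.plus (q.ι x) (q.ι y) (q.ι z) ↔ x + y = z := by
  rw [q.plus_iff]
  exact ⟨fun ⟨a, b, ha, hb, h⟩ => by rw [← q.inj ha, ← q.inj hb, q.inj h],
    fun h => ⟨x, y, rfl, rfl, by rw [h]⟩⟩

theorem times_ι (x y z : K) : A.times (q.ι x) (q.ι y) (q.ι z) ↔ x * y = z := by
  rw [q.times_iff]
  exact ⟨fun ⟨a, b, ha, hb, h⟩ => by rw [← q.inj ha, ← q.inj hb, q.inj h],
    fun h => ⟨x, y, rfl, rfl, by rw [h]⟩⟩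

theorem le_ι (x y : K) : A.le (q.ι x) (q.ι y) ↔ x ≤ y := by
  rw [q.le_iff]
  exact ⟨fun ⟨a, b, ha, hb, h⟩ => by rwa [← q.inj ha, ← q.inj hb], fun h => ⟨x, y, rfl, rfl, h⟩⟩

theorem sat_allQ {τ : ℕ → M} {n : ℕ} {f : ℕ → KForm S} : Sat (A.interp S) τ (allQ f n) ↔
    ∀ x, Sat (A.interp S) (Function.update τ n (q.ι x)) (f n (n + 1)) := by
  rw [_root_.sat_allQ, q.forall_Q]

theorem sat_exQ {τ : ℕ → M} {n : ℕ} {f : ℕ → KForm S} : Sat (A.interp S) τ (exQ f n) ↔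
    ∃ x, Sat (A.interp S) (Function.update τ n (q.ι x)) (f n (n + 1)) := by
  rw [_root_.sat_exQ, q.exists_Q]

end Quantities

/-- The variables of the term `t` are less than `n` and denote quantities. -/
def Tm.Good {M : Type u} (A : KinStr M) (τ : ℕ → M) (n : ℕ) : Tm → Prop
  | .v i => i < n ∧ A.Q (τ i)
  | .zero => True
  | .one => True
  | .add s t => Tm.Good A τ n s ∧ Tm.Good A τ n t
  | .sub s t => Tm.Good A τ n s ∧ Tm.Good A τ n t
  | .mul s t => Tm.Good A τ n s ∧ Tm.Good A τ n t

section TermSemantics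

variable {S M K : Type u} [Field K] [LinearOrder K] {A : KinStr M} (q : Quantities A K)

/-- The value of a term under an assignment. -/
noncomputable def Quantities.eval (q : Quantities A K) (τ : ℕ → M) : Tm → K
  | .v i => q.val (τ i)
  | .zero => 0
  | .one => 1
  | .add s t => Quantities.eval q τ s + Quantities.eval q τ t
  | .sub s t => Quantities.eval q τ s - Quantities.eval q τ t
  | .mul s t => Quantities.eval q τ s * Quantities.eval q τ t

theorem Tm.Good.mono {τ : ℕ → M} {n m : ℕ} {t : Tm} (h : t.Good A τ n) (hnm : n ≤ m) :
    t.Good A τ m := by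
  induction t with
  | v i => exact ⟨h.1.trans_le hnm, h.2⟩
  | zero => trivial
  | one => trivial
  | add s t hs ht => exact ⟨hs h.1, ht h.2⟩
  | sub s t hs ht => exact ⟨hs h.1, ht h.2⟩
  | mul s t hs ht => exact ⟨hs h.1, ht h.2⟩

theorem Tm.Good.update {τ : ℕ → M} {n : ℕ} {t : Tm} (h : t.Good A τ n) (a : M) :
    t.Good A (Function.update τ n a) n := by
  induction t with
  | v i => exact ⟨h.1, by rw [Function.update_of_ne (Nat.ne_of_lt h.1)]; exact h.2⟩
  | zero => trivial
  | one => trivial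
  | add s t hs ht => exact ⟨hs h.1, ht h.2⟩
  | sub s t hs ht => exact ⟨hs h.1, ht h.2⟩
  | mul s t hs ht => exact ⟨hs h.1, ht h.2⟩

theorem Quantities.eval_update {τ : ℕ → M} {n : ℕ} {t : Tm} (h : t.Good A τ n) (a : M) :
    q.eval (Function.update τ n a) t = q.eval τ t := by
  induction t with
  | v i => simp only [eval, Function.update_of_ne (Nat.ne_of_lt h.1)]
  | zero => rfl
  | one => rfl
  | add s t hs ht => simp only [eval, hs h.1, ht h.2]
  | sub s t hs ht => simp only [eval, hs h.1, ht h.2]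
  | mul s t hs ht => simp only [eval, hs h.1, ht h.2]

theorem Tm.Good.update₂ {τ : ℕ → M} {n : ℕ} {t : Tm} (h : t.Good A τ n) (a b : M) :
    t.Good A (Function.update (Function.update τ n a) (n + 1) b) (n + 1 + 1) :=
  ((((h.update a).mono (Nat.le_succ n)).update b).mono (Nat.le_succ _))

theorem Quantities.eval_update₂ {τ : ℕ → M} {n : ℕ} {t : Tm} (h : t.Good A τ n) (a b : M) :
    q.eval (Function.update (Function.update τ n a) (n + 1) b) t = q.eval τ t := by
  rw [q.eval_update ((h.update a).mono (Nat.le_succ n)), q.eval_update h]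

theorem update₂_zero {τ : ℕ → M} {n : ℕ} (a b : M) :
    Function.update (Function.update τ n a) (n + 1) b n = a := by
  rw [Function.update_of_ne (by omega), Function.update_self]

theorem update₂_lt {τ : ℕ → M} {n i : ℕ} (h : i < n) (a b : M) :
    Function.update (Function.update τ n a) (n + 1) b i = τ i := by
  rw [Function.update_of_ne (by omega), Function.update_of_ne (by omega)]

/-- The formula `valueIs t z` has its intended meaning, because its quantifiers bind variables that do
not occur in `t`. -/
theorem Quantities.sat_valueIs (t : Tm) : ∀ {τ : ℕ → M} {n z : ℕ} {x : K}, t.Good A τ n → z < n →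
    τ z = q.ι x → (Sat (A.interp S) τ ((t.valueIs z : KForm S) n) ↔ q.eval τ t = x) := by
  induction t with
  | v i =>
    intro τ n z x h hz hx
    obtain ⟨y, hy⟩ := (q.Q_iff _).1 h.2
    simp only [Tm.valueIs, sat_same, eval, hx, ← hy, q.val_ι, q.inj.eq_iff]
  | zero =>
    intro τ n z x h hz hx
    simp only [Tm.valueIs, sat_plus, eval, hx, q.plus_ι]
    constructor <;> intro h <;> linear_combination -h
  | one =>
    intro τ n z x h hz hx
    simp only [Tm.valueIs, sat_conj, sat_neg, sat_plus, sat_times, eval, hx, q.plus_ι, q.times_ι]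
    constructor
    · rintro ⟨h₁, h₂⟩
      have h₃ : x ≠ 0 := fun h => h₂ (by rw [h, add_zero])
      exact (mul_left_cancel₀ h₃ (by rw [h₁, mul_one])).symm
    · rintro rfl
      simp
  | add s t hs ht =>
    intro τ n z x h hz hx
    simp only [Tm.valueIs, q.sat_exQ, sat_conj, sat_plus]
    constructor
    · rintro ⟨a, b, ha, hb, hab⟩
      rw [hs (x := a) (h.1.update₂ _ _) (by omega) (update₂_zero _ _), q.eval_update₂ h.1] at ha
      rw [ht (x := b) (h.2.update₂ _ _) (by omega) (Function.update_self ..),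
        q.eval_update₂ h.2] at hb
      rw [update₂_zero, Function.update_self, update₂_lt hz, hx, q.plus_ι] at hab
      rw [eval, ha, hb, hab]
    · rintro rfl
      refine ⟨q.eval τ s, q.eval τ t, ?_, ?_, ?_⟩
      · rw [hs (x := q.eval τ s) (h.1.update₂ _ _) (by omega) (update₂_zero _ _),
          q.eval_update₂ h.1]
      · rw [ht (x := q.eval τ t) (h.2.update₂ _ _) (by omega) (Function.update_self ..),
          q.eval_update₂ h.2]
      · rw [update₂_zero, Function.update_self, update₂_lt hz, hx, q.plus_ι, eval]
  | sub s t hs ht =>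
    intro τ n z x h hz hx
    simp only [Tm.valueIs, q.sat_exQ, sat_conj, sat_plus]
    constructor
    · rintro ⟨a, b, ha, hb, hab⟩
      rw [hs (x := a) (h.1.update₂ _ _) (by omega) (update₂_zero _ _), q.eval_update₂ h.1] at ha
      rw [ht (x := b) (h.2.update₂ _ _) (by omega) (Function.update_self ..),
        q.eval_update₂ h.2] at hb
      rw [update₂_zero, Function.update_self, update₂_lt hz, hx, q.plus_ι] at hab
      rw [eval, ha, hb, ← hab, add_sub_cancel_right]
    · rintro rfl
      refine ⟨q.eval τ s, q.eval τ t, ?_, ?_, ?_⟩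
      · rw [hs (x := q.eval τ s) (h.1.update₂ _ _) (by omega) (update₂_zero _ _),
          q.eval_update₂ h.1]
      · rw [ht (x := q.eval τ t) (h.2.update₂ _ _) (by omega) (Function.update_self ..),
          q.eval_update₂ h.2]
      · rw [update₂_zero, Function.update_self, update₂_lt hz, hx, q.plus_ι, eval, sub_add_cancel]
  | mul s t hs ht =>
    intro τ n z x h hz hx
    simp only [Tm.valueIs, q.sat_exQ, sat_conj, sat_times]
    constructor
    · rintro ⟨a, b, ha, hb, hab⟩
      rw [hs (x := a) (h.1.update₂ _ _) (by omega) (update₂_zero _ _), q.eval_update₂ h.1] at ha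
      rw [ht (x := b) (h.2.update₂ _ _) (by omega) (Function.update_self ..),
        q.eval_update₂ h.2] at hb
      rw [update₂_zero, Function.update_self, update₂_lt hz, hx, q.times_ι] at hab
      rw [eval, ha, hb, hab]
    · rintro rfl
      refine ⟨q.eval τ s, q.eval τ t, ?_, ?_, ?_⟩
      · rw [hs (x := q.eval τ s) (h.1.update₂ _ _) (by omega) (update₂_zero _ _),
          q.eval_update₂ h.1]
      · rw [ht (x := q.eval τ t) (h.2.update₂ _ _) (by omega) (Function.update_self ..),
          q.eval_update₂ h.2]
      · rw [update₂_zero, Function.update_self, update₂_lt hz, hx, q.times_ι, eval]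

theorem Quantities.sat_eqF {s t : Tm} {τ : ℕ → M} {n : ℕ} (hs : s.Good A τ n)
    (ht : t.Good A τ n) :
    Sat (A.interp S) τ ((s ≐ t : KForm S) n) ↔ q.eval τ s = q.eval τ t := by
  simp only [Tm.eqF, q.sat_exQ, sat_conj]
  have key (x : K) {t : Tm} (ht : t.Good A τ n) := q.sat_valueIs (S := S) t (x := x)
    ((ht.update (q.ι x)).mono (Nat.le_succ n)) (Nat.lt_succ_self n) (Function.update_self ..)
  simp only [key _ hs, key _ ht, q.eval_update hs, q.eval_update ht]
  exact ⟨fun ⟨x, h, h'⟩ => h.trans h'.symm, fun h => ⟨_, h, rfl⟩⟩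

theorem Quantities.sat_leF {s t : Tm} {τ : ℕ → M} {n : ℕ} (hs : s.Good A τ n)
    (ht : t.Good A τ n) :
    Sat (A.interp S) τ ((s ≼ᶠ t : KForm S) n) ↔ q.eval τ s ≤ q.eval τ t := by
  simp only [Tm.leF, q.sat_exQ, sat_conj, sat_le]
  have key (x y : K) := q.sat_valueIs (S := S) s (x := x)
    (hs.update₂ (q.ι x) (q.ι y)) (show n < n + 1 + 1 by omega) (update₂_zero _ _)
  have key' (x y : K) := q.sat_valueIs (S := S) t (x := y)
    (ht.update₂ (q.ι x) (q.ι y)) (show n + 1 < n + 1 + 1 by omega) (Function.update_self ..)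
  simp only [key, key', q.eval_update₂ hs, q.eval_update₂ ht, update₂_zero, Function.update_self,
    q.le_ι]
  exact ⟨fun ⟨x, y, h, h', hxy⟩ => by rwa [h, h'], fun h => ⟨_, _, rfl, rfl, h⟩⟩

theorem Quantities.sat_ltF {s t : Tm} {τ : ℕ → M} {n : ℕ} (hs : s.Good A τ n)
    (ht : t.Good A τ n) :
    Sat (A.interp S) τ ((s ≺ᶠ t : KForm S) n) ↔ q.eval τ s < q.eval τ t := by
  simp only [Tm.ltF, sat_conj, sat_neg, q.sat_leF hs ht, q.sat_eqF hs ht]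
  exact lt_iff_le_and_ne.symm

theorem Tm.good_v {τ : ℕ → M} {n i : ℕ} : (Tm.v i).Good A τ n ↔ i < n ∧ A.Q (τ i) := Iff.rfl
theorem Tm.good_zero {τ : ℕ → M} {n : ℕ} : (0 : Tm).Good A τ n ↔ True := Iff.rfl
theorem Tm.good_one {τ : ℕ → M} {n : ℕ} : (1 : Tm).Good A τ n ↔ True := Iff.rfl
theorem Tm.good_add {τ : ℕ → M} {n : ℕ} {s t : Tm} :
    (s + t).Good A τ n ↔ s.Good A τ n ∧ t.Good A τ n := Iff.rfl
theorem Tm.good_sub {τ : ℕ → M} {n : ℕ} {s t : Tm} :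
    (s - t).Good A τ n ↔ s.Good A τ n ∧ t.Good A τ n := Iff.rfl
theorem Tm.good_mul {τ : ℕ → M} {n : ℕ} {s t : Tm} :
    (s * t).Good A τ n ↔ s.Good A τ n ∧ t.Good A τ n := Iff.rfl
theorem Tm.good_sq {τ : ℕ → M} {n : ℕ} {t : Tm} :
    (Tm.sq t).Good A τ n ↔ t.Good A τ n := and_self_iff

theorem Quantities.eval_v {τ : ℕ → M} {i : ℕ} : q.eval τ (Tm.v i) = q.val (τ i) := rfl
theorem Quantities.eval_zero {τ : ℕ → M} : q.eval τ 0 = 0 := rfl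
theorem Quantities.eval_one {τ : ℕ → M} : q.eval τ 1 = 1 := rfl
theorem Quantities.eval_add {τ : ℕ → M} {s t : Tm} :
    q.eval τ (s + t) = q.eval τ s + q.eval τ t := rfl
theorem Quantities.eval_sub {τ : ℕ → M} {s t : Tm} :
    q.eval τ (s - t) = q.eval τ s - q.eval τ t := rfl
theorem Quantities.eval_mul {τ : ℕ → M} {s t : Tm} :
    q.eval τ (s * t) = q.eval τ s * q.eval τ t := rfl
theorem Quantities.eval_sq {τ : ℕ → M} {t : Tm} :
    q.eval τ (Tm.sq t) = q.eval τ t ^ 2 := (pow_two _).symm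

end TermSemantics

/-! ### Minkowski geometry over a Euclidean field -/

/-- Non-negative elements have square roots. -/
class IsEuclidean (K : Type*) [Field K] [LinearOrder K] : Prop where
  exists_sq : ∀ x : K, 0 ≤ x → ∃ y, y ^ 2 = x

namespace Coord

variable {K : Type*} [Field K]

/-- The unit vector of the time axis. -/
def timeUnit : Fin 4 → K := ![1, 0, 0, 0]

/-- The product of the spatial parts of coordinate points. -/
def sdot (x y : Fin 4 → K) : K := x 1 * y 1 + x 2 * y 2 + x 3 * y 3

/-- The squared length of the spatial part of a coordinate point. -/
def space (x : Fin 4 → K) : K := x 1 ^ 2 + x 2 ^ 2 + x 3 ^ 2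

/-- The Minkowski product for the speed of light `c`, of signature `(+, -, -, -)`. -/
def mprod (c : K) (x y : Fin 4 → K) : K := c ^ 2 * x 0 * y 0 - sdot x y

/-- The quadratic form of the Minkowski product. -/
def mink (c : K) (x : Fin 4 → K) : K := c ^ 2 * x 0 ^ 2 - space x

theorem timeUnit_zero : (timeUnit : Fin 4 → K) 0 = 1 := rfl
theorem timeUnit_one : (timeUnit : Fin 4 → K) 1 = 0 := rfl
theorem timeUnit_two : (timeUnit : Fin 4 → K) 2 = 0 := rfl
theorem timeUnit_three : (timeUnit : Fin 4 → K) 3 = 0 := rfl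

theorem mink_add (c : K) (x y : Fin 4 → K) :
    mink c (x + y) = mink c x + 2 * mprod c x y + mink c y := by
  simp only [mink, mprod, space, sdot, Pi.add_apply]; ring

theorem mink_sub (c : K) (x y : Fin 4 → K) :
    mink c (x - y) = mink c x - 2 * mprod c x y + mink c y := by
  simp only [mink, mprod, space, sdot, Pi.sub_apply]; ring

theorem mink_smul (c a : K) (x : Fin 4 → K) : mink c (a • x) = a ^ 2 * mink c x := by
  simp only [mink, space, Pi.smul_apply, smul_eq_mul]; ring

theorem mink_neg (c : K) (x : Fin 4 → K) : mink c (-x) = mink c x := by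
  simp only [mink, space, Pi.neg_apply]; ring

theorem mink_sub_comm (c : K) (x y : Fin 4 → K) : mink c (x - y) = mink c (y - x) := by
  rw [← mink_neg, neg_sub]

theorem mprod_sub_right (c : K) (x y z : Fin 4 → K) :
    mprod c z (x - y) = mprod c z x - mprod c z y := by
  simp only [mprod, sdot, Pi.sub_apply]; ring

theorem mprod_add_right (c : K) (x y z : Fin 4 → K) :
    mprod c z (x + y) = mprod c z x + mprod c z y := by
  simp only [mprod, sdot, Pi.add_apply]; ring

theorem mprod_smul_left (c a : K) (x y : Fin 4 → K) : mprod c (a • x) y = a * mprod c x y := by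
  simp only [mprod, sdot, Pi.smul_apply, smul_eq_mul]; ring

theorem mprod_smul_right (c a : K) (x y : Fin 4 → K) : mprod c x (a • y) = a * mprod c x y := by
  simp only [mprod, sdot, Pi.smul_apply, smul_eq_mul]; ring

theorem mprod_self (c : K) (x : Fin 4 → K) : mprod c x x = mink c x := by
  simp only [mprod, mink, space, sdot]; ring

theorem mprod_comm (c : K) (x y : Fin 4 → K) : mprod c x y = mprod c y x := by
  simp only [mprod, sdot]; ring

theorem space_neg (x : Fin 4 → K) : space (-x) = space x := by
  simp only [space, Pi.neg_apply]; ring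

theorem space_add (x y : Fin 4 → K) : space (x + y) = space x + 2 * sdot x y + space y := by
  simp only [space, sdot, Pi.add_apply]; ring

theorem space_smul (a : K) (x : Fin 4 → K) : space (a • x) = a ^ 2 * space x := by
  simp only [space, Pi.smul_apply, smul_eq_mul]; ring

/-- A map preserving the relation "connected by a light signal" in both directions. -/
structure NullPreserving (c : K) (f : (Fin 4 → K) → (Fin 4 → K)) : Prop where
  bij : Function.Bijective f
  null_iff : ∀ x y, mink c (f x - f y) = 0 ↔ mink c (x - y) = 0

theorem NullPreserving.symm_of {c : K} {f : (Fin 4 → K) → (Fin 4 → K)}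
    (hf : NullPreserving c f) : ∃ g, NullPreserving c g ∧ (∀ x, f (g x) = x) ∧
    ∀ x, g (f x) = x := by
  let e := Equiv.ofBijective f hf.bij
  refine ⟨e.symm, ⟨e.symm.bijective, fun x y => ?_⟩, e.apply_symm_apply, e.symm_apply_apply⟩
  rw [← hf.null_iff]
  have h (x) : f (e.symm x) = x := e.apply_symm_apply x
  rw [h, h]

variable [LinearOrder K] [IsStrictOrderedRing K]

theorem sum_sq_eq_zero {x y z : K} (h : x ^ 2 + y ^ 2 + z ^ 2 = 0) : x = 0 ∧ y = 0 ∧ z = 0 := by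
  refine ⟨?_, ?_, ?_⟩ <;> nlinarith [sq_nonneg x, sq_nonneg y, sq_nonneg z]

theorem space_nonneg (x : Fin 4 → K) : 0 ≤ space x := by
  unfold space; positivity

/-- A vector with vanishing temporal and spatial part is zero. -/
theorem eq_zero_of_space {x : Fin 4 → K} (h₀ : x 0 = 0) (h : space x = 0) : x = 0 := by
  obtain ⟨h₁, h₂, h₃⟩ := sum_sq_eq_zero h
  ext i; fin_cases i <;> assumption

theorem time_ne_zero_of_null {c : K} {u : Fin 4 → K} (hu : mink c u = 0) (h : u ≠ 0) : u 0 ≠ 0 := by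
  intro h₀
  refine h (eq_zero_of_space h₀ ?_)
  have := hu
  simp only [mink, h₀] at this
  linear_combination -this

/-- Orthogonal lightlike vectors are parallel. -/
theorem exists_smul_of_null {c : K} {u v : Fin 4 → K} (hu : mink c u = 0) (h : u ≠ 0)
    (hv : mink c v = 0) (huv : mprod c u v = 0) : ∃ a : K, v = a • u := by
  have h₀ := time_ne_zero_of_null hu h
  refine ⟨v 0 / u 0, sub_eq_zero.1 (eq_zero_of_space ?_ ?_)⟩
  · simp [h₀]
  · have h₁ : mink c (v - (v 0 / u 0) • u) = 0 := by
      rw [mink_sub, mink_smul, hu, hv, mprod_smul_right, mprod_comm, huv]; ring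
    have h₂ : (v - (v 0 / u 0) • u) 0 = 0 := by simp [h₀]
    simp only [mink, h₂] at h₁
    linear_combination -h₁

/-- Every lightlike vector is a combination of three lightlike vectors not parallel to it. -/
theorem exists_null_sum {c : K} (hc : 0 < c) {u : Fin 4 → K} (hu : mink c u = 0)
    (h : u ≠ 0) : ∃ x y z : Fin 4 → K, u = x + y - z ∧ (mink c x = 0 ∧ mprod c u x ≠ 0) ∧
      (mink c y = 0 ∧ mprod c u y ≠ 0) ∧ (mink c z = 0 ∧ mprod c u z ≠ 0) := by
  have h₀ := time_ne_zero_of_null hu h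
  have h₀' : 0 < c ^ 2 * u 0 ^ 2 := by positivity
  have hu' : c ^ 2 * u 0 ^ 2 = u 1 ^ 2 + u 2 ^ 2 + u 3 ^ 2 := by
    simp only [mink, space] at hu; linear_combination hu
  by_cases hall : u 1 = u 2 ∧ u 2 = u 3
  · obtain ⟨h₁, h₂⟩ := hall
    refine ⟨![u 0, -u 1, u 2, u 3], ![u 0, u 1, -u 2, -u 3], ![u 0, -u 1, -u 2, -u 3], ?_, ?_⟩
    · ext i; fin_cases i <;> simp
    · simp only [mink, mprod, space, sdot, Matrix.cons_val, ← h₂, ← h₁]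
      rw [← h₂, ← h₁] at hu'
      refine ⟨⟨by linear_combination hu', fun h => ?_⟩, ⟨by linear_combination hu', fun h => ?_⟩,
        ⟨by linear_combination hu', fun h => ?_⟩⟩ <;> nlinarith
  · refine ⟨![u 0, u 2, u 3, u 1], ![u 0, -u 2, -u 3, -u 1], ![u 0, -u 1, -u 2, -u 3], ?_, ?_⟩
    · ext i; fin_cases i <;> simp
    · simp only [mink, mprod, space, sdot, Matrix.cons_val]
      refine ⟨⟨by linear_combination hu', fun h => hall ?_⟩,
        ⟨by linear_combination hu', fun h => hall ?_⟩, ⟨by linear_combination hu', fun h => ?_⟩⟩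
      · obtain ⟨h₁, h₂, h₃⟩ := sum_sq_eq_zero (x := u 1 - u 2) (y := u 2 - u 3) (z := u 3 - u 1)
          (by linear_combination 2 * h - 2 * hu')
        exact ⟨sub_eq_zero.1 h₁, sub_eq_zero.1 h₂⟩
      · obtain ⟨h₁, h₂, h₃⟩ := sum_sq_eq_zero (x := u 1 + u 2) (y := u 2 + u 3) (z := u 3 + u 1)
          (by linear_combination 2 * h - 2 * hu')
        constructor <;> linarith
      · linarith

/-- The lightlike vectors generate the additive group of all vectors. -/
theorem mem_of_null_mem {c : K} (hc : 0 < c) {P : Set (Fin 4 → K)}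
    (hadd : ∀ x ∈ P, ∀ y ∈ P, x + y ∈ P) (hnull : ∀ x, mink c x = 0 → x ∈ P) (w : Fin 4 → K) :
    w ∈ P := by
  have hw : w = (![w 0 / 2, c * w 0 / 2, 0, 0] + ![w 0 / 2, -(c * w 0 / 2), 0, 0]) +
      (![w 1 / (2 * c), w 1 / 2, 0, 0] + ![-(w 1 / (2 * c)), w 1 / 2, 0, 0]) +
      (![w 2 / (2 * c), 0, w 2 / 2, 0] + ![-(w 2 / (2 * c)), 0, w 2 / 2, 0]) +
      (![w 3 / (2 * c), 0, 0, w 3 / 2] + ![-(w 3 / (2 * c)), 0, 0, w 3 / 2]) := by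
    ext i; fin_cases i <;> simp
  rw [hw]
  have hc' := hc.ne'
  refine hadd _ (hadd _ (hadd _ (hadd _ ?_ _ ?_) _ (hadd _ ?_ _ ?_)) _ (hadd _ ?_ _ ?_)) _
    (hadd _ ?_ _ ?_) <;>
  · apply hnull
    simp only [mink, space, Matrix.cons_val]
    field_simp
    ring

namespace NullPreserving

variable {c : K} {f : (Fin 4 → K) → (Fin 4 → K)}

/-- The image of a point of the light line through `p` and `p + u`. -/
theorem map_line (hf : NullPreserving c f) (p : Fin 4 → K) {u : Fin 4 → K} (hu : mink c u = 0)
    (h : u ≠ 0) (a : K) : ∃ s : K, f (p + a • u) - f p = s • (f (p + u) - f p) := by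
  have h₁ : mink c (f (p + u) - f p) = 0 := by
    rw [hf.null_iff, add_sub_cancel_left, hu]
  have h₂ : f (p + u) - f p ≠ 0 := fun h₂ => h (by
    have := hf.bij.1 (sub_eq_zero.1 h₂)
    simpa using this)
  have h₃ : mink c (f (p + a • u) - f p) = 0 := by
    rw [hf.null_iff, add_sub_cancel_left, mink_smul, hu, mul_zero]
  refine exists_smul_of_null h₁ h₂ h₃ ?_
  have h₄ : mink c (f (p + u) - f (p + a • u)) = 0 := by
    rw [hf.null_iff, show p + u - (p + a • u) = (1 - a) • u by module, mink_smul, hu, mul_zero]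
  rw [← sub_sub_sub_cancel_right _ _ (f p), mink_sub, h₁, h₃] at h₄
  linarith

/-- Every point of the light line through `f p` and `f (p + u)` is an image. -/
theorem exists_of_line (hf : NullPreserving c f) (p : Fin 4 → K) {u : Fin 4 → K}
    (hu : mink c u = 0) (h : u ≠ 0) (s : K) :
    ∃ a : K, f (p + a • u) = f p + s • (f (p + u) - f p) := by
  obtain ⟨g, hg, hfg, hgf⟩ := hf.symm_of
  have h₁ : mink c (f (p + u) - f p) = 0 := by
    rw [hf.null_iff, add_sub_cancel_left, hu]
  have h₂ : f (p + u) - f p ≠ 0 := fun h₂ => h (by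
    have := hf.bij.1 (sub_eq_zero.1 h₂)
    simpa using this)
  obtain ⟨a, ha⟩ := hg.map_line (f p) h₁ h₂ s
  rw [add_sub_cancel, hgf, hgf, add_sub_cancel_left, sub_eq_iff_eq_add'] at ha
  exact ⟨a, by rw [← ha, hfg]⟩

/-- Opposite sides of a parallelogram with lightlike sides have parallel images: otherwise some
point of one side would be connected by light signals with all or with no points of the line
through the other side. -/
theorem map_parallel (hf : NullPreserving c f) (p : Fin 4 → K) {u v : Fin 4 → K}
    (hu : mink c u = 0) (hv : mink c v = 0) (huv : mprod c u v ≠ 0) :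
    ∃ a : K, f (p + v + u) - f (p + v) = a • (f (p + u) - f p) := by
  have hu₀ : u ≠ 0 := by rintro rfl; simp [mprod, sdot] at huv
  set u₁ := f (p + u) - f p with hu₁
  set u₂ := f (p + v + u) - f (p + v) with hu₂
  have h₁ : mink c u₁ = 0 := by rw [hu₁, hf.null_iff, add_sub_cancel_left, hu]
  have h₂ : mink c u₂ = 0 := by rw [hu₂, hf.null_iff, add_sub_cancel_left, hu]
  have h₁' : u₁ ≠ 0 := fun h => hu₀ (by
    have := hf.bij.1 (sub_eq_zero.1 h)
    simpa using this)
  refine exists_smul_of_null h₁ h₁' h₂ ?_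
  by_contra hne
  set d := f (p + v) - f p with hd
  obtain ⟨a, ha⟩ := hf.exists_of_line p hu hu₀ (mprod c d u₂ / mprod c u₁ u₂)
  rw [← hu₁] at ha
  obtain ⟨r, hr⟩ := hf.map_line (p + v) hu hu₀ a
  obtain ⟨b, hb⟩ := hf.exists_of_line (p + v) hu hu₀ (r + 1)
  rw [← hu₂] at hr hb
  set s := mprod c d u₂ / mprod c u₁ u₂ with hs
  have hs' : s * mprod c u₁ u₂ = mprod c d u₂ := div_mul_cancel₀ _ hne
  have key (t : K) : mink c (f (p + v) + t • u₂ - f (p + a • u)) = mink c (d - s • u₁) := by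
    rw [ha, show f (p + v) + t • u₂ - (f p + s • u₁) = (d - s • u₁) + t • u₂ by
      rw [hd]; module, mink_add, mink_smul, h₂, mprod_smul_right]
    have : mprod c (d - s • u₁) u₂ = 0 := by
      rw [mprod_comm, mprod_sub_right, mprod_smul_right, mprod_comm c u₂ u₁, hs', mprod_comm,
        sub_self]
    rw [this]; ring
  -- the point `p + a u` is connected with `p + v + a u`
  have h₃ : mink c (d - s • u₁) = 0 := by
    rw [← key r, ← hr, add_sub_cancel, hf.null_iff,
      show p + v + a • u - (p + a • u) = v by module, hv]
  have h₄ : mink c ((b - a) • u + v) = 0 := by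
    rw [← show p + v + b • u - (p + a • u) = (b - a) • u + v by module, ← hf.null_iff, hb, key, h₃]
  rw [mink_add, mink_smul, hu, hv, mprod_smul_left] at h₄
  have h₅ : b - a = 0 := by
    have : (b - a) * mprod c u v = 0 := by linear_combination h₄ / 2
    exact (mul_eq_zero.1 this).resolve_right huv
  rw [sub_eq_zero.1 h₅, ← sub_eq_iff_eq_add', hr] at hb
  have h₆ : u₂ = 0 := by
    have : (r + 1 - r) • u₂ = 0 := by rw [sub_smul, hb, sub_self]
    simpa using this
  exact hne (by rw [h₆]; simp [mprod, sdot])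

theorem map_parallelogram (hf : NullPreserving c f) (p : Fin 4 → K) {u v : Fin 4 → K}
    (hu : mink c u = 0) (hv : mink c v = 0) (huv : mprod c u v ≠ 0) :
    f (p + v + u) - f (p + v) = f (p + u) - f p := by
  obtain ⟨a, ha⟩ := hf.map_parallel p hu hv huv
  obtain ⟨b, hb⟩ := hf.map_parallel p hv hu (by rwa [mprod_comm])
  rw [add_right_comm] at hb
  have h₁ : mink c (f (p + u) - f p) = 0 := by rw [hf.null_iff, add_sub_cancel_left, hu]
  have h₂ : mink c (f (p + v) - f p) = 0 := by rw [hf.null_iff, add_sub_cancel_left, hv]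
  have h₃ : mprod c (f (p + u) - f p) (f (p + v) - f p) ≠ 0 := by
    intro h
    have h₃ : mink c (f (p + u) - f (p + v)) = 0 := by
      rw [← sub_sub_sub_cancel_right _ _ (f p), mink_sub, h₁, h₂, h]; ring
    rw [hf.null_iff, add_sub_add_left_eq_sub, mink_sub, hu, hv] at h₃
    exact huv (by linear_combination -h₃ / 2)
  have h₄ : (a - 1) • (f (p + u) - f p) = (b - 1) • (f (p + v) - f p) := by
    rw [sub_smul, sub_smul, ← ha, ← hb]; module
  have h₅ : a - 1 = 0 := by
    have h₅ : mprod c ((a - 1) • (f (p + u) - f p)) (f (p + v) - f p) = 0 := by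
      rw [h₄, mprod_smul_left, mprod_self, h₂, mul_zero]
    rw [mprod_smul_left] at h₅
    exact (mul_eq_zero.1 h₅).resolve_right h₃
  rw [ha, sub_eq_zero.1 h₅, one_smul]

/-- The displacement of the images of the ends of a lightlike vector does not depend on the
point where the vector is attached. -/
theorem displacement (hf : NullPreserving c f) (hc : 0 < c) {u : Fin 4 → K} (hu : mink c u = 0)
    (p w : Fin 4 → K) : f (p + w + u) - f (p + w) = f (p + u) - f p := by
  by_cases h : u = 0
  · simp [h]
  -- the periods of the displacement form a group
  let P : Set (Fin 4 → K) := {w | ∀ p, f (p + w + u) - f (p + w) = f (p + u) - f p}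
  have hadd {x y} (hx : x ∈ P) (hy : y ∈ P) : x + y ∈ P := fun p => by
    rw [← add_assoc, hy (p + x), hx p]
  have hneg {x} (hx : x ∈ P) : -x ∈ P := fun p => by
    have := hx (p + -x)
    rw [neg_add_cancel_right] at this
    exact this.symm
  have hnull₁ {v} (hv : mink c v = 0) (huv : mprod c u v ≠ 0) : v ∈ P := fun p =>
    hf.map_parallelogram p hu hv huv
  have hself {v} (hv : mink c v = 0) (huv : mprod c u v = 0) : v ∈ P := by
    obtain ⟨a, rfl⟩ := exists_smul_of_null hu h hv huv
    obtain ⟨x, y, z, hxyz, hx, hy, hz⟩ := exists_null_sum hc hu h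
    by_cases ha : a = 0
    · intro p; simp [ha]
    have key {v} (hv : mink c v = 0 ∧ mprod c u v ≠ 0) : a • v ∈ P :=
      hnull₁ (by rw [mink_smul, hv.1, mul_zero])
        (by rw [mprod_smul_right]; exact mul_ne_zero ha hv.2)
    rw [hxyz, smul_sub, smul_add, sub_eq_add_neg]
    exact hadd (hadd (key hx) (key hy)) (hneg (key hz))
  have hnull {v} (hv : mink c v = 0) : v ∈ P := by
    by_cases huv : mprod c u v = 0
    exacts [hself hv huv, hnull₁ hv huv]
  exact mem_of_null_mem hc (fun x hx y hy => hadd hx hy) (fun v hv => hnull hv) w p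

/-- A map preserving the light relation is additive up to a translation. -/
theorem displacement_eq (hf : NullPreserving c f) (hc : 0 < c) (p w : Fin 4 → K) :
    f (p + w) - f p = f w - f 0 := by
  let P : Set (Fin 4 → K) := {w | ∀ p, f (p + w) - f p = f w - f 0}
  have hadd {x y} (hx : x ∈ P) (hy : y ∈ P) : x + y ∈ P := fun p => by
    have h₁ := hx p
    have h₂ := hy (p + x)
    have h₃ := hy x
    rw [← add_assoc, ← sub_add_sub_cancel _ (f (p + x)), h₁, h₂, ← h₃]; abel
  have hnull {v} (hv : mink c v = 0) : v ∈ P := fun p => by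
    have := hf.displacement hc hv 0 p
    simpa using this
  exact mem_of_null_mem hc (fun x hx y hy => hadd hx hy) (fun v hv => hnull hv) w p

end NullPreserving

end Coord

/-! ### Poincaré transformations -/

namespace Coord

variable {K : Type*} [Field K]

/-- The spatial part of a coordinate point, as a vector with vanishing time coordinate. -/
def spatial (x : Fin 4 → K) : Fin 4 → K := x - x 0 • timeUnit

theorem spatial_zero (x : Fin 4 → K) : spatial x 0 = 0 := by
  simp [spatial, timeUnit]

theorem smul_timeUnit_add_spatial (x : Fin 4 → K) : x 0 • timeUnit + spatial x = x := by
  simp [spatial]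

theorem mink_smul_timeUnit_add (c a : K) {x : Fin 4 → K} (hx : x 0 = 0) :
    mink c (a • timeUnit + x) = c ^ 2 * a ^ 2 - space x := by
  simp [mink, space, timeUnit, hx]

theorem mink_of_time_eq_zero (c : K) {x : Fin 4 → K} (hx : x 0 = 0) : mink c x = -space x := by
  simp [mink, hx]

theorem mprod_of_time_eq_zero (c : K) (x : Fin 4 → K) {y : Fin 4 → K} (hy : y 0 = 0) :
    mprod c x y = -sdot x y := by
  simp [mprod, hy]

theorem sdot_self (x : Fin 4 → K) : sdot x x = space x := by
  simp only [sdot, space]; ring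

theorem sdot_add_left (x y z : Fin 4 → K) : sdot (x + y) z = sdot x z + sdot y z := by
  simp only [sdot, Pi.add_apply]; ring

variable [LinearOrder K] [IsStrictOrderedRing K]

theorem space_pos {x : Fin 4 → K} (h₀ : x 0 = 0) (h : x ≠ 0) : 0 < space x :=
  (space_nonneg x).lt_of_ne' fun h' => h (eq_zero_of_space h₀ h')

theorem exists_sdot_eq_zero (x : Fin 4 → K) :
    ∃ y : Fin 4 → K, y ≠ 0 ∧ y 0 = 0 ∧ sdot x y = 0 := by
  by_cases h : x 1 = 0
  · refine ⟨![0, 1, 0, 0], fun h => ?_, rfl, ?_⟩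
    · simpa using congrFun h 1
    · simp [sdot, h]
  · refine ⟨![0, -x 2, x 1, 0], fun h' => ?_, rfl, ?_⟩
    · exact h (by simpa using congrFun h' 2)
    · simp only [sdot, Matrix.cons_val]; ring

/-- A map preserving the light relation is a Poincaré transformation if it maps the time axis into a
straight line and preserves the distance of points that are simultaneous before and after. -/
theorem NullPreserving.exists_linear [IsEuclidean K] {c : K} {f : (Fin 4 → K) → (Fin 4 → K)}
    (hf : NullPreserving c f) (hc : 0 < c)
    (haxis : ∀ a : K, ∃ s : K, f (a • timeUnit) - f 0 = s • (f timeUnit - f 0))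
    (hsim : ∀ x y, x 0 = y 0 → f x 0 = f y 0 → space (f x - f y) = space (x - y)) :
    ∃ L : (Fin 4 → K) →ₗ[K] (Fin 4 → K), (∀ x, mink c (L x) = mink c x) ∧ ∀ x, f x = f 0 + L x := by
  have hc' := hc.ne'
  let F : (Fin 4 → K) →+ (Fin 4 → K) := AddMonoidHom.mk' (fun w => f w - f 0) fun x y => by
    have := hf.displacement_eq hc x y
    rw [← this]; abel
  have hF (x) : F x = f x - f 0 := rfl
  have hnull (x) : mink c (F x) = 0 ↔ mink c x = 0 := by rw [hF, hf.null_iff, sub_zero]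
  have hinj {x} (h : F x = 0) : x = 0 := hf.bij.1 (sub_eq_zero.1 h)
  have hsurj (y) : ∃ x, F x = y := by
    obtain ⟨x, hx⟩ := hf.bij.2 (y + f 0)
    exact ⟨x, by rw [hF, hx, add_sub_cancel_right]⟩
  have haxis' (a : K) : ∃ s : K, F (a • timeUnit) = s • F timeUnit := haxis a
  have hlen {x} (h₀ : x 0 = 0) (h₁ : F x 0 = 0) : space (F x) = space x := by
    have := hsim x 0 h₀ (by rw [hF] at h₁; exact sub_eq_zero.1 h₁)
    rwa [sub_zero] at this
  have hline {u} (hu : mink c u = 0) (a : K) : ∃ s : K, F (a • u) = s • F u := by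
    by_cases h : u = 0
    · exact ⟨0, by simp [h]⟩
    · obtain ⟨s, hs⟩ := hf.map_line 0 hu h a
      exact ⟨s, by simpa [hF] using hs⟩
  have hsqrt {w : Fin 4 → K} (hw : w 0 = 0) : ∃ a : K, c ^ 2 * a ^ 2 = space w := by
    obtain ⟨r, hr⟩ := IsEuclidean.exists_sq (space w) (space_nonneg w)
    exact ⟨r / c, by rw [← hr]; field_simp⟩
  -- the image of the space orthogonal to the time axis is orthogonal to the image of the time axis
  have hcone {w : Fin 4 → K} (hw : w 0 = 0) {a : K} (ha : c ^ 2 * a ^ 2 = space w) :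
      mprod c (F (a • timeUnit)) (F w) = 0 ∧ mink c (F (a • timeUnit)) + mink c (F w) = 0 := by
    have h₁ : mink c (F (a • timeUnit + w)) = 0 := by
      rw [hnull, mink_smul_timeUnit_add c a hw, ha, sub_self]
    have h₂ : mink c (F (a • timeUnit - w)) = 0 := by
      rw [hnull, sub_eq_add_neg, mink_smul_timeUnit_add c a (by simp [hw]), space_neg, ha, sub_self]
    rw [map_add, mink_add] at h₁
    rw [map_sub, mink_sub] at h₂
    constructor <;> linarith
  have hperp {w : Fin 4 → K} (hw : w 0 = 0) : mprod c (F timeUnit) (F w) = 0 := by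
    obtain ⟨a, ha⟩ := hsqrt hw
    obtain ⟨s, hs⟩ := haxis' a
    have h₁ := (hcone hw ha).1
    rw [hs, mprod_smul_left] at h₁
    rcases mul_eq_zero.1 h₁ with rfl | h₁
    · rw [zero_smul] at hs
      have h₂ : a = 0 := by simpa [timeUnit] using congrFun (hinj hs) 0
      rw [h₂] at ha
      have : w = 0 := eq_zero_of_space hw (by rw [← ha]; ring)
      rw [this, map_zero]; simp [mprod, sdot]
    · exact h₁
  have hT : mink c (F timeUnit) ≠ 0 := by
    rw [Ne, hnull]
    simpa [mink, space, timeUnit] using hc'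
  have htime {v} (hv : mprod c (F timeUnit) (F v) = 0) : v 0 = 0 := by
    obtain ⟨s, hs⟩ := haxis' (v 0)
    rw [← smul_timeUnit_add_spatial v, map_add, mprod_add_right, hperp (spatial_zero v), hs,
      mprod_smul_right, mprod_self, add_zero] at hv
    rw [(mul_eq_zero.1 hv).resolve_right hT, zero_smul] at hs
    simpa [timeUnit] using congrFun (hinj hs) 0
  -- a vector of space whose multiples are mapped to the multiples of its image
  obtain ⟨w₁, hw₁, hw₁₀, hperp₁⟩ := exists_sdot_eq_zero (F timeUnit)
  obtain ⟨v₁, hv₁⟩ := hsurj w₁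
  have hpre (a : K) {v} (hv : F v = a • w₁) : v 0 = 0 ∧ space v = a ^ 2 * space w₁ := by
    have h₀ : F v 0 = 0 := by rw [hv]; simp [hw₁₀]
    have h₁ : v 0 = 0 := htime (by
      rw [hv, mprod_smul_right, mprod_of_time_eq_zero c _ hw₁₀, hperp₁]; simp)
    exact ⟨h₁, by rw [← hlen h₁ h₀, hv, space_smul]⟩
  obtain ⟨hv₁₀, hv₁s⟩ := hpre 1 (v := v₁) (by rw [hv₁, one_smul])
  have hv₁ne : v₁ ≠ 0 := by
    rintro rfl
    exact hw₁ (by rw [← hv₁, map_zero])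
  have hmul₁ (a : K) : F (a • v₁) = a • F v₁ := by
    obtain ⟨v, hv⟩ := hsurj (a • w₁)
    obtain ⟨h₀, hs⟩ := hpre a hv
    obtain ⟨-, hs'⟩ := hpre (a + 1) (v := v + v₁) (by rw [map_add, hv, hv₁]; module)
    have : v - a • v₁ = 0 := by
      apply eq_zero_of_space
      · simp [h₀, hv₁₀]
      · rw [space_add] at hs'
        have h : space (v - a • v₁) = space v - 2 * a * sdot v v₁ + a ^ 2 * space v₁ := by
          simp only [space, sdot, Pi.sub_apply, Pi.smul_apply, smul_eq_mul]; ring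
        rw [h]
        linear_combination (1 + a) * hs + (a ^ 2 + a) * hv₁s - a * hs'
    rw [hv₁, ← hv, sub_eq_zero.1 this]
  -- the vectors on whose multiples the map is linear
  let P : Set (Fin 4 → K) := {x | ∀ a : K, F (a • x) = a • F x}
  have hPadd {x y} (hx : x ∈ P) (hy : y ∈ P) : x + y ∈ P := fun a => by
    rw [smul_add, map_add, hx a, hy a, map_add, smul_add]
  have hPsmul {x} (b : K) (hx : x ∈ P) : b • x ∈ P := fun a => by
    rw [smul_smul, hx, hx, smul_smul]
  have hPsub {x y} (hx : x ∈ P) (hy : y ∈ P) : x - y ∈ P := by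
    have := hPadd hx (hPsmul (-1) hy)
    rwa [neg_one_smul, ← sub_eq_add_neg] at this
  have hPcancel {x} {b : K} (hb : b ≠ 0) (hx : b • x ∈ P) : x ∈ P := by
    have := hPsmul b⁻¹ hx
    rwa [smul_smul, inv_mul_cancel₀ hb, one_smul] at this
  have hmink₁ : mink c v₁ ≠ 0 := by
    rw [mink_of_time_eq_zero c hv₁₀, neg_ne_zero]
    exact (space_pos hv₁₀ hv₁ne).ne'
  have hPnull {u} (hu : mink c u = 0) (huv : mprod c u v₁ ≠ 0) : u ∈ P := by
    have ht : mink c v₁ / (2 * mprod c u v₁) ≠ 0 := by positivity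
    refine hPcancel ht fun a => ?_
    set u₀ := (mink c v₁ / (2 * mprod c u v₁)) • u with hu₀
    have h₁ : mink c u₀ = 0 := by rw [hu₀, mink_smul, hu, mul_zero]
    have h₂ : mink c (u₀ - v₁) = 0 := by
      rw [mink_sub, h₁, hu₀, mprod_smul_left]
      field_simp
      ring
    obtain ⟨s, hs⟩ := hline h₁ a
    obtain ⟨s', hs'⟩ := hline h₂ a
    have h₃ : mprod c (F u₀) (F (u₀ - v₁)) ≠ 0 := by
      intro h
      have h₄ : mink c (F v₁) = 0 := by
        rw [show v₁ = u₀ - (u₀ - v₁) by abel, map_sub F u₀, mink_sub, h, (hnull _).2 h₁,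
          (hnull _).2 h₂]
        ring
      exact hmink₁ ((hnull _).1 h₄)
    have h₄ : (s - a) • F u₀ = (s' - a) • F (u₀ - v₁) := by
      rw [sub_smul, sub_smul, ← hs, ← hs', smul_sub, map_sub, map_sub, hmul₁]
      module
    have h₅ : (s - a) * mprod c (F u₀) (F (u₀ - v₁)) = 0 := by
      rw [← mprod_smul_left, h₄, mprod_smul_left, mprod_self, (hnull _).2 h₂, mul_zero]
    rw [hs, sub_eq_zero.1 ((mul_eq_zero.1 h₅).resolve_right h₃)]
  have hPcone {w : Fin 4 → K} (hw : w 0 = 0) (hne : sdot w v₁ ≠ 0) {a : K}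
      (ha : c ^ 2 * a ^ 2 = space w) : a • timeUnit + w ∈ P := by
    apply hPnull
    · rw [mink_smul_timeUnit_add c a hw, ha, sub_self]
    · rw [mprod_of_time_eq_zero c _ hv₁₀, neg_ne_zero]
      simpa [sdot, timeUnit] using hne
  have hPv : v₁ ∈ P := hmul₁
  have hself : sdot v₁ v₁ ≠ 0 := by rw [sdot_self]; exact (space_pos hv₁₀ hv₁ne).ne'
  have hPtime : (timeUnit : Fin 4 → K) ∈ P := by
    obtain ⟨a, ha⟩ := hsqrt hv₁₀
    refine hPcancel (b := a) ?_ ?_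
    · rintro rfl
      rw [sdot_self, ← ha] at hself
      exact hself (by ring)
    · have := hPsub (hPcone hv₁₀ hself ha) hPv
      rwa [add_sub_cancel_right] at this
  have hPspace₁ {w : Fin 4 → K} (hw : w 0 = 0) (hne : sdot w v₁ ≠ 0) : w ∈ P := by
    obtain ⟨a, ha⟩ := hsqrt hw
    have := hPsub (hPcone hw hne ha) (hPsmul a hPtime)
    rwa [add_sub_cancel_left] at this
  have hPspace {w : Fin 4 → K} (hw : w 0 = 0) : w ∈ P := by
    by_cases hne : sdot w v₁ = 0
    · have := hPsub (hPspace₁ (w := w + v₁) (by simp [hw, hv₁₀])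
        (by rwa [sdot_add_left, hne, zero_add])) hPv
      rwa [add_sub_cancel_right] at this
    · exact hPspace₁ hw hne
  have hPall (x) : x ∈ P := by
    rw [← smul_timeUnit_add_spatial x]
    exact hPadd (hPsmul _ hPtime) (hPspace (spatial_zero x))
  refine ⟨⟨F.toAddHom, fun a x => hPall x a⟩, ?_, fun x => ?_⟩
  · have h₁ {w : Fin 4 → K} (hw : w 0 = 0) :
        c ^ 2 * mink c (F w) = -space w * mink c (F timeUnit) := by
      obtain ⟨a, ha⟩ := hsqrt hw
      have := (hcone hw ha).2
      rw [hPtime a, mink_smul] at this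
      rw [← ha]
      linear_combination c ^ 2 * this
    have h₂ : mink c (F timeUnit) = c ^ 2 := by
      have h := h₁ hv₁₀
      rw [hv₁, mink_of_time_eq_zero c hw₁₀] at h
      rw [sdot_self] at hself
      have h' : space v₁ = space w₁ := by rw [hv₁s]; ring
      rw [← h'] at h
      exact mul_left_cancel₀ hself (by linear_combination h)
    intro x
    have h₃ : mink c (F (spatial x)) = -space (spatial x) := by
      have := h₁ (spatial_zero x)
      rw [h₂] at this
      exact mul_left_cancel₀ (pow_ne_zero 2 hc') (by rw [this]; ring)
    change mink c (F x) = mink c x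
    conv_lhs => rw [← smul_timeUnit_add_spatial x]
    conv_rhs => rw [← smul_timeUnit_add_spatial x]
    rw [map_add, hPtime, mink_add, mink_smul, h₂, mprod_smul_left, hperp (spatial_zero x), h₃,
      mink_smul_timeUnit_add c _ (spatial_zero x)]
    ring
  · change f x = f 0 + F x
    rw [hF, add_sub_cancel]

end Coord

namespace Coord

/-! ### Galilean transformations -/

section Galilean

variable {K : Type*} [Field K] [LinearOrder K] [IsStrictOrderedRing K]

/-- A map preserving time differences and the distances of simultaneous points is affine if it maps
the straight lines that are not horizontal into straight lines. -/
theorem exists_linear_of_absolute_time {f : (Fin 4 → K) → (Fin 4 → K)}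
    (htime : ∀ x y, (f x 0 - f y 0) ^ 2 = (x 0 - y 0) ^ 2)
    (hdist : ∀ x y, x 0 = y 0 → space (f x - f y) = space (x - y))
    (hline : ∀ x y, x 0 ≠ y 0 → ∀ a : K, ∃ b : K, f (x + a • (y - x)) - f x = b • (f y - f x)) :
    ∃ L : (Fin 4 → K) →ₗ[K] (Fin 4 → K), ∀ x, f x = f 0 + L x := by
  have haff₁ (x y) (hxy : x 0 ≠ y 0) (a : K) : f (x + a • (y - x)) = f x + a • (f y - f x) := by
    obtain ⟨b, hb⟩ := hline x y hxy a
    have h₀ : (y 0 - x 0) ^ 2 ≠ 0 := pow_ne_zero 2 (sub_ne_zero.2 hxy.symm)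
    have h₁ := htime (x + a • (y - x)) x
    have h₂ := htime (x + a • (y - x)) y
    have h₃ := htime y x
    have h₄ : f (x + a • (y - x)) 0 - f x 0 = b * (f y 0 - f x 0) := by
      simpa using congrFun hb 0
    simp only [Pi.add_apply, Pi.smul_apply, Pi.sub_apply, smul_eq_mul] at h₁ h₂
    have h₅ : b ^ 2 = a ^ 2 := by
      apply mul_right_cancel₀ h₀
      rw [h₄] at h₁
      linear_combination h₁ - b ^ 2 * h₃
    have h₆ : (b - 1) ^ 2 = (a - 1) ^ 2 := by
      apply mul_right_cancel₀ h₀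
      rw [show f (x + a • (y - x)) 0 - f y 0 = (b - 1) * (f y 0 - f x 0) by
        linear_combination h₄] at h₂
      linear_combination h₂ - (b - 1) ^ 2 * h₃
    have h₇ : b = a := by linear_combination (h₅ - h₆) / 2
    rw [h₇, sub_eq_iff_eq_add'] at hb
    exact hb
  have hup (x : Fin 4 → K) (s : K) : f (x + s • timeUnit) = f x + s • (f (x + timeUnit) - f x) := by
    have := haff₁ x (x + timeUnit) (by simp [timeUnit]) s
    rwa [add_sub_cancel_left] at this
  -- simultaneous points move with the same velocity because their distance is constant
  have hvel {x y : Fin 4 → K} (hxy : x 0 = y 0) :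
      f (x + timeUnit) - f x = f (y + timeUnit) - f y := by
    have h (s : K) : space ((f x - f y) + s • ((f (x + timeUnit) - f x) -
        (f (y + timeUnit) - f y))) = space (x - y) := by
      rw [← show x + s • timeUnit - (y + s • timeUnit) = x - y by abel,
        ← hdist _ _ (by simp [hxy]), hup, hup]
      congr 1
      module
    refine sub_eq_zero.1 (eq_zero_of_space ?_ ?_)
    · have h₁ := htime x y
      have h₂ := htime (x + timeUnit) (y + timeUnit)
      simp only [Pi.add_apply, hxy, sub_self, ne_eq, OfNat.ofNat_ne_zero, not_false_eq_true,
        zero_pow, pow_eq_zero_iff] at h₁ h₂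
      simp only [Pi.sub_apply]
      linear_combination h₂ - h₁
    · have h₁ := h 1
      have h₂ := h (-1)
      have h₀ := h 0
      rw [space_add, space_smul] at h₀ h₁ h₂
      have h₃ (s : K) (a b : Fin 4 → K) : sdot a (s • b) = s * sdot a b := by
        simp only [sdot, Pi.smul_apply, smul_eq_mul]; ring
      rw [h₃] at h₀ h₁ h₂
      linear_combination (h₁ + h₂) / 2 - h₀
  have haff (x y) (a : K) : f (x + a • (y - x)) = f x + a • (f y - f x) := by
    by_cases hxy : x 0 = y 0
    -- the point lies on the line through two points above and below `x` and `y`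
    · have h₁ := haff₁ (x + a • timeUnit) (y + (a - 1) • timeUnit) (fun h => by
        have : a = a - 1 := by simpa [timeUnit, hxy] using h
        linarith) a
      rw [show x + a • timeUnit + a • (y + (a - 1) • timeUnit - (x + a • timeUnit)) =
        x + a • (y - x) by module, hup, hup, hvel hxy] at h₁
      rw [h₁]
      module
    · exact haff₁ x y hxy a
  have hsmul (a : K) (w) : f (a • w) - f 0 = a • (f w - f 0) := by
    have := haff 0 w a
    rw [zero_add, sub_zero] at this
    rw [this, add_sub_cancel_left]
  refine ⟨{ toFun := fun w => f w - f 0, map_add' := fun x y => ?_, map_smul' := hsmul },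
    fun x => (add_sub_cancel _ _).symm⟩
  have h₁ := haff x y (1 / 2)
  have h₂ := hsmul (1 / 2) (x + y)
  rw [show x + (1 / 2 : K) • (y - x) = (1 / 2 : K) • (x + y) by module] at h₁
  have h₃ : (1 / 2 : K) • (f (x + y) - f 0) = (1 / 2 : K) • (f x - f 0 + (f y - f 0)) := by
    rw [← h₂, h₁]; module
  exact smul_right_injective _ (by norm_num : (1 / 2 : K) ≠ 0) h₃

end Galilean

/-! ### Trivial transformations -/

section Trivial

variable {K : Type*} [Field K]

/-- A linear map is a trivial transformation if it is the product of the identity or the reversal of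
time and an orthogonal map of space. -/
def IsTrivial (ρ : (Fin 4 → K) →ₗ[K] (Fin 4 → K)) : Prop :=
  ∀ x, ρ x 0 ^ 2 = x 0 ^ 2 ∧ space (ρ x) = space x

theorem IsTrivial.comp {ρ σ : (Fin 4 → K) →ₗ[K] (Fin 4 → K)} (hρ : IsTrivial ρ)
    (hσ : IsTrivial σ) : IsTrivial (ρ ∘ₗ σ) := fun x =>
  ⟨((hρ _).1.trans (hσ x).1), ((hρ _).2.trans (hσ x).2)⟩

theorem IsTrivial.mink {ρ : (Fin 4 → K) →ₗ[K] (Fin 4 → K)} (hρ : IsTrivial ρ) (c : K)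
    (x : Fin 4 → K) : mink c (ρ x) = mink c x := by
  rw [Coord.mink, (hρ x).1, (hρ x).2, Coord.mink]

theorem mprod_timeUnit (c : K) (x : Fin 4 → K) : mprod c x timeUnit = c ^ 2 * x 0 := by
  simp [mprod, sdot, timeUnit]

theorem mink_timeUnit (c : K) : mink c timeUnit = c ^ 2 := by
  simp [mink, space, timeUnit]

variable [LinearOrder K] [IsStrictOrderedRing K]

/-- A linear map preserving the Minkowski quadratic form preserves the Minkowski product. -/
theorem mprod_map {c : K} {L : (Fin 4 → K) →ₗ[K] (Fin 4 → K)} (hL : ∀ x, mink c (L x) = mink c x)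
    (x y : Fin 4 → K) : mprod c (L x) (L y) = mprod c x y := by
  have := hL (x + y)
  rw [map_add, mink_add, mink_add, hL, hL] at this
  linarith

theorem IsTrivial.injective {ρ : (Fin 4 → K) →ₗ[K] (Fin 4 → K)} (hρ : IsTrivial ρ) :
    Function.Injective ρ := (injective_iff_map_eq_zero ρ).2 fun x hx => by
  have h := hρ x
  rw [hx] at h
  refine eq_zero_of_space (pow_eq_zero_iff two_ne_zero |>.1 (by rw [← h.1]; simp)) ?_
  rw [← h.2]; simp [space]

theorem IsTrivial.exists_inverse {ρ : (Fin 4 → K) →ₗ[K] (Fin 4 → K)} (hρ : IsTrivial ρ) :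
    ∃ σ : (Fin 4 → K) →ₗ[K] (Fin 4 → K), IsTrivial σ ∧ (∀ x, σ (ρ x) = x) ∧ ∀ x, ρ (σ x) = x := by
  let e := LinearEquiv.ofInjectiveEndo ρ hρ.injective
  have h₁ (x) : ρ (e.symm x) = x := e.apply_symm_apply x
  refine ⟨e.symm.toLinearMap, fun x => ?_, e.symm_apply_apply, h₁⟩
  have := hρ (e.symm x)
  rw [h₁] at this
  exact ⟨this.1.symm, this.2.symm⟩

/-- A trivial transformation fixes or reverses the direction of time. -/
theorem IsTrivial.exists_time {ρ : (Fin 4 → K) →ₗ[K] (Fin 4 → K)} (hρ : IsTrivial ρ) :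
    ∃ ε : K, ε ^ 2 = 1 ∧ (ρ timeUnit = ε • timeUnit) ∧ ∀ x, ρ x 0 = ε * x 0 := by
  have h₀ : ρ timeUnit 0 ^ 2 = 1 := by rw [(hρ _).1]; simp [timeUnit]
  have h₁ : ρ timeUnit = ρ timeUnit 0 • timeUnit := by
    refine sub_eq_zero.1 (eq_zero_of_space (by simp [timeUnit]) ?_)
    have h₁ : space (ρ timeUnit) = 0 := by rw [(hρ _).2]; simp [space, timeUnit]
    rw [← h₁]
    simp [space, timeUnit]
  refine ⟨_, h₀, h₁, fun x => ?_⟩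
  have h₂ := mprod_map (hρ.mink (1 : K)) x timeUnit
  rw [h₁, mprod_smul_right, mprod_timeUnit, mprod_timeUnit] at h₂
  linear_combination ρ timeUnit 0 * h₂ - ρ x 0 * h₀

/-- A Lorentz transformation preserving the time axis is trivial. -/
theorem isTrivial_of_mink {c : K} (hc : 0 < c) {L : (Fin 4 → K) →ₗ[K] (Fin 4 → K)}
    (hL : ∀ x, mink c (L x) = mink c x) {ε : K} (hε : ε ^ 2 = 1)
    (h : L timeUnit = ε • timeUnit) : IsTrivial L := fun x => by
  have hc' := hc.ne'
  have h₁ := mprod_map hL x timeUnit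
  rw [h, mprod_smul_right, mprod_timeUnit, mprod_timeUnit] at h₁
  have h₂ : ε * L x 0 = x 0 := mul_left_cancel₀ (pow_ne_zero 2 hc') (by linear_combination h₁)
  have h₃ : L x 0 ^ 2 = x 0 ^ 2 := by
    rw [← h₂]; linear_combination -L x 0 ^ 2 * hε
  refine ⟨h₃, ?_⟩
  have h₄ := hL x
  rw [mink, mink, h₃] at h₄
  linear_combination -h₄

theorem IsTrivial.sdot_map {θ : (Fin 4 → K) →ₗ[K] (Fin 4 → K)} (hθ : IsTrivial θ)
    (x y : Fin 4 → K) : sdot (θ x) (θ y) = sdot x y := by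
  have h₁ := (hθ (x + y)).2
  rw [map_add, space_add, space_add, (hθ x).2, (hθ y).2] at h₁
  linarith

/-- A trivial transformation consists of a sign for time and an orthogonal matrix for space. -/
theorem IsTrivial.exists_matrix {ρ : (Fin 4 → K) →ₗ[K] (Fin 4 → K)} (hρ : IsTrivial ρ) :
    ∃ (r : K) (m : Matrix (Fin 3) (Fin 3) K), r ^ 2 = 1 ∧ m * m.transpose = 1 ∧
      ∀ x, ρ x = Matrix.vecCons (r * x 0) (m.mulVec (Matrix.vecTail x)) := by
  obtain ⟨r, hr, hr', hr''⟩ := hρ.exists_time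
  let u : Fin 3 → Fin 4 → K := fun i => Pi.single i.succ 1
  let m : Matrix (Fin 3) (Fin 3) K := fun i j => ρ (u j) i.succ
  have h₁ : m.transpose * m = 1 := by
    ext i j
    rw [Matrix.mul_apply]
    have h₃ : ∑ l, m.transpose i l * m l j = sdot (ρ (u i)) (ρ (u j)) := by
      rw [Fin.sum_univ_three]; rfl
    rw [h₃, hρ.sdot_map]
    fin_cases i <;> fin_cases j <;> simp [sdot, u]
  refine ⟨r, m, hr, mul_eq_one_comm.1 h₁, fun x => ?_⟩
  have hx : x = x 0 • timeUnit + x 1 • u 0 + x 2 • u 1 + x 3 • u 2 := by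
    ext i
    simp only [Pi.add_apply, Pi.smul_apply, smul_eq_mul]
    fin_cases i <;> simp [timeUnit, u]
  ext i
  refine Fin.cases (hr'' x) (fun i => ?_) i
  have h₂ : ρ x i.succ = x 1 * m i 0 + x 2 * m i 1 + x 3 * m i 2 := by
    conv_lhs => rw [hx]
    have : timeUnit (K := K) i.succ = 0 := by fin_cases i <;> rfl
    simp only [map_add, map_smul, hr', Pi.add_apply, Pi.smul_apply, smul_eq_mul, this, m]
    ring
  rw [h₂, Matrix.cons_val_succ, Matrix.mulVec, dotProduct, Fin.sum_univ_three]
  change _ = m i 0 * x 1 + m i 1 * x 2 + m i 2 * x 3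
  ring

end Trivial

/-! ### The two families of boosts -/

section Boosts

variable {K : Type*} [Field K]

/-- The Galilean involution that maps the time axis to the world line with velocity `w`. -/
def gal (w : Fin 4 → K) : (Fin 4 → K) →ₗ[K] (Fin 4 → K) where
  toFun x := x 0 • ((2 : K) • timeUnit + w) - x
  map_add' x y := by simp only [Pi.add_apply]; module
  map_smul' a x := by simp only [Pi.smul_apply, smul_eq_mul, RingHom.id_apply]; module

theorem gal_apply (w x : Fin 4 → K) : gal w x = x 0 • ((2 : K) • timeUnit + w) - x := rfl

theorem gal_time {w : Fin 4 → K} (hw : w 0 = 0) (x : Fin 4 → K) : gal w x 0 = x 0 := by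
  simp only [gal_apply, Pi.sub_apply, Pi.smul_apply, Pi.add_apply, timeUnit_zero, hw, smul_eq_mul]
  ring

theorem gal_gal {w : Fin 4 → K} (hw : w 0 = 0) (x : Fin 4 → K) : gal w (gal w x) = x := by
  rw [gal_apply w (gal w x), gal_time hw, gal_apply]; abel

theorem gal_timeUnit (w : Fin 4 → K) : gal w timeUnit = timeUnit + w := by
  simp only [gal_apply, timeUnit_zero]; module

theorem gal_space (w : Fin 4 → K) {x : Fin 4 → K} (hx : x 0 = 0) : space (gal w x) = space x := by
  rw [gal_apply, hx, zero_smul, zero_sub, space_neg]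

theorem isTrivial_gal_zero : IsTrivial (gal (0 : Fin 4 → K)) := fun x =>
  ⟨by rw [gal_time rfl], by simp [gal_apply, space, timeUnit]⟩

/-- The reflection in the line spanned by `n`. -/
def refl (c : K) (n : Fin 4 → K) : (Fin 4 → K) →ₗ[K] (Fin 4 → K) where
  toFun x := (2 * mprod c n x / mink c n) • n - x
  map_add' x y := by rw [mprod_add_right, mul_add, add_div]; module
  map_smul' a x := by
    rw [mprod_smul_right, mul_left_comm, mul_div_assoc, RingHom.id_apply]; module

theorem refl_apply (c : K) (n x : Fin 4 → K) :
    refl c n x = (2 * mprod c n x / mink c n) • n - x := rfl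

theorem mink_refl {c : K} {n : Fin 4 → K} (hn : mink c n ≠ 0) (x : Fin 4 → K) :
    mink c (refl c n x) = mink c x := by
  rw [refl_apply, mink_sub, mink_smul, mprod_smul_left]; field_simp; ring

theorem refl_refl {c : K} {n : Fin 4 → K} (hn : mink c n ≠ 0) (x : Fin 4 → K) :
    refl c n (refl c n x) = x := by
  have : mprod c n (refl c n x) = mprod c n x := by
    rw [refl_apply, mprod_sub_right, mprod_smul_right, mprod_self]; field_simp; ring
  rw [refl_apply c n (refl c n x), this, refl_apply]; abel

variable [LinearOrder K]

open Classical in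
/-- The Lorentz factor `√(1 + w² / c²)` of an observer whose spatial velocity with respect to proper
time is `w`. -/
noncomputable def gamma (c : K) (w : Fin 4 → K) : K :=
  if h : ∃ g : K, 0 ≤ g ∧ c ^ 2 * g ^ 2 = c ^ 2 + space w then h.choose else 0

/-- The Lorentz involution that maps the time axis to the world line with four-velocity
`(γ, w)`. -/
noncomputable def lor (c : K) (w : Fin 4 → K) : (Fin 4 → K) →ₗ[K] (Fin 4 → K) :=
  refl c ((1 + gamma c w) • timeUnit + w)

variable [IsStrictOrderedRing K]

theorem gamma_unique {c g g' : K} (hc : 0 < c) (hg : 0 ≤ g) (hg' : 0 ≤ g')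
    (h : c ^ 2 * g ^ 2 = c ^ 2 * g' ^ 2) : g = g' :=
  (pow_left_inj₀ hg hg' two_ne_zero).1 (mul_left_cancel₀ (pow_ne_zero 2 hc.ne') h)

variable [IsEuclidean K]

theorem gamma_spec {c : K} (hc : 0 < c) (w : Fin 4 → K) :
    0 ≤ gamma c w ∧ c ^ 2 * gamma c w ^ 2 = c ^ 2 + space w := by
  have h : ∃ g : K, 0 ≤ g ∧ c ^ 2 * g ^ 2 = c ^ 2 + space w := by
    obtain ⟨r, hr⟩ := IsEuclidean.exists_sq (c ^ 2 + space w)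
      (add_nonneg (sq_nonneg c) (space_nonneg w))
    refine ⟨|r| / c, by positivity, ?_⟩
    rw [← hr, div_pow, sq_abs]
    field_simp
  rw [gamma, dif_pos h]
  exact h.choose_spec

theorem eq_gamma {c : K} (hc : 0 < c) {w : Fin 4 → K} {g : K} (hg : 0 ≤ g)
    (h : c ^ 2 * g ^ 2 = c ^ 2 + space w) : g = gamma c w :=
  gamma_unique hc hg (gamma_spec hc w).1 (h.trans (gamma_spec hc w).2.symm)

theorem gamma_pos {c : K} (hc : 0 < c) (w : Fin 4 → K) : 0 < gamma c w := by
  obtain ⟨h₀, h₁⟩ := gamma_spec hc w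
  refine h₀.lt_of_ne fun h => ?_
  rw [← h] at h₁
  nlinarith [space_nonneg w, sq_pos_of_pos hc]

theorem gamma_zero {c : K} (hc : 0 < c) : gamma c (0 : Fin 4 → K) = 1 :=
  (eq_gamma hc zero_le_one (by simp [space])).symm

variable {c : K} {w : Fin 4 → K}

theorem mink_axis (hc : 0 < c) (hw : w 0 = 0) :
    mink c ((1 + gamma c w) • timeUnit + w) = 2 * c ^ 2 * (1 + gamma c w) := by
  rw [mink_smul_timeUnit_add c _ hw]
  linear_combination (gamma_spec hc w).2

theorem mink_axis_ne_zero (hc : 0 < c) (hw : w 0 = 0) :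
    mink c ((1 + gamma c w) • timeUnit + w) ≠ 0 := by
  have := gamma_pos hc w
  rw [mink_axis hc hw]; positivity

theorem mink_lor (hc : 0 < c) (hw : w 0 = 0) (x : Fin 4 → K) :
    mink c (lor c w x) = mink c x := mink_refl (mink_axis_ne_zero hc hw) x

theorem lor_lor (hc : 0 < c) (hw : w 0 = 0) (x : Fin 4 → K) : lor c w (lor c w x) = x :=
  refl_refl (mink_axis_ne_zero hc hw) x

theorem lor_apply (hc : 0 < c) (hw : w 0 = 0) (x : Fin 4 → K) : lor c w x =
    (x 0 - sdot w x / (c ^ 2 * (1 + gamma c w))) • ((1 + gamma c w) • timeUnit + w) - x := by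
  have h := gamma_pos hc w
  rw [lor, refl_apply, mink_axis hc hw]
  congr 2
  have : mprod c ((1 + gamma c w) • timeUnit + w) x = c ^ 2 * (1 + gamma c w) * x 0 - sdot w x := by
    simp [mprod, sdot, timeUnit, hw]
  rw [this]
  field_simp

theorem lor_timeUnit (hc : 0 < c) (hw : w 0 = 0) :
    lor c w timeUnit = gamma c w • timeUnit + w := by
  rw [lor_apply hc hw]
  simp [sdot, timeUnit_zero, timeUnit_one, timeUnit_two, timeUnit_three]
  module

theorem lor_zero (hc : 0 < c) : lor c (0 : Fin 4 → K) = gal 0 := by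
  ext1 i
  ext1
  simp only [LinearMap.comp_apply]
  rw [lor_apply hc rfl, gal_apply, gamma_zero hc]
  simp [sdot, one_add_one_eq_two]

/-- Every Lorentz transformation is the product of a trivial transformation and a boost. -/
theorem exists_lor (hc : 0 < c) {L : (Fin 4 → K) →ₗ[K] (Fin 4 → K)}
    (hL : ∀ x, mink c (L x) = mink c x) :
    ∃ (w : Fin 4 → K) (ρ : (Fin 4 → K) →ₗ[K] (Fin 4 → K)), w 0 = 0 ∧ IsTrivial ρ ∧
      ∀ x, L x = lor c w (ρ x) := by
  have hL₀ : c ^ 2 * L timeUnit 0 ^ 2 = c ^ 2 + space (spatial (L timeUnit)) := by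
    have := hL timeUnit
    rw [mink_timeUnit, ← smul_timeUnit_add_spatial (L timeUnit),
      mink_smul_timeUnit_add c _ (spatial_zero _)] at this
    linear_combination this
  obtain ⟨ε, hε, hε'⟩ : ∃ ε : K, ε ^ 2 = 1 ∧ 0 ≤ ε * L timeUnit 0 := by
    rcases le_total 0 (L timeUnit 0) with h | h
    · exact ⟨1, by ring, by linarith⟩
    · exact ⟨-1, by ring, by linarith⟩
  have hw : (ε • spatial (L timeUnit)) 0 = 0 := by
    rw [Pi.smul_apply, spatial_zero, smul_zero]
  set w := ε • spatial (L timeUnit) with hwdef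
  have hg : ε * L timeUnit 0 = gamma c w := eq_gamma hc hε' (by
    rw [hwdef, space_smul]; linear_combination ε ^ 2 * hL₀ + c ^ 2 * hε)
  have hLe : L timeUnit = ε • (gamma c w • timeUnit + w) := by
    rw [← hg, hwdef, smul_add, smul_smul, smul_smul, ← mul_assoc, ← pow_two, hε, one_mul, one_smul,
      smul_timeUnit_add_spatial]
  refine ⟨w, lor c w ∘ₗ L, hw, isTrivial_of_mink hc (ε := ε) (fun x => ?_) hε ?_, fun x => ?_⟩
  · rw [LinearMap.comp_apply, mink_lor hc hw, hL]
  · rw [LinearMap.comp_apply, hLe, map_smul, ← lor_timeUnit hc hw, lor_lor hc hw]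
  · rw [LinearMap.comp_apply, lor_lor hc hw]

omit [IsEuclidean K] in
/-- Every Galilean transformation is the product of a trivial transformation and a boost. -/
theorem exists_gal {L : (Fin 4 → K) →ₗ[K] (Fin 4 → K)}
    (htime : ∀ x, L x 0 ^ 2 = x 0 ^ 2) (hspace : ∀ x, x 0 = 0 → space (L x) = space x) :
    ∃ (w : Fin 4 → K) (ρ : (Fin 4 → K) →ₗ[K] (Fin 4 → K)), w 0 = 0 ∧ IsTrivial ρ ∧
      ∀ x, L x = gal w (ρ x) := by
  have hε : L timeUnit 0 ^ 2 = 1 := by rw [htime]; simp [timeUnit]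
  set ε := L timeUnit 0
  have hw : (ε • spatial (L timeUnit)) 0 = 0 := by
    rw [Pi.smul_apply, spatial_zero, smul_zero]
  set w := ε • spatial (L timeUnit) with hwdef
  have hLe : L timeUnit = ε • (timeUnit + w) := by
    rw [hwdef, smul_add, smul_smul, ← pow_two, hε, one_smul, smul_timeUnit_add_spatial]
  refine ⟨w, gal w ∘ₗ L, hw, fun x => ⟨?_, ?_⟩, fun x => ?_⟩
  · rw [LinearMap.comp_apply, gal_time hw, htime]
  · have h₀ : L (spatial x) 0 = 0 := by
      have := htime (spatial x)
      rw [spatial_zero] at this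
      exact pow_eq_zero_iff two_ne_zero |>.1 (by rw [this]; ring)
    rw [LinearMap.comp_apply]
    conv_lhs => rw [← smul_timeUnit_add_spatial x, map_add, map_smul, map_add, map_smul, hLe,
      map_smul, ← gal_timeUnit, gal_gal hw]
    have h₁ (a : K) (y : Fin 4 → K) : space (a • ε • timeUnit + y) = space y := by
      simp [space, timeUnit]
    have h₂ : space x = space (spatial x) := by simp [space, spatial, timeUnit]
    rw [h₁, gal_space w h₀, hspace _ (spatial_zero x), h₂]
  · rw [LinearMap.comp_apply, gal_gal hw]

end Boosts

end Coord

/-! ### Quantification over coordinate points -/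

/-- The variables of a coordinate point bound by `allQ4` or `exQ4`. -/
def pt (n : ℕ) : Fin 4 → ℕ := ![n, n + 1, n + 2, n + 3]

theorem pt_lt {m n : ℕ} (h : m + 4 ≤ n) (j : Fin 4) : pt m j < n := by
  fin_cases j <;> simp [pt] <;> omega

/-- The variables of a triple bound by `allQ3`. -/
def pt3 (n : ℕ) : Fin 3 → ℕ := ![n, n + 1, n + 2]

theorem pt3_lt {m n : ℕ} (h : m + 3 ≤ n) (j : Fin 3) : pt3 m j < n := by
  fin_cases j <;> simp [pt3] <;> omega

namespace Quantities

open KForm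

section Assignments

variable {S M K : Type u} [Add K] [Mul K] [LE K] {A : KinStr M} (q : Quantities A K)

/-- The assignment with the coordinate point `x` as value of the variables `v_n`, …, `v_{n+3}`. -/
def upd4 (τ : ℕ → M) (n : ℕ) (x : Fin 4 → K) : ℕ → M :=
  Function.update (Function.update (Function.update (Function.update τ n (q.ι (x 0)))
    (n + 1) (q.ι (x 1))) (n + 2) (q.ι (x 2))) (n + 3) (q.ι (x 3))

/-- The assignment with the triple `x` as value of the variables `v_n`, `v_{n+1}`, `v_{n+2}`. -/
def upd3 (τ : ℕ → M) (n : ℕ) (x : Fin 3 → K) : ℕ → M :=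
  Function.update (Function.update (Function.update τ n (q.ι (x 0)))
    (n + 1) (q.ι (x 1))) (n + 2) (q.ι (x 2))

variable {τ : ℕ → M} {n m i : ℕ}

theorem sat_allQ4 {f : (Fin 4 → ℕ) → KForm S} : Sat (A.interp S) τ (allQ4 f n) ↔
    ∀ x, Sat (A.interp S) (q.upd4 τ n x) (f (pt n) (n + 4)) := by
  simp only [allQ4, q.sat_allQ]
  exact ⟨fun h x => h (x 0) (x 1) (x 2) (x 3), fun h a b c d => h ![a, b, c, d]⟩

theorem sat_exQ4 {f : (Fin 4 → ℕ) → KForm S} : Sat (A.interp S) τ (exQ4 f n) ↔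
    ∃ x, Sat (A.interp S) (q.upd4 τ n x) (f (pt n) (n + 4)) := by
  simp only [exQ4, q.sat_exQ]
  exact ⟨fun ⟨a, b, c, d, h⟩ => ⟨![a, b, c, d], h⟩, fun ⟨x, h⟩ => ⟨x 0, x 1, x 2, x 3, h⟩⟩

theorem sat_allQ3 {f : (Fin 3 → ℕ) → KForm S} : Sat (A.interp S) τ (allQ3 f n) ↔
    ∀ x, Sat (A.interp S) (q.upd3 τ n x) (f (pt3 n) (n + 3)) := by
  simp only [allQ3, q.sat_allQ]
  exact ⟨fun h x => h (x 0) (x 1) (x 2), fun h a b c => h ![a, b, c]⟩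

theorem upd4_lt (h : i < n) (x : Fin 4 → K) : q.upd4 τ n x i = τ i := by
  simp only [upd4]
  repeat rw [Function.update_of_ne (by omega)]

theorem upd4_pt (x : Fin 4 → K) (j : Fin 4) : q.upd4 τ n x (pt n j) = q.ι (x j) := by
  fin_cases j <;> simp [upd4, pt]

theorem upd4_pt_lt (h : m + 4 ≤ n) (x : Fin 4 → K) (j : Fin 4) :
    q.upd4 τ n x (pt m j) = τ (pt m j) := q.upd4_lt (pt_lt h j) x

theorem upd4_pt3_lt (h : m + 3 ≤ n) (x : Fin 4 → K) (j : Fin 3) :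
    q.upd4 τ n x (pt3 m j) = τ (pt3 m j) := q.upd4_lt (pt3_lt h j) x

theorem upd3_lt (h : i < n) (x : Fin 3 → K) : q.upd3 τ n x i = τ i := by
  simp only [upd3]
  repeat rw [Function.update_of_ne (by omega)]

theorem upd3_pt3 (x : Fin 3 → K) (j : Fin 3) : q.upd3 τ n x (pt3 n j) = q.ι (x j) := by
  fin_cases j <;> simp [upd3, pt3]

theorem upd3_pt3_lt (h : m + 3 ≤ n) (x : Fin 3 → K) (j : Fin 3) :
    q.upd3 τ n x (pt3 m j) = τ (pt3 m j) := q.upd3_lt (pt3_lt h j) x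

end Assignments

theorem _root_.update_pt_lt {M : Type u} {τ : ℕ → M} {n m : ℕ} (h : m + 4 ≤ n) (a : M)
    (j : Fin 4) : Function.update τ n a (pt m j) = τ (pt m j) :=
  Function.update_of_ne (Nat.ne_of_lt (pt_lt h j)) _ _

theorem _root_.update_pt3_lt {M : Type u} {τ : ℕ → M} {n m : ℕ} (h : m + 3 ≤ n) (a : M)
    (j : Fin 3) : Function.update τ n a (pt3 m j) = τ (pt3 m j) :=
  Function.update_of_ne (Nat.ne_of_lt (pt3_lt h j)) _ _

theorem _root_.update_lt {M : Type u} {τ : ℕ → M} {n i : ℕ} (h : i < n) (a : M) :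
    Function.update τ n a i = τ i :=
  Function.update_of_ne (Nat.ne_of_lt h) _ _

/-! ### Coordinatization and events -/

section Worldviews

variable {S M K : Type u} [Field K] [LinearOrder K] {A : KinStr M} (q : Quantities A K)

/-- The observer `k` coordinatizes the body `b` at the point `x`. -/
def W (k b : M) (x : Fin 4 → K) : Prop := A.W k b (q.ι (x 0)) (q.ι (x 1)) (q.ι (x 2)) (q.ι (x 3))

/-- The event of `k` at `x` is the event of `h` at `y`. -/
def SameEvent (k : M) (x : Fin 4 → K) (h : M) (y : Fin 4 → K) : Prop :=
  ∀ b, A.B b → (q.W k b x ↔ q.W h b y)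

/-- Light has speed `c` for the observer `k`. -/
def LightSpeed (k : M) (c : K) : Prop :=
  0 < c ∧ ∀ x y, (∃ p, A.B p ∧ A.Ph p ∧ q.W k p x ∧ q.W k p y) ↔
    Coord.space (x - y) = c ^ 2 * (x 0 - y 0) ^ 2

/-- The value of a quadruple of variables under an assignment. -/
noncomputable def vec (τ : ℕ → M) (x : Fin 4 → ℕ) : Fin 4 → K := fun j => q.val (τ (x j))

variable {τ : ℕ → M} {n m : ℕ}

theorem eq_ι_vec {x : Fin 4 → ℕ} (h : ∀ j, A.Q (τ (x j))) (j : Fin 4) :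
    τ (x j) = q.ι (q.vec τ x j) := (q.ι_val (h j)).symm

theorem vec_upd4 (x : Fin 4 → K) : q.vec (q.upd4 τ n x) (pt n) = x := by
  funext j; simp only [vec, upd4_pt, val_ι]

theorem vec_upd4_lt (h : m + 4 ≤ n) (x : Fin 4 → K) :
    q.vec (q.upd4 τ n x) (pt m) = q.vec τ (pt m) := by
  funext j; simp only [vec, q.upd4_pt_lt h]

theorem vec_upd4_lt' {y : Fin 4 → ℕ} (h : ∀ j, y j < n) (x : Fin 4 → K) :
    q.vec (q.upd4 τ n x) y = q.vec τ y := by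
  funext j; simp only [vec, q.upd4_lt (h j)]

theorem vec_update_lt (h : m + 4 ≤ n) (a : M) :
    q.vec (Function.update τ n a) (pt m) = q.vec τ (pt m) := by
  funext j; simp only [vec, update_pt_lt h]

theorem vec_update_lt' {y : Fin 4 → ℕ} (h : ∀ j, y j < n) (a : M) :
    q.vec (Function.update τ n a) y = q.vec τ y := by
  funext j; simp only [vec, update_lt (h j)]

theorem sat_W {k b : ℕ} {x : Fin 4 → ℕ} (hx : ∀ j, A.Q (τ (x j))) :
    Sat (A.interp S) τ ((KForm.W k b x : KForm S) n) ↔ q.W (τ k) (τ b) (q.vec τ x) := by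
  rw [_root_.sat_W, q.eq_ι_vec hx, q.eq_ι_vec hx, q.eq_ι_vec hx, q.eq_ι_vec hx]; rfl

theorem sat_sameEvent {k h : ℕ} {x y : Fin 4 → ℕ} (hk : k < n) (hh : h < n) (hx : ∀ j, x j < n)
    (hy : ∀ j, y j < n) (hQx : ∀ j, A.Q (τ (x j))) (hQy : ∀ j, A.Q (τ (y j))) :
    Sat (A.interp S) τ ((Kin.sameEvent k x h y : KForm S) n) ↔
      q.SameEvent (τ k) (q.vec τ x) (τ h) (q.vec τ y) := by
  simp only [Kin.sameEvent, sat_allB, sat_equi, SameEvent]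
  refine forall₂_congr fun b _ => ?_
  rw [q.sat_W (fun j => by rw [update_lt (hx j)]; exact hQx j),
    q.sat_W (fun j => by rw [update_lt (hy j)]; exact hQy j), update_lt hk, update_lt hh,
    Function.update_self, q.vec_update_lt' hx, q.vec_update_lt' hy]

end Worldviews

end Quantities

theorem Quantities.Q_ι_iff {M K : Type u} [Add K] [Mul K] [LE K] {A : KinStr M}
    (q : Quantities A K) (x : K) : A.Q (q.ι x) ↔ True := iff_true_intro (q.Q_ι x)

section LightSpeed

variable {S M K : Type u} [Field K] [LinearOrder K] {A : KinStr M} (q : Quantities A K)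
variable {τ : ℕ → M} {n : ℕ}

theorem Quantities.sat_lightSpeed {k c : ℕ} (hk : k < n) (hc : c < n) (hQ : A.Q (τ c)) :
    Sat (A.interp S) τ ((Kin.lightSpeed k c : KForm S) n) ↔
      q.LightSpeed (τ k) (q.val (τ c)) := by
  have hk₁ : k < n + 4 := by omega
  have hk₂ : k < n + 4 + 4 := by omega
  have hc₁ : c < n + 4 := by omega
  have hc₂ : c < n + 4 + 4 := by omega
  simp only [Kin.lightSpeed, sat_conj, q.sat_allQ4, sat_equi, sat_exB]
  refine and_congr ?_ (forall₂_congr fun x y => iff_congr (exists_congr fun p =>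
    and_congr Iff.rfl (and_congr (by rw [sat_Ph, Function.update_self]) ?_)) ?_)
  · rw [q.sat_ltF (Tm.good_zero.2 trivial) (Tm.good_v.2 ⟨hc, hQ⟩)]; rfl
  · rw [q.sat_W, q.sat_W, q.vec_update_lt (by omega), q.vec_update_lt (by omega),
      q.vec_upd4_lt (by omega), q.vec_upd4, q.vec_upd4, Function.update_self, update_lt hk₂,
      q.upd4_lt hk₁, q.upd4_lt hk]
    · intro j; rw [update_pt_lt (by omega), q.upd4_pt]; exact q.Q_ι _
    · intro j; rw [update_pt_lt (by omega), q.upd4_pt_lt (by omega), q.upd4_pt]; exact q.Q_ι _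
  · have h (j) : q.upd4 (q.upd4 τ n x) (n + 4) y (pt n j) = q.ι (x j) := by
      rw [q.upd4_pt_lt (by omega), q.upd4_pt]
    have hc' : q.upd4 (q.upd4 τ n x) (n + 4) y c = τ c := by
      rw [q.upd4_lt hc₁, q.upd4_lt hc]
    have h₁ (j) : pt n j < n + 4 + 4 := pt_lt (by omega) j
    have h₂ (j) : pt (n + 4) j < n + 4 + 4 := pt_lt (by omega) j
    rw [q.sat_eqF]
    · simp only [Kin.space2, Kin.time2, q.eval_add, q.eval_sub, q.eval_mul, q.eval_sq, q.eval_v,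
        q.upd4_pt, q.val_ι, h, hc', Coord.space, Pi.sub_apply]
    · simp only [Kin.space2, Tm.good_add, Tm.good_sub, Tm.good_sq, Tm.good_v, h, q.upd4_pt,
        q.Q_ι_iff, h₁, h₂, and_self]
    · simp only [Kin.time2, Tm.good_mul, Tm.good_sub, Tm.good_sq, Tm.good_v, h, q.upd4_pt,
        q.Q_ι_iff, h₁, h₂, hc', hQ, hc₂, and_self]

end LightSpeed

/-! ### The meaning of the axioms -/

/-- The sorts of the relations of a structure. -/
structure KinStr.Sorted {M : Type u} (A : KinStr M) : Prop where
  B_iff : ∀ a, A.B a ↔ ¬ A.Q a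
  IOb_B : ∀ a, A.IOb a → A.B a
  Ph_B : ∀ a, A.Ph a → A.B a
  IOb_Ph : ∀ a, ¬ (A.IOb a ∧ A.Ph a)
  W_sorts : ∀ k b x₀ x₁ x₂ x₃, A.W k b x₀ x₁ x₂ x₃ →
    A.B k ∧ A.B b ∧ A.Q x₀ ∧ A.Q x₁ ∧ A.Q x₂ ∧ A.Q x₃

section Axioms

open KForm

variable {S M K : Type u} [Field K] [LinearOrder K] {A : KinStr M} (q : Quantities A K)
variable {τ : ℕ → M}

theorem sat_axSorts_iff : Sat (A.interp S) τ ((Kin.axSorts : KForm S) 0) ↔ A.Sorted ∧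
    (∀ x y z, A.plus x y z → A.Q x ∧ A.Q y ∧ A.Q z) ∧
    (∀ x y z, A.times x y z → A.Q x ∧ A.Q y ∧ A.Q z) ∧
    (∀ x y, A.le x y → A.Q x ∧ A.Q y) ∧
    (∀ x, A.Q x → ∀ y, A.Q y → ∃ z, A.Q z ∧ A.plus x y z ∧ ∀ w, A.Q w → A.plus x y w → w = z) ∧
    (∀ x, A.Q x → ∀ y, A.Q y → ∃ z, A.Q z ∧ A.times x y z ∧
      ∀ w, A.Q w → A.times x y w → w = z) := by
  simp only [Kin.axSorts, sat_conj, sat_all, sat_equi, sat_impl, sat_neg, sat_isB, sat_isQ, sat_IOb,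
    sat_Ph, sat_plus, sat_times, sat_le, _root_.sat_W, sat_allQ, sat_exQ, sat_same, zero_add,
    Nat.reduceAdd, Matrix.cons_val, Function.update_apply, Nat.reduceEqDiff, ↓reduceIte,
    OfNat.zero_ne_ofNat, OfNat.one_ne_ofNat, zero_ne_one]
  constructor
  · rintro ⟨h₁, h₂, h₃, h₄, h₅, h₆, h₇, h₈, h₉, h₁₀⟩
    exact ⟨⟨h₁, h₂, h₃, h₄, h₈⟩, h₅, h₆, h₇, h₉, h₁₀⟩
  · rintro ⟨⟨h₁, h₂, h₃, h₄, h₈⟩, h₅, h₆, h₇, h₉, h₁₀⟩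
    exact ⟨h₁, h₂, h₃, h₄, h₅, h₆, h₇, h₈, h₉, h₁₀⟩

include q in
theorem sat_axSorts_iff_sorted : Sat (A.interp S) τ ((Kin.axSorts : KForm S) 0) ↔ A.Sorted := by
  rw [sat_axSorts_iff]
  refine ⟨fun h => h.1, fun h => ⟨h, fun x y z h => ?_, fun x y z h => ?_, fun x y h => ?_, ?_, ?_⟩⟩
  · obtain ⟨a, b, rfl, rfl, rfl⟩ := (q.plus_iff _ _ _).1 h
    exact ⟨q.Q_ι _, q.Q_ι _, q.Q_ι _⟩
  · obtain ⟨a, b, rfl, rfl, rfl⟩ := (q.times_iff _ _ _).1 h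
    exact ⟨q.Q_ι _, q.Q_ι _, q.Q_ι _⟩
  · obtain ⟨a, b, rfl, rfl, -⟩ := (q.le_iff _ _).1 h
    exact ⟨q.Q_ι _, q.Q_ι _⟩
  · simp only [q.forall_Q, q.exists_Q, q.plus_ι, q.inj.eq_iff]
    exact fun x y => ⟨_, rfl, fun _ h => h.symm⟩
  · simp only [q.forall_Q, q.exists_Q, q.times_ι, q.inj.eq_iff]
    exact fun x y => ⟨_, rfl, fun _ h => h.symm⟩

end Axioms

section Axioms

open KForm

variable {S M K : Type u} [Field K] [LinearOrder K] {A : KinStr M} (q : Quantities A K)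
variable {τ : ℕ → M}

attribute [local simp] Quantities.upd4_lt Quantities.upd4_pt Quantities.upd4_pt_lt
  Quantities.upd4_pt3_lt Quantities.upd3_lt Quantities.upd3_pt3 Quantities.upd3_pt3_lt
  update_pt_lt update_pt3_lt pt_lt pt3_lt Quantities.vec_upd4 Quantities.vec_upd4_lt
  Quantities.vec_update_lt Quantities.Q_ι_iff sat_conj sat_disj sat_impl sat_equi sat_neg sat_allB
  sat_exB
  Quantities.eval_v Quantities.eval_zero Quantities.eval_one Quantities.eval_add
  Quantities.eval_sub Quantities.eval_mul Quantities.eval_sq Tm.good_v Tm.good_zero Tm.good_one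
  Tm.good_add Tm.good_sub Tm.good_mul Tm.good_sq

theorem sat_axEv_iff (hA : A.Sorted) : Sat (A.interp S) τ ((Kin.axEv : KForm S) 0) ↔
    ∀ k, A.IOb k → ∀ h, A.IOb h → ∀ x, ∃ y, q.SameEvent k x h y := by
  simp [Kin.axEv, sat_allO hA.IOb_B, q.sat_allQ4, q.sat_exQ4, q.sat_sameEvent]

theorem sat_axSelf_iff (hA : A.Sorted) : Sat (A.interp S) τ ((Kin.axSelf : KForm S) 0) ↔
    ∀ k, A.IOb k → ∀ x, q.W k k x ↔ x 1 = 0 ∧ x 2 = 0 ∧ x 3 = 0 := by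
  simp [Kin.axSelf, sat_allO hA.IOb_B, q.sat_allQ4, q.sat_W, q.sat_eqF]

theorem sat_axSymD_iff (hA : A.Sorted) : Sat (A.interp S) τ ((Kin.axSymD : KForm S) 0) ↔
    ∀ k, A.IOb k → ∀ k', A.IOb k' → ∀ x y x' y' : Fin 4 → K, x 0 = y 0 → x' 0 = y' 0 →
      q.SameEvent k x k' x' → q.SameEvent k y k' y' →
        Coord.space (x - y) = Coord.space (x' - y') := by
  simp [Kin.axSymD, sat_allO hA.IOb_B, q.sat_allQ4, q.sat_sameEvent, q.sat_eqF, Kin.time2,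
    Kin.space2, Coord.space, sub_eq_zero]

theorem sat_axLine_iff (hA : A.Sorted) : Sat (A.interp S) τ ((Kin.axLine : KForm S) 0) ↔
    ∀ k, A.IOb k → ∀ h, A.IOb h → ∀ x y z : Fin 4 → K, q.W k h x → q.W k h y → q.W k h z →
      ∃ a : K, z - x = a • (y - x) ∨ y - x = a • (z - x) := by
  simp [Kin.axLine, sat_allO hA.IOb_B, q.sat_allQ4, q.sat_exQ, q.sat_W, q.sat_eqF, Kin.onLine,
    funext_iff, Fin.forall_fin_succ]

theorem sat_axTriv_iff (hA : A.Sorted) : Sat (A.interp S) τ ((Kin.axTriv : KForm S) 0) ↔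
    ∀ a b c : Fin 3 → K, ∀ d : Fin 4 → K, a ⬝ᵥ a = 1 → b ⬝ᵥ b = 1 → c ⬝ᵥ c = 1 → a ⬝ᵥ b = 0 →
      a ⬝ᵥ c = 0 → b ⬝ᵥ c = 0 → ∀ k, A.IOb k → ∃ k', A.IOb k' ∧ ∀ x y, q.SameEvent k x k' y ↔
        y = ![x 0 + d 0, a ⬝ᵥ ![x 1, x 2, x 3] + d 1, b ⬝ᵥ ![x 1, x 2, x 3] + d 2,
          c ⬝ᵥ ![x 1, x 2, x 3] + d 3] := by
  simp [Kin.axTriv, sat_allO hA.IOb_B, sat_exO hA.IOb_B, q.sat_allQ3, q.sat_allQ4,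
    q.sat_sameEvent, q.sat_eqF, Kin.orthogonal, Kin.dot, Kin.trivImage, dotProduct,
    Fin.sum_univ_succ, funext_iff, Fin.forall_fin_succ, add_assoc]

theorem sat_axNoAcc_iff (hA : A.Sorted) : Sat (A.interp S) τ ((Kin.axNoAcc : KForm S) 0) ↔
    ∀ k b x, q.W k b x → A.IOb k := by
  simp [Kin.axNoAcc, q.sat_allQ4, q.sat_W]
  exact ⟨fun h k b x hx => h k (hA.W_sorts _ _ _ _ _ _ hx).1 b (hA.W_sorts _ _ _ _ _ _ hx).2.1 x hx,
    fun h k _ b _ x hx => h k b x hx⟩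

theorem sat_axEther_iff (hA : A.Sorted) : Sat (A.interp S) τ ((Kin.axEther : KForm S) 0) ↔
    ∃ e, A.IOb e ∧ ∃ c, q.LightSpeed e c := by
  simp [Kin.axEther, sat_exO hA.IOb_B, q.sat_exQ, q.sat_lightSpeed]

theorem sat_axAbsTime_iff (hA : A.Sorted) : Sat (A.interp S) τ ((Kin.axAbsTime : KForm S) 0) ↔
    ∀ k, A.IOb k → ∀ k', A.IOb k' → ∀ x y x' y' : Fin 4 → K,
      q.SameEvent k x k' x' → q.SameEvent k y k' y' → (x 0 - y 0) ^ 2 = (x' 0 - y' 0) ^ 2 := by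
  simp [Kin.axAbsTime, sat_allO hA.IOb_B, q.sat_allQ4, q.sat_sameEvent, q.sat_eqF, Kin.time2]

theorem sat_axThExpPlus_iff (hA : A.Sorted) :
    Sat (A.interp S) τ ((Kin.axThExpPlus : KForm S) 0) ↔ (∃ h, A.IOb h) ∧
      ∀ k, A.IOb k → ∀ x y : Fin 4 → K, x 0 ≠ y 0 → ∃ k', A.IOb k' ∧ q.W k k' x ∧ q.W k k' y := by
  simp [Kin.axThExpPlus, sat_exO hA.IOb_B, sat_allO hA.IOb_B, q.sat_allQ4, q.sat_W,
    q.sat_eqF, sat_same]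

theorem sat_axPhc_iff (hA : A.Sorted) : Sat (A.interp S) τ ((Kin.axPhc : KForm S) 0) ↔
    ∃ c, ∀ k, A.IOb k → q.LightSpeed k c := by
  simp [Kin.axPhc, sat_allO hA.IOb_B, q.sat_exQ, q.sat_lightSpeed]

theorem sat_axThExp_iff (hA : A.Sorted) : Sat (A.interp S) τ ((Kin.axThExp : KForm S) 0) ↔
    (∃ h, A.IOb h) ∧ ∀ k, A.IOb k → ∀ c, q.LightSpeed k c → ∀ x y : Fin 4 → K,
      Coord.space (x - y) < c ^ 2 * (x 0 - y 0) ^ 2 → ∃ k', A.IOb k' ∧ q.W k k' x ∧ q.W k k' y := by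
  simp [Kin.axThExp, sat_allO hA.IOb_B, sat_exO hA.IOb_B, q.sat_allQ4, q.sat_allQ,
    q.sat_lightSpeed, q.sat_ltF, q.sat_W, sat_same, Kin.time2, Kin.space2, Coord.space]

theorem sat_stationary_iff {k h n : ℕ} (hk : k < n) (hh : h < n) :
    Sat (A.interp S) τ ((Kin.stationary k h : KForm S) n) ↔
      ∀ x y, q.W (τ k) (τ h) x → q.W (τ k) (τ h) y → x 1 = y 1 ∧ x 2 = y 2 ∧ x 3 = y 3 := by
  simp [Kin.stationary, q.sat_allQ4, q.sat_W, q.sat_eqF, hk, hh,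
    (show k < n + 4 by omega), (show h < n + 4 by omega)]

end Axioms

/-! ### The field axioms -/

section Field

open KForm

/-- The quantities of a structure that satisfies the axioms about sorts, with their addition,
multiplication and order. -/
theorem exists_operations {S M : Type u} {A : KinStr M} {τ : ℕ → M}
    (h : Sat (A.interp S) τ ((Kin.axSorts : KForm S) 0)) :
    ∃ (_ : Add {a // A.Q a}) (_ : Mul {a // A.Q a}) (_ : LE {a // A.Q a}),
      Nonempty (Quantities A {a // A.Q a}) := by
  obtain ⟨-, h₁, h₂, h₃, h₄, h₅⟩ := sat_axSorts_iff.1 h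
  choose! f hfQ hf hf' using h₄
  choose! g hgQ hg hg' using h₅
  let i₁ : Add {a // A.Q a} := ⟨fun x y => ⟨f x y, hfQ x x.2 y y.2⟩⟩
  let i₂ : Mul {a // A.Q a} := ⟨fun x y => ⟨g x y, hgQ x x.2 y y.2⟩⟩
  let i₃ : LE {a // A.Q a} := ⟨fun x y => A.le x y⟩
  refine ⟨i₁, i₂, i₃, ⟨⟨Subtype.val, Subtype.val_injective, fun a => by simp, ?_, ?_, ?_⟩⟩⟩
  · intro a b c
    constructor
    · intro h
      obtain ⟨ha, hb, hc⟩ := h₁ a b c h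
      exact ⟨⟨a, ha⟩, ⟨b, hb⟩, rfl, rfl, (hf' a ha b hb c hc h).symm⟩
    · rintro ⟨x, y, rfl, rfl, rfl⟩
      exact hf x x.2 y y.2
  · intro a b c
    constructor
    · intro h
      obtain ⟨ha, hb, hc⟩ := h₂ a b c h
      exact ⟨⟨a, ha⟩, ⟨b, hb⟩, rfl, rfl, (hg' a ha b hb c hc h).symm⟩
    · rintro ⟨x, y, rfl, rfl, rfl⟩
      exact hg x x.2 y y.2
  · intro a b
    constructor
    · intro h
      obtain ⟨ha, hb⟩ := h₃ a b h
      exact ⟨⟨a, ha⟩, ⟨b, hb⟩, rfl, rfl, h⟩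
    · rintro ⟨x, y, rfl, rfl, h⟩
      exact h

/-- The axioms of Euclidean fields. -/
structure EFieldAxioms (K : Type*) [Add K] [Mul K] [LE K] (o e : K) : Prop where
  ne : o ≠ e
  add_assoc : ∀ x y z : K, (x + y) + z = x + (y + z)
  add_comm : ∀ x y : K, x + y = y + x
  add_zero : ∀ x : K, x + o = x
  add_neg : ∀ x : K, ∃ y, x + y = o
  mul_assoc : ∀ x y z : K, (x * y) * z = x * (y * z)
  mul_comm : ∀ x y : K, x * y = y * x
  mul_one : ∀ x : K, x * e = x
  mul_inv : ∀ x : K, x ≠ o → ∃ y, x * y = e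
  mul_add : ∀ x y z : K, x * (y + z) = x * y + x * z
  le_total : ∀ x y : K, x ≤ y ∨ y ≤ x
  le_antisymm : ∀ x y : K, x ≤ y → y ≤ x → x = y
  le_trans : ∀ x y z : K, x ≤ y → y ≤ z → x ≤ z
  add_le : ∀ x y z : K, x ≤ y → x + z ≤ y + z
  mul_nonneg : ∀ x y : K, o ≤ x → o ≤ y → o ≤ x * y
  sqrt : ∀ x : K, o ≤ x → ∃ y, y * y = x

theorem sat_axEField_iff {S M K : Type u} [Add K] [Mul K] [LE K] {A : KinStr M}
    (q : Quantities A K) {τ : ℕ → M} : Sat (A.interp S) τ ((Kin.axEField : KForm S) 0) ↔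
      ∃ o e, EFieldAxioms K o e := by
  have hadd (s t : Tm) (z : ℕ) : ((s + t).valueIs z : KForm S) = KForm.exQ fun a =>
      KForm.exQ fun b => s.valueIs a ⋏ t.valueIs b ⋏ KForm.plus a b z := rfl
  have hmul (s t : Tm) (z : ℕ) : ((s * t).valueIs z : KForm S) = KForm.exQ fun a =>
      KForm.exQ fun b => s.valueIs a ⋏ t.valueIs b ⋏ KForm.times a b z := rfl
  have hv (i z : ℕ) : ((Tm.v i).valueIs z : KForm S) = KForm.same i z := rfl
  simp only [Kin.axEField, Tm.eqF, Tm.leF, Tm.sq, hadd, hmul, hv, q.sat_exQ, q.sat_allQ, sat_conj,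
    sat_impl, sat_neg, sat_disj, sat_same, sat_le, sat_plus, sat_times, zero_add, Nat.reduceAdd,
    Function.update_apply, Nat.reduceEqDiff, ↓reduceIte, OfNat.zero_ne_ofNat,
    OfNat.one_ne_ofNat, zero_ne_one, q.inj.eq_iff, q.plus_ι, q.times_ι, q.le_ι, exists_eq_left',
    ↓existsAndEq, true_and]
  refine exists₂_congr fun o e => ?_
  constructor
  · rintro ⟨h₁, h₂, h₃, h₄, h₅, h₆, h₇, h₈, h₉, h₁₀, h₁₁, h₁₂, h₁₃, h₁₄, h₁₅, h₁₆⟩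
    exact ⟨h₁, fun x y z => (h₂ x y z).symm, fun x y => (h₃ x y).symm, fun x => (h₄ x).symm,
      fun x => (h₅ x).imp fun _ => Eq.symm, fun x y z => (h₆ x y z).symm, fun x y => (h₇ x y).symm,
      fun x => (h₈ x).symm, fun x hx => (h₉ x hx).imp fun _ => Eq.symm,
      fun x y z => (h₁₀ x y z).symm, h₁₁, fun x y h h' => h₁₂ x y ⟨h, h'⟩,
      fun x y z h h' => h₁₃ x y z ⟨h, h'⟩, h₁₄, fun x y h h' => h₁₅ x y ⟨h, h'⟩,
      fun x hx => (h₁₆ x hx).imp fun _ => Eq.symm⟩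
  · rintro ⟨h₁, h₂, h₃, h₄, h₅, h₆, h₇, h₈, h₉, h₁₀, h₁₁, h₁₂, h₁₃, h₁₄, h₁₅, h₁₆⟩
    exact ⟨h₁, fun x y z => (h₂ x y z).symm, fun x y => (h₃ x y).symm, fun x => (h₄ x).symm,
      fun x => (h₅ x).imp fun _ => Eq.symm, fun x y z => (h₆ x y z).symm, fun x y => (h₇ x y).symm,
      fun x => (h₈ x).symm, fun x hx => (h₉ x hx).imp fun _ => Eq.symm,
      fun x y z => (h₁₀ x y z).symm, h₁₁, fun x y h => h₁₂ x y h.1 h.2,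
      fun x y z h => h₁₃ x y z h.1 h.2, h₁₄, fun x y h => h₁₅ x y h.1 h.2,
      fun x hx => (h₁₆ x hx).imp fun _ => Eq.symm⟩

open Classical in
/-- The field given by the axioms. -/
@[reducible] noncomputable def EFieldAxioms.field {K : Type*} [Add K] [Mul K] [LE K] {o e : K}
    (h : EFieldAxioms K o e) : Field K :=
  have hz (x : K) : o + x = x := (h.add_comm o x).trans (h.add_zero x)
  have ho (x : K) : x * o = o := by
    obtain ⟨y, hy⟩ := h.add_neg (x * o)
    have h₁ : x * o + x * o = x * o := by rw [← h.mul_add, h.add_zero]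
    have h₂ := h.add_assoc (x * o) (x * o) y
    rwa [h₁, hy, h.add_zero, eq_comm] at h₂
  { add := (· + ·)
    add_assoc := h.add_assoc
    zero := o
    zero_add := hz
    add_zero := h.add_zero
    nsmul := @nsmulRec K ⟨o⟩ ⟨(· + ·)⟩
    neg := fun x => (h.add_neg x).choose
    zsmul := @zsmulRec K ⟨o⟩ ⟨(· + ·)⟩ ⟨fun x => (h.add_neg x).choose⟩
      (@nsmulRec K ⟨o⟩ ⟨(· + ·)⟩)
    neg_add_cancel := fun x => (h.add_comm _ _).trans (h.add_neg x).choose_spec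
    add_comm := h.add_comm
    mul := (· * ·)
    left_distrib := h.mul_add
    right_distrib := fun x y z => by
      change (x + y) * z = x * z + y * z
      rw [h.mul_comm, h.mul_add, h.mul_comm z x, h.mul_comm z y]
    zero_mul := fun x => (h.mul_comm o x).trans (ho x)
    mul_zero := ho
    mul_assoc := h.mul_assoc
    one := e
    one_mul := fun x => (h.mul_comm e x).trans (h.mul_one x)
    mul_one := h.mul_one
    mul_comm := h.mul_comm
    inv := fun x => if hx : x = o then o else (h.mul_inv x hx).choose
    exists_pair_ne := ⟨o, e, h.ne⟩
    mul_inv_cancel := fun x hx => by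
      change x * (if hx : x = o then o else (h.mul_inv x hx).choose) = e
      rw [dif_neg (show ¬ x = o from hx)]
      exact (h.mul_inv x hx).choose_spec
    inv_zero := dif_pos rfl
    nnqsmul := _
    qsmul := _ }

open Classical in
/-- The order given by the axioms. -/
@[reducible] noncomputable def EFieldAxioms.linearOrder {K : Type*} [Add K] [Mul K] [LE K]
    {o e : K} (h : EFieldAxioms K o e) : LinearOrder K where
  le := (· ≤ ·)
  le_refl x := (h.le_total x x).elim id id
  le_trans := h.le_trans
  le_antisymm := h.le_antisymm
  le_total := h.le_total
  toDecidableLE := inferInstance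

/-- The quantities of a structure that satisfies the axioms about sorts and quantities form a
Euclidean field. -/
theorem exists_quantities {S M : Type u} {A : KinStr M} {τ : ℕ → M}
    (h₁ : Sat (A.interp S) τ ((Kin.axSorts : KForm S) 0))
    (h₂ : Sat (A.interp S) τ ((Kin.axEField : KForm S) 0)) :
    ∃ (K : Type u) (_ : Field K) (_ : LinearOrder K) (_ : IsStrictOrderedRing K)
      (_ : IsEuclidean K), Nonempty (Quantities A K) := by
  obtain ⟨i₁, i₂, i₃, ⟨q⟩⟩ := exists_operations h₁
  obtain ⟨o, e, h⟩ := (sat_axEField_iff q).1 h₂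
  let i₄ := h.field
  let i₅ := h.linearOrder
  have hadd (x y z : {a // A.Q a}) (hxy : x ≤ y) : x + z ≤ y + z := h.add_le x y z hxy
  have i₆ : IsOrderedAddMonoid {a // A.Q a} :=
    ⟨fun x y hxy z => hadd x y z hxy, fun x y hxy z => by
      rw [add_comm z, add_comm z]; exact hadd x y z hxy⟩
  have i₇ : ZeroLEOneClass {a // A.Q a} := ⟨by
    rcases h.le_total o e with h' | h'
    · exact h'
    · have h₃ : (0 : {a // A.Q a}) ≤ -1 := by
        have := h.add_le _ _ (-1) h'
        change (1 : {a // A.Q a}) + -1 ≤ 0 + -1 at this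
        simpa using this
      have h₄ : (0 : {a // A.Q a}) ≤ -1 * -1 := h.mul_nonneg _ _ h₃ h₃
      simpa using h₄⟩
  have i₈ : IsStrictOrderedRing {a // A.Q a} := IsStrictOrderedRing.of_mul_pos fun x y hx hy =>
    lt_of_le_of_ne (h.mul_nonneg x y hx.le hy.le) (mul_ne_zero hx.ne' hy.ne').symm
  refine ⟨{a // A.Q a}, i₄, i₅, i₈, ⟨fun x hx => ?_⟩,
    ⟨⟨q.ι, q.inj, q.Q_iff, q.plus_iff, q.times_iff, q.le_iff⟩⟩⟩
  obtain ⟨y, hy⟩ := h.sqrt x hx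
  exact ⟨y, (pow_two y).trans hy⟩

/-- Every Euclidean field satisfies the axioms about quantities. -/
theorem sat_axEField {S M K : Type u} [Field K] [LinearOrder K] [IsStrictOrderedRing K]
    [IsEuclidean K] {A : KinStr M} (q : Quantities A K) {τ : ℕ → M} :
    Sat (A.interp S) τ ((Kin.axEField : KForm S) 0) := by
  refine (sat_axEField_iff q).2 ⟨0, 1, zero_ne_one, add_assoc, add_comm, add_zero,
    fun x => ⟨-x, add_neg_cancel x⟩, mul_assoc, mul_comm, mul_one,
    fun x hx => ⟨x⁻¹, mul_inv_cancel₀ hx⟩, mul_add, le_total, fun _ _ => le_antisymm,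
    fun _ _ _ => le_trans, fun x y z h => by gcongr, fun _ _ => mul_nonneg, fun x hx => ?_⟩
  obtain ⟨y, hy⟩ := IsEuclidean.exists_sq x hx
  exact ⟨y, (pow_two y).symm.trans hy⟩

end Field

open Coord

/-! ### Models of the two theories -/

section Models

variable {S M K : Type u} [Field K] [LinearOrder K]

/-- The meaning of the common axioms of the two theories. -/
structure CommonAxioms {A : KinStr M} (q : Quantities A K) : Prop where
  sorted : A.Sorted
  ev : ∀ k, A.IOb k → ∀ h, A.IOb h → ∀ x, ∃ y, q.SameEvent k x h y
  self : ∀ k, A.IOb k → ∀ x, q.W k k x ↔ x 1 = 0 ∧ x 2 = 0 ∧ x 3 = 0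
  symD : ∀ k, A.IOb k → ∀ k', A.IOb k' → ∀ x y x' y' : Fin 4 → K, x 0 = y 0 → x' 0 = y' 0 →
    q.SameEvent k x k' x' → q.SameEvent k y k' y' → space (x - y) = space (x' - y')
  line : ∀ k, A.IOb k → ∀ h, A.IOb h → ∀ x y z : Fin 4 → K, q.W k h x → q.W k h y → q.W k h z →
    ∃ a : K, z - x = a • (y - x) ∨ y - x = a • (z - x)
  triv : ∀ a b c : Fin 3 → K, ∀ d : Fin 4 → K, a ⬝ᵥ a = 1 → b ⬝ᵥ b = 1 → c ⬝ᵥ c = 1 →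
    a ⬝ᵥ b = 0 → a ⬝ᵥ c = 0 → b ⬝ᵥ c = 0 → ∀ k, A.IOb k → ∃ k', A.IOb k' ∧
      ∀ x y, q.SameEvent k x k' y ↔ y = ![x 0 + d 0, a ⬝ᵥ ![x 1, x 2, x 3] + d 1,
        b ⬝ᵥ ![x 1, x 2, x 3] + d 2, c ⬝ᵥ ![x 1, x 2, x 3] + d 3]
  noAcc : ∀ k b x, q.W k b x → A.IOb k

/-- The meaning of the axioms of classical kinematics. -/
structure ClassicalAxioms {A : KinStr M} (q : Quantities A K) : Prop extends CommonAxioms q where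
  ether : ∃ e, A.IOb e ∧ ∃ c, q.LightSpeed e c
  absTime : ∀ k, A.IOb k → ∀ k', A.IOb k' → ∀ x y x' y' : Fin 4 → K,
    q.SameEvent k x k' x' → q.SameEvent k y k' y' → (x 0 - y 0) ^ 2 = (x' 0 - y' 0) ^ 2
  thExp : (∃ h, A.IOb h) ∧
    ∀ k, A.IOb k → ∀ x y : Fin 4 → K, x 0 ≠ y 0 → ∃ k', A.IOb k' ∧ q.W k k' x ∧ q.W k k' y

/-- The meaning of the axioms of relativistic kinematics. -/
structure RelativisticAxioms {A : KinStr M} (q : Quantities A K) : Prop extends CommonAxioms q where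
  phc : ∃ c, ∀ k, A.IOb k → q.LightSpeed k c
  thExp : (∃ h, A.IOb h) ∧ ∀ k, A.IOb k → ∀ c, q.LightSpeed k c → ∀ x y : Fin 4 → K,
    space (x - y) < c ^ 2 * (x 0 - y 0) ^ 2 → ∃ k', A.IOb k' ∧ q.W k k' x ∧ q.W k k' y

theorem isModel_image {Φ : Set (KForm S)} {I : Interp (kinLang S) M} :
    (∀ ψ ∈ (fun φ : KForm S => φ 0) '' Φ, TrueIn I ψ) ↔ ∀ φ ∈ Φ, ∀ τ, Sat I τ (φ 0) := by
  simp [TrueIn]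

variable [IsStrictOrderedRing K] [IsEuclidean K]

theorem isModel_classicalKin_iff {A : KinStr M} (q : Quantities A K) :
    (classicalKin S).IsModel (A.interp S) ↔ ClassicalAxioms q := by
  refine isModel_image.trans ?_
  simp only [Kin.common, Set.mem_union, Set.mem_insert_iff, Set.mem_singleton_iff, or_imp,
    forall_and, forall_eq]
  constructor
  · rintro ⟨⟨h₁, -, h₃, h₄, h₅, h₆, h₇, h₈⟩, h₉, h₁₀, h₁₁⟩
    have hA := (sat_axSorts_iff_sorted q).1 (h₁ fun _ => q.ι 0)
    exact ⟨⟨hA, (sat_axEv_iff q hA).1 (h₃ fun _ => q.ι 0), (sat_axSelf_iff q hA).1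
      (h₄ fun _ => q.ι 0), (sat_axSymD_iff q hA).1 (h₅ fun _ => q.ι 0),
      (sat_axLine_iff q hA).1 (h₆ fun _ => q.ι 0), (sat_axTriv_iff q hA).1 (h₇ fun _ => q.ι 0),
      (sat_axNoAcc_iff q hA).1 (h₈ fun _ => q.ι 0)⟩, (sat_axEther_iff q hA).1 (h₉ fun _ => q.ι 0),
      (sat_axAbsTime_iff q hA).1 (h₁₀ fun _ => q.ι 0),
      (sat_axThExpPlus_iff q hA).1 (h₁₁ fun _ => q.ι 0)⟩
  · rintro ⟨⟨hA, h₃, h₄, h₅, h₆, h₇, h₈⟩, h₉, h₁₀, h₁₁⟩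
    exact ⟨⟨fun _ => (sat_axSorts_iff_sorted q).2 hA, fun _ => sat_axEField q,
      fun _ => (sat_axEv_iff q hA).2 h₃, fun _ => (sat_axSelf_iff q hA).2 h₄,
      fun _ => (sat_axSymD_iff q hA).2 h₅, fun _ => (sat_axLine_iff q hA).2 h₆,
      fun _ => (sat_axTriv_iff q hA).2 h₇, fun _ => (sat_axNoAcc_iff q hA).2 h₈⟩,
      fun _ => (sat_axEther_iff q hA).2 h₉, fun _ => (sat_axAbsTime_iff q hA).2 h₁₀,
      fun _ => (sat_axThExpPlus_iff q hA).2 h₁₁⟩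

theorem isModel_specRel_iff {A : KinStr M} (q : Quantities A K) :
    (specRel S).IsModel (A.interp S) ↔ RelativisticAxioms q := by
  refine isModel_image.trans ?_
  simp only [Kin.common, Set.mem_union, Set.mem_insert_iff, Set.mem_singleton_iff, or_imp,
    forall_and, forall_eq]
  constructor
  · rintro ⟨⟨h₁, -, h₃, h₄, h₅, h₆, h₇, h₈⟩, h₉, h₁₀⟩
    have hA := (sat_axSorts_iff_sorted q).1 (h₁ fun _ => q.ι 0)
    exact ⟨⟨hA, (sat_axEv_iff q hA).1 (h₃ fun _ => q.ι 0), (sat_axSelf_iff q hA).1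
      (h₄ fun _ => q.ι 0), (sat_axSymD_iff q hA).1 (h₅ fun _ => q.ι 0),
      (sat_axLine_iff q hA).1 (h₆ fun _ => q.ι 0), (sat_axTriv_iff q hA).1 (h₇ fun _ => q.ι 0),
      (sat_axNoAcc_iff q hA).1 (h₈ fun _ => q.ι 0)⟩, (sat_axPhc_iff q hA).1 (h₉ fun _ => q.ι 0),
      (sat_axThExp_iff q hA).1 (h₁₀ fun _ => q.ι 0)⟩
  · rintro ⟨⟨hA, h₃, h₄, h₅, h₆, h₇, h₈⟩, h₉, h₁₀⟩
    exact ⟨⟨fun _ => (sat_axSorts_iff_sorted q).2 hA, fun _ => sat_axEField q,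
      fun _ => (sat_axEv_iff q hA).2 h₃, fun _ => (sat_axSelf_iff q hA).2 h₄,
      fun _ => (sat_axSymD_iff q hA).2 h₅, fun _ => (sat_axLine_iff q hA).2 h₆,
      fun _ => (sat_axTriv_iff q hA).2 h₇, fun _ => (sat_axNoAcc_iff q hA).2 h₈⟩,
      fun _ => (sat_axPhc_iff q hA).2 h₉, fun _ => (sat_axThExp_iff q hA).2 h₁₀⟩

omit [Field K] [LinearOrder K] [IsStrictOrderedRing K] [IsEuclidean K] in
/-- The quantities of a model of classical kinematics form a Euclidean field. -/
theorem exists_quantities_of_classical [Nonempty M] {A : KinStr M}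
    (h : (classicalKin S).IsModel (A.interp S)) :
    ∃ (K : Type u) (_ : Field K) (_ : LinearOrder K) (_ : IsStrictOrderedRing K)
      (_ : IsEuclidean K) (q : Quantities A K), ClassicalAxioms q := by
  have h' := isModel_image.1 h
  let τ : ℕ → M := fun _ => Classical.arbitrary M
  obtain ⟨K, i₁, i₂, i₃, i₄, ⟨q⟩⟩ := exists_quantities (h' Kin.axSorts (by simp [Kin.common]) τ)
    (h' Kin.axEField (by simp [Kin.common]) τ)
  exact ⟨K, i₁, i₂, i₃, i₄, q, (isModel_classicalKin_iff q).1 h⟩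

omit [Field K] [LinearOrder K] [IsStrictOrderedRing K] [IsEuclidean K] in
/-- The quantities of a model of relativistic kinematics form a Euclidean field. -/
theorem exists_quantities_of_relativistic [Nonempty M] {A : KinStr M}
    (h : (specRel S).IsModel (A.interp S)) :
    ∃ (K : Type u) (_ : Field K) (_ : LinearOrder K) (_ : IsStrictOrderedRing K)
      (_ : IsEuclidean K) (q : Quantities A K), RelativisticAxioms q := by
  have h' := isModel_image.1 h
  let τ : ℕ → M := fun _ => Classical.arbitrary M
  obtain ⟨K, i₁, i₂, i₃, i₄, ⟨q⟩⟩ := exists_quantities (h' Kin.axSorts (by simp [Kin.common]) τ)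
    (h' Kin.axEField (by simp [Kin.common]) τ)
  exact ⟨K, i₁, i₂, i₃, i₄, q, (isModel_specRel_iff q).1 h⟩

end Models

/-! ### Worldviews given by affine coordinate transformations -/

section Worldview

variable {M K : Type u} [Field K] [LinearOrder K] {A : KinStr M} (q : Quantities A K)

/-- The worldview relation in which the point `x` of the observer `k` is the point `o k + L k x` of
a fixed coordinate system, the world lines of the observers are the images of their time axes, and
the other bodies `b` have the world lines `wl b`. -/
def KinStr.Worldview (A : KinStr M) (o : M → Fin 4 → K)
    (L : M → (Fin 4 → K) →ₗ[K] (Fin 4 → K)) (wl : M → Set (Fin 4 → K)) (k b : M)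
    (x : Fin 4 → K) : Prop :=
  A.IOb k ∧ A.B b ∧ ((A.IOb b ∧ ∃ s : K, o k + L k x = o b + s • L b timeUnit) ∨
    (¬ A.IOb b ∧ o k + L k x ∈ wl b))

/-- The structure `A` with the coordinatization replaced by the worldview `F`. -/
noncomputable def Quantities.withW (q : Quantities A K) (F : M → M → (Fin 4 → K) → Prop) :
    KinStr M where
  B := A.B
  Q := A.Q
  IOb := A.IOb
  Ph := A.Ph
  plus := A.plus
  times := A.times
  le := A.le
  W k b x₀ x₁ x₂ x₃ := (A.Q x₀ ∧ A.Q x₁ ∧ A.Q x₂ ∧ A.Q x₃) ∧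
    F k b ![q.val x₀, q.val x₁, q.val x₂, q.val x₃]

/-- The quantities of the structure with another worldview. -/
noncomputable def Quantities.withWQuantities (F : M → M → (Fin 4 → K) → Prop) :
    Quantities (q.withW F) K where
  ι := q.ι
  inj := q.inj
  Q_iff := q.Q_iff
  plus_iff := q.plus_iff
  times_iff := q.times_iff
  le_iff := q.le_iff

theorem Quantities.withW_W (F : M → M → (Fin 4 → K) → Prop) (k b : M) (x : Fin 4 → K) :
    (q.withWQuantities F).W k b x ↔ F k b x := by
  have hx : ![q.val (q.ι (x 0)), q.val (q.ι (x 1)), q.val (q.ι (x 2)), q.val (q.ι (x 3))] = x := by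
    ext i; fin_cases i <;> simp
  change (A.Q (q.ι (x 0)) ∧ A.Q (q.ι (x 1)) ∧ A.Q (q.ι (x 2)) ∧ A.Q (q.ι (x 3))) ∧
    F k b ![q.val (q.ι (x 0)), q.val (q.ι (x 1)), q.val (q.ι (x 2)), q.val (q.ι (x 3))] ↔ _
  rw [hx]
  simp [q.Q_ι]

/-- A structure is determined by its worldview and its other relations. -/
theorem Quantities.withW_eq (hA : A.Sorted) {F : M → M → (Fin 4 → K) → Prop}
    (h : ∀ k b x, q.W k b x ↔ F k b x) : q.withW F = A := by
  refine KinStr.ext rfl rfl rfl rfl rfl rfl rfl ?_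
  funext k b x₀ x₁ x₂ x₃
  apply propext
  change (A.Q x₀ ∧ A.Q x₁ ∧ A.Q x₂ ∧ A.Q x₃) ∧ F k b _ ↔ _
  rw [← h]
  constructor
  · rintro ⟨⟨h₀, h₁, h₂, h₃⟩, h⟩
    simpa [Quantities.W, q.ι_val, h₀, h₁, h₂, h₃] using h
  · intro h
    obtain ⟨-, -, h₀, h₁, h₂, h₃⟩ := hA.W_sorts _ _ _ _ _ _ h
    refine ⟨⟨h₀, h₁, h₂, h₃⟩, ?_⟩
    simpa [Quantities.W, q.ι_val, h₀, h₁, h₂, h₃] using h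

/-- The conditions on the coordinate transformations of the observers that are common to the two
theories. -/
structure Transformations (A : KinStr M) (o : M → Fin 4 → K)
    (L : M → (Fin 4 → K) →ₗ[K] (Fin 4 → K)) : Prop where
  inj : ∀ k, A.IOb k → Function.Injective (L k)
  separate : ∀ z z' : Fin 4 → K, z ≠ z' → ∃ h, A.IOb h ∧ (∃ s : K, z = o h + s • L h timeUnit) ∧
    ¬ ∃ s : K, z' = o h + s • L h timeUnit
  symD : ∀ k, A.IOb k → ∀ k', A.IOb k' → ∀ x x', L k x = L k' x' → x 0 = 0 → x' 0 = 0 →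
    space x = space x'
  triv : ∀ k, A.IOb k → ∀ σ : (Fin 4 → K) →ₗ[K] (Fin 4 → K), IsTrivial σ → (∀ x, σ x 0 = x 0) →
    ∀ d, ∃ k', A.IOb k' ∧ ∀ x, o k' + L k' (σ x + d) = o k + L k x

variable {o : M → Fin 4 → K} {L : M → (Fin 4 → K) →ₗ[K] (Fin 4 → K)} {wl : M → Set (Fin 4 → K)}

/-- Observers separate points, so events are given by the points of the common coordinate system. -/
theorem Transformations.sameEvent_iff (h : Transformations A o L) (hA : A.Sorted)
    {q : Quantities A K} (hW : ∀ k b x, q.W k b x ↔ A.Worldview o L wl k b x)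
    {k k' : M} (hk : A.IOb k) (hk' : A.IOb k') (x x' : Fin 4 → K) :
    q.SameEvent k x k' x' ↔ o k + L k x = o k' + L k' x' := by
  constructor
  · intro hev
    by_contra hne
    obtain ⟨b, hb, h₁, h₂⟩ := h.separate _ _ hne
    have := (hev b (hA.IOb_B b hb)).1 ((hW ..).2 ⟨hk, hA.IOb_B b hb, .inl ⟨hb, h₁⟩⟩)
    rcases ((hW ..).1 this).2.2 with ⟨-, h₃⟩ | ⟨h₃, -⟩
    exacts [h₂ h₃, h₃ hb]
  · intro heq b _
    rw [hW, hW, KinStr.Worldview, KinStr.Worldview, heq]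
    simp [hk, hk']

omit [LinearOrder K] in
/-- The linear map with the given rows in space. -/
theorem exists_trivial_of_rows {a b c : Fin 3 → K} (haa : a ⬝ᵥ a = 1) (hbb : b ⬝ᵥ b = 1)
    (hcc : c ⬝ᵥ c = 1) (hab : a ⬝ᵥ b = 0) (hac : a ⬝ᵥ c = 0) (hbc : b ⬝ᵥ c = 0) :
    ∃ σ : (Fin 4 → K) →ₗ[K] (Fin 4 → K), IsTrivial σ ∧ ∀ x, σ x = ![x 0, a ⬝ᵥ ![x 1, x 2, x 3],
      b ⬝ᵥ ![x 1, x 2, x 3], c ⬝ᵥ ![x 1, x 2, x 3]] := by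
  let m : Matrix (Fin 3) (Fin 3) K := Matrix.of ![a, b, c]
  have h₁ : m * m.transpose = 1 := by
    ext i j
    rw [Matrix.mul_apply]
    change m i ⬝ᵥ m j = _
    have m0 : m 0 = a := rfl
    have m1 : m 1 = b := rfl
    have m2 : m 2 = c := rfl
    fin_cases i <;> fin_cases j <;> simp [m0, m1, m2, haa, hbb, hcc, hab, hac, hbc,
      dotProduct_comm b a,
      dotProduct_comm c a, dotProduct_comm c b]
  have h₂ : m.transpose * m = 1 := mul_eq_one_comm.1 h₁
  refine ⟨{ toFun := fun x => ![x 0, a ⬝ᵥ ![x 1, x 2, x 3], b ⬝ᵥ ![x 1, x 2, x 3],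
      c ⬝ᵥ ![x 1, x 2, x 3]], map_add' := fun x y => ?_, map_smul' := fun r x => ?_ },
    fun x => ⟨rfl, ?_⟩, fun x => rfl⟩
  · ext i; fin_cases i <;> simp [dotProduct, Fin.sum_univ_succ] <;> ring
  · ext i; fin_cases i <;> simp [dotProduct, Fin.sum_univ_succ] <;> ring
  · let v : Fin 3 → K := ![x 1, x 2, x 3]
    have h₃ : m.mulVec v ⬝ᵥ m.mulVec v = v ⬝ᵥ v := by
      rw [Matrix.dotProduct_mulVec, ← Matrix.mulVec_transpose, Matrix.mulVec_mulVec, h₂,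
        Matrix.one_mulVec]
    have h₄ (u : Fin 3 → K) : u ⬝ᵥ u = u 0 ^ 2 + u 1 ^ 2 + u 2 ^ 2 := by
      simp only [dotProduct, Fin.sum_univ_succ, Fin.sum_univ_zero]
      simp only [Fin.succ_zero_eq_one, Fin.succ_one_eq_two]
      ring
    rw [h₄, h₄] at h₃
    exact h₃

/-- Worldviews given by suitable transformations satisfy the common axioms. -/
theorem Transformations.commonAxioms [IsStrictOrderedRing K] (h : Transformations A o L)
    (hA : A.Sorted)
    {q : Quantities A K} (hW : ∀ k b x, q.W k b x ↔ A.Worldview o L wl k b x) :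
    CommonAxioms q where
  sorted := hA
  ev k hk k' hk' x := by
    obtain ⟨y, hy⟩ := LinearMap.surjective_of_injective (h.inj k' hk') (o k + L k x - o k')
    exact ⟨y, (h.sameEvent_iff hA hW hk hk' x y).2 (by rw [hy]; abel)⟩
  self k hk x := by
    rw [hW, KinStr.Worldview]
    simp only [hk, hA.IOb_B k hk, true_and, not_true, false_and, or_false, add_right_inj,
      ← map_smul, (h.inj k hk).eq_iff]
    constructor
    · rintro ⟨s, rfl⟩
      simp [timeUnit]
    · rintro ⟨h₁, h₂, h₃⟩
      refine ⟨x 0, ?_⟩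
      ext i; fin_cases i <;> simp [timeUnit, h₁, h₂, h₃]
  symD k hk k' hk' x y x' y' h₀ h₀' hx hy := by
    rw [h.sameEvent_iff hA hW hk hk'] at hx hy
    refine h.symD k hk k' hk' _ _ ?_ (by simp [h₀]) (by simp [h₀'])
    rw [map_sub, map_sub, ← add_sub_add_left_eq_sub _ _ (o k), hx, hy, add_sub_add_left_eq_sub]
  line k hk k' hk' x y z hx hy hz := by
    rw [hW, KinStr.Worldview] at hx hy hz
    simp only [hk, hk', hA.IOb_B k' hk', true_and, not_true, false_and, or_false] at hx hy hz
    obtain ⟨s, hx⟩ := hx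
    obtain ⟨t, hy⟩ := hy
    obtain ⟨r, hz⟩ := hz
    have h₁ : L k (y - x) = (t - s) • L k' timeUnit := by
      rw [map_sub, ← add_sub_add_left_eq_sub _ _ (o k), hx, hy]; module
    have h₂ : L k (z - x) = (r - s) • L k' timeUnit := by
      rw [map_sub, ← add_sub_add_left_eq_sub _ _ (o k), hx, hz]; module
    by_cases hts : t - s = 0
    · refine ⟨0, .inr ?_⟩
      rw [hts, zero_smul] at h₁
      rw [zero_smul]
      exact h.inj k hk (by rw [h₁, map_zero])
    · refine ⟨(r - s) / (t - s), .inl (h.inj k hk ?_)⟩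
      rw [map_smul, h₁, h₂, smul_smul, div_mul_cancel₀ _ hts]
  triv a b c d haa hbb hcc hab hac hbc k hk := by
    obtain ⟨σ, hσ, hσ'⟩ := exists_trivial_of_rows haa hbb hcc hab hac hbc
    obtain ⟨k', hk', h₁⟩ := h.triv k hk σ hσ (fun x => by rw [hσ']; rfl) d
    refine ⟨k', hk', fun x y => ?_⟩
    rw [h.sameEvent_iff hA hW hk hk', ← h₁ x, add_right_inj, (h.inj k' hk').eq_iff, eq_comm, hσ']
    have h₂ : ![x 0, a ⬝ᵥ ![x 1, x 2, x 3], b ⬝ᵥ ![x 1, x 2, x 3], c ⬝ᵥ ![x 1, x 2, x 3]] + d =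
        ![x 0 + d 0, a ⬝ᵥ ![x 1, x 2, x 3] + d 1, b ⬝ᵥ ![x 1, x 2, x 3] + d 2,
          c ⬝ᵥ ![x 1, x 2, x 3] + d 3] := by
      ext i; fin_cases i <;> rfl
    rw [h₂]
  noAcc k b x hx := ((hW ..).1 hx).1

theorem Quantities.withW_sorted (q : Quantities A K) (hA : A.Sorted)
    {F : M → M → (Fin 4 → K) → Prop} (hF : ∀ k b x, F k b x → A.IOb k ∧ A.B b) : (q.withW F).Sorted where
  B_iff := hA.B_iff
  IOb_B := hA.IOb_B
  Ph_B := hA.Ph_B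
  IOb_Ph := hA.IOb_Ph
  W_sorts _ _ _ _ _ _ h :=
    ⟨hA.IOb_B _ (hF _ _ _ h.2).1, (hF _ _ _ h.2).2, h.1.1, h.1.2.1, h.1.2.2.1, h.1.2.2.2⟩

end Worldview

open Coord

/-! ### Frames: the geometric content common to the models of the two theories -/

section Frames

variable {M K : Type u} [Field K] [LinearOrder K]

/-- The coordinate system of a base observer together with, for every observer `k`, the origin
`o k`, the velocity `w k` and the trivial transformation `ρ k` that determine the coordinates of
`k` relative to the base observer, and the world lines `wl b` of the bodies `b` that are not
observers. The same frame yields a relativistic model, in which `w k` is the spatial part of the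
four-velocity, and a classical model, in which `w k` is the ordinary velocity. -/
structure Frame (M K : Type u) [Field K] where
  c : K
  o : M → Fin 4 → K
  w : M → Fin 4 → K
  ρ : M → (Fin 4 → K) →ₗ[K] (Fin 4 → K)
  wl : M → Set (Fin 4 → K)

namespace Frame

/-- The linear part of the coordinate transformation from `k` to the base observer when boosts are
Lorentz transformations. -/
noncomputable def lorMap (D : Frame M K) (k : M) : (Fin 4 → K) →ₗ[K] (Fin 4 → K) :=
  lor D.c (D.w k) ∘ₗ D.ρ k

/-- The linear part of the coordinate transformation from `k` to the base observer when boosts are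
Galilean transformations. -/
noncomputable def galMap (D : Frame M K) (k : M) : (Fin 4 → K) →ₗ[K] (Fin 4 → K) :=
  gal (D.w k) ∘ₗ D.ρ k

/-- The conditions on a frame with base observer `e`. -/
structure Good (D : Frame M K) (A : KinStr M) (e : M) : Prop where
  sorted : A.Sorted
  c_pos : 0 < D.c
  base_mem : A.IOb e
  base_o : D.o e = 0
  base_w : D.w e = 0
  base : ∀ x, gal 0 (D.ρ e x) = x
  time_w : ∀ k, A.IOb k → D.w k 0 = 0
  trivial : ∀ k, A.IOb k → IsTrivial (D.ρ k)
  boost : ∀ w : Fin 4 → K, w 0 = 0 → ∃ k, A.IOb k ∧ D.w k = w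
  triv : ∀ k, A.IOb k → ∀ σ : (Fin 4 → K) →ₗ[K] (Fin 4 → K), IsTrivial σ → (∀ x, σ x 0 = x 0) →
    ∀ o, ∃ k', A.IOb k' ∧ D.w k' = D.w k ∧ D.ρ k' = D.ρ k ∘ₗ σ ∧ D.o k' = o
  light : ∀ z z', (∃ p, A.B p ∧ A.Ph p ∧ z ∈ D.wl p ∧ z' ∈ D.wl p) ↔ mink D.c (z - z') = 0

variable [IsStrictOrderedRing K] {D : Frame M K} {A : KinStr M} {e : M}

/-- For every family of boosts, the coordinate transformations given by a frame satisfy the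
conditions common to the two theories. -/
theorem Good.transformations (h : D.Good A e) (Λ : (Fin 4 → K) → (Fin 4 → K) →ₗ[K] (Fin 4 → K))
    (hinj : ∀ w, w 0 = 0 → Function.Injective (Λ w))
    (haxis : ∀ w, w 0 = 0 → ∃ a : K, Λ w timeUnit = a • timeUnit + w)
    (hsym : ∀ w w', w 0 = 0 → w' 0 = 0 → ∀ x x', Λ w x = Λ w' x' → x 0 = 0 → x' 0 = 0 →
      space x = space x') :
    Transformations A D.o (fun k => Λ (D.w k) ∘ₗ D.ρ k) where
  inj k hk := (hinj _ (h.time_w k hk)).comp (h.trivial k hk).injective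
  separate z z' hne := by
    have hline (w : Fin 4 → K) (hw : w 0 = 0) : ∃ k, A.IOb k ∧ D.o k = z ∧
        ∃ a r : K, r ≠ 0 ∧ Λ (D.w k) (D.ρ k timeUnit) = a • timeUnit + r • w := by
      obtain ⟨k, hk, hkw⟩ := h.boost w hw
      obtain ⟨k', hk', h₁, h₂, h₃⟩ := h.triv k hk LinearMap.id (fun _ => ⟨rfl, rfl⟩)
        (fun _ => rfl) z
      obtain ⟨a, ha⟩ := haxis w hw
      obtain ⟨r, hr, hr', -⟩ := (h.trivial k' hk').exists_time
      refine ⟨k', hk', h₃, r * a, r, fun h => by simp [h] at hr, ?_⟩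
      rw [h₁, hkw, hr', map_smul, ha, smul_add, smul_smul]
    obtain ⟨k, hk, hko, a, _, _, ha⟩ := hline 0 rfl
    by_cases hz : ∃ s : K, z' = D.o k + s • (Λ (D.w k) ∘ₗ D.ρ k) timeUnit
    · obtain ⟨s, hs⟩ := hz
      obtain ⟨k', hk', hko', a', r, hr, ha'⟩ := hline ![0, 1, 0, 0] rfl
      refine ⟨k', hk', ⟨0, by rw [zero_smul, add_zero, hko']⟩, ?_⟩
      rintro ⟨s', hs'⟩
      rw [LinearMap.comp_apply, ha, hko, smul_zero, add_zero] at hs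
      rw [LinearMap.comp_apply, ha', hko', hs] at hs'
      have h₁ := congrFun (add_left_cancel hs') 1
      have h₂ : s' = 0 := by simpa [timeUnit, hr] using h₁.symm
      rw [add_left_cancel hs', h₂, zero_smul, add_zero] at hs
      exact hne hs.symm
    · exact ⟨k, hk, ⟨0, by rw [zero_smul, add_zero, hko]⟩, hz⟩
  symD k hk k' hk' x x' heq hx hx' := by
    obtain ⟨r, -, -, hr⟩ := (h.trivial k hk).exists_time
    obtain ⟨r', -, -, hr'⟩ := (h.trivial k' hk').exists_time
    rw [← (h.trivial k hk x).2, ← (h.trivial k' hk' x').2]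
    exact hsym _ _ (h.time_w k hk) (h.time_w k' hk') _ _ heq (by rw [hr, hx, mul_zero])
      (by rw [hr', hx', mul_zero])
  triv k hk σ hσ hσ' d := by
    obtain ⟨σ', h₁, h₂, h₃⟩ := hσ.exists_inverse
    have h₄ (x) : σ' x 0 = x 0 := by rw [← hσ' (σ' x), h₃]
    obtain ⟨k', hk', h₅, h₆, h₇⟩ := h.triv k hk σ' h₁ h₄
      (D.o k - Λ (D.w k) (D.ρ k (σ' d)))
    refine ⟨k', hk', fun x => ?_⟩
    rw [h₅, h₆, h₇]
    simp only [LinearMap.comp_apply, map_add, h₂]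
    abel

theorem Good.transformations_gal (h : D.Good A e) : Transformations A D.o D.galMap := by
  refine h.transformations gal (fun w hw x y hxy => ?_) (fun w _ => ⟨1, ?_⟩)
    (fun w w' _ _ x x' heq hx hx' => ?_)
  · rw [← gal_gal hw x, hxy, gal_gal hw]
  · rw [gal_timeUnit, one_smul]
  · rw [← gal_space w hx, heq, gal_space w' hx']

variable [IsEuclidean K]

theorem Good.transformations_lor (h : D.Good A e) : Transformations A D.o D.lorMap := by
  refine h.transformations (lor D.c) (fun w hw x y hxy => ?_) (fun w hw => ⟨gamma D.c w, ?_⟩)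
    (fun w w' hw hw' x x' heq hx hx' => ?_)
  · rw [← lor_lor h.c_pos hw x, hxy, lor_lor h.c_pos hw]
  · exact lor_timeUnit h.c_pos hw
  · have := mink_lor h.c_pos hw x
    rw [heq, mink_lor h.c_pos hw', mink_of_time_eq_zero _ hx, mink_of_time_eq_zero _ hx'] at this
    exact neg_injective this.symm

theorem Good.mink_lorMap (h : D.Good A e) {k : M} (hk : A.IOb k) (x : Fin 4 → K) :
    mink D.c (D.lorMap k x) = mink D.c x := by
  rw [lorMap, LinearMap.comp_apply, mink_lor h.c_pos (h.time_w k hk), (h.trivial k hk).mink]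

omit [IsStrictOrderedRing K] [IsEuclidean K] in
theorem Good.galMap_base (h : D.Good A e) (x : Fin 4 → K) : D.galMap e x = x := by
  rw [galMap, LinearMap.comp_apply, h.base_w, h.base]

theorem Good.lorMap_base (h : D.Good A e) (x : Fin 4 → K) : D.lorMap e x = x := by
  rw [lorMap, LinearMap.comp_apply, h.base_w, lor_zero h.c_pos, h.base]

omit [IsEuclidean K] in
/-- Observers of every velocity have their origin at any given point. -/
theorem Good.exists_observer (h : D.Good A e) {w : Fin 4 → K} (hw : w 0 = 0) (z : Fin 4 → K) :
    ∃ k, A.IOb k ∧ D.w k = w ∧ D.o k = z ∧ ∃ r : K, r ^ 2 = 1 ∧ D.ρ k timeUnit = r • timeUnit := by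
  obtain ⟨k, hk, hkw⟩ := h.boost w hw
  obtain ⟨k', hk', h₁, -, h₃⟩ := h.triv k hk LinearMap.id (fun _ => ⟨rfl, rfl⟩) (fun _ => rfl) z
  obtain ⟨r, hr, hr', -⟩ := (h.trivial k' hk').exists_time
  exact ⟨k', hk', h₁.trans hkw, h₃, r, hr, hr'⟩

end Frame

end Frames

section LightSpeedOfWorldview

variable {M K : Type u} [Field K] [LinearOrder K] [IsStrictOrderedRing K] {A : KinStr M}
  {q : Quantities A K}

/-- The speed of light of an observer is unique. -/
theorem Quantities.LightSpeed.unique {k : M} {c c' : K} (h : q.LightSpeed k c)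
    (h' : q.LightSpeed k c') : c = c' := by
  have h₁ := (h'.2 ![1, c, 0, 0] 0).1 ((h.2 _ _).2 (by simp [space]))
  simp only [space, sub_zero, Matrix.cons_val, Pi.zero_apply] at h₁
  exact (pow_left_inj₀ h.1.le h'.1.le two_ne_zero).1 (by linear_combination h₁)

variable {D : Frame M K} {L : M → (Fin 4 → K) →ₗ[K] (Fin 4 → K)} {e : M}

omit [IsStrictOrderedRing K] in
theorem Frame.Good.light_iff (h : D.Good A e)
    (hW : ∀ k b x, q.W k b x ↔ A.Worldview D.o L D.wl k b x) {k : M} (hk : A.IOb k)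
    (x y : Fin 4 → K) : (∃ p, A.B p ∧ A.Ph p ∧ q.W k p x ∧ q.W k p y) ↔
      mink D.c (L k (x - y)) = 0 := by
  rw [map_sub, ← add_sub_add_left_eq_sub _ _ (D.o k), ← h.light]
  refine exists_congr fun p => and_congr_right fun hp => and_congr_right fun hp' => ?_
  have hp'' : ¬ A.IOb p := fun h' => h.sorted.IOb_Ph p ⟨h', hp'⟩
  simp only [hW, KinStr.Worldview, hk, hp, hp'', true_and, false_and, not_false_eq_true, false_or]

omit [IsStrictOrderedRing K] in
theorem Frame.Good.lightSpeed (h : D.Good A e)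
    (hW : ∀ k b x, q.W k b x ↔ A.Worldview D.o L D.wl k b x) {k : M} (hk : A.IOb k)
    (hL : ∀ x, mink D.c (L k x) = mink D.c x) : q.LightSpeed k D.c := by
  refine ⟨h.c_pos, fun x y => ?_⟩
  rw [h.light_iff hW hk, hL, mink, Pi.sub_apply, sub_eq_zero, eq_comm]

/-- The observers with some speed of light in the classical model given by a frame are those at rest
with respect to the base observer. -/
theorem Frame.Good.exists_lightSpeed_iff (h : D.Good A e)
    (hW : ∀ k b x, q.W k b x ↔ A.Worldview D.o D.galMap D.wl k b x) {k : M} (hk : A.IOb k) :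
    (∃ c, q.LightSpeed k c) ↔ D.w k = 0 := by
  constructor
  · rintro ⟨c, hc, hl⟩
    obtain ⟨σ, hσ, -, hρσ⟩ := (h.trivial k hk).exists_inverse
    have h₁ (v : Fin 4 → K) (hv : mink c v = 0) : mink D.c (gal (D.w k) v) = 0 := by
      have h₂ := (hl (σ v) 0).2 (by
        have := hσ.mink c v
        rw [hv, mink, sub_eq_zero] at this
        rw [sub_zero, Pi.zero_apply, sub_zero, this])
      rw [h.light_iff hW hk, sub_zero, galMap, LinearMap.comp_apply, hρσ] at h₂
      exact h₂
    have h₂ (a₁ a₂ a₃ : K) (ha : a₁ ^ 2 + a₂ ^ 2 + a₃ ^ 2 = c ^ 2) :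
        D.c ^ 2 = (D.w k 1 - a₁) ^ 2 + (D.w k 2 - a₂) ^ 2 + (D.w k 3 - a₃) ^ 2 := by
      have := h₁ ![1, a₁, a₂, a₃] (by simp [mink, space, ha])
      simp only [mink, gal_apply, space, timeUnit, Pi.sub_apply, Pi.add_apply, Pi.smul_apply,
        Matrix.cons_val, smul_eq_mul, h.time_w k hk] at this
      linear_combination this
    have hc' : 4 * c ≠ 0 := mul_ne_zero four_ne_zero hc.ne'
    refine eq_zero_of_space (h.time_w k hk) ?_
    have e₁ : D.w k 1 = 0 := (mul_eq_zero.1 (by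
      linear_combination h₂ c 0 0 (by ring) - h₂ (-c) 0 0 (by ring) :
        4 * c * D.w k 1 = 0)).resolve_left hc'
    have e₂ : D.w k 2 = 0 := (mul_eq_zero.1 (by
      linear_combination h₂ 0 c 0 (by ring) - h₂ 0 (-c) 0 (by ring) :
        4 * c * D.w k 2 = 0)).resolve_left hc'
    have e₃ : D.w k 3 = 0 := (mul_eq_zero.1 (by
      linear_combination h₂ 0 0 c (by ring) - h₂ 0 0 (-c) (by ring) :
        4 * c * D.w k 3 = 0)).resolve_left hc'
    simp [space, e₁, e₂, e₃]
  · intro hw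
    refine ⟨D.c, h.lightSpeed hW hk fun x => ?_⟩
    rw [galMap, LinearMap.comp_apply, hw, gal_apply, ← (h.trivial k hk).mink D.c x]
    simp only [mink, space, timeUnit, Pi.sub_apply, Pi.add_apply, Pi.smul_apply, Pi.zero_apply,
      Matrix.cons_val, smul_eq_mul]
    ring

/-- The classical model given by a frame. -/
theorem Frame.Good.classicalAxioms [IsEuclidean K] (h : D.Good A e)
    (hW : ∀ k b x, q.W k b x ↔ A.Worldview D.o D.galMap D.wl k b x) : ClassicalAxioms q := by
  have hT := h.transformations_gal
  have htime {k} (hk : A.IOb k) (x : Fin 4 → K) : D.galMap k x 0 ^ 2 = x 0 ^ 2 := by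
    rw [galMap, LinearMap.comp_apply, gal_time (h.time_w k hk), (h.trivial k hk x).1]
  refine ⟨hT.commonAxioms h.sorted hW, ⟨e, h.base_mem, D.c, h.lightSpeed hW h.base_mem
    fun x => by rw [h.galMap_base]⟩, fun k hk k' hk' x y x' y' hx hy => ?_, ⟨e, h.base_mem⟩,
    fun k hk x y hxy => ?_⟩
  · rw [hT.sameEvent_iff h.sorted hW hk hk'] at hx hy
    rw [← Pi.sub_apply, ← htime hk, map_sub, ← add_sub_add_left_eq_sub _ _ (D.o k), hx, hy,
      add_sub_add_left_eq_sub, ← map_sub, htime hk', Pi.sub_apply]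
  · let u := D.galMap k (y - x)
    have hu : u 0 ≠ 0 := fun h₀ => by
      have : u 0 ^ 2 = _ := htime hk (y - x)
      rw [h₀, Pi.sub_apply, zero_pow two_ne_zero, eq_comm, sq_eq_zero_iff, sub_eq_zero] at this
      exact hxy this.symm
    obtain ⟨k', hk', h₁, h₂, r, hr, h₃⟩ :=
      h.exists_observer (spatial_zero ((u 0)⁻¹ • u)) (D.o k + D.galMap k x)
    have h₄ : D.galMap k' timeUnit = (r * (u 0)⁻¹) • u := by
      have : timeUnit + spatial ((u 0)⁻¹ • u) = (u 0)⁻¹ • u := by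
        have h₅ : ((u 0)⁻¹ • u) 0 = 1 := inv_mul_cancel₀ hu
        nth_rw 2 [← smul_timeUnit_add_spatial ((u 0)⁻¹ • u)]
        rw [h₅, one_smul]
      rw [galMap, LinearMap.comp_apply, h₃, map_smul, h₁, gal_timeUnit, this, smul_smul]
    have hB := h.sorted.IOb_B k' hk'
    refine ⟨k', hk', (hW ..).2 ⟨hk, hB, .inl ⟨hk', 0, ?_⟩⟩,
      (hW ..).2 ⟨hk, hB, .inl ⟨hk', r * u 0, ?_⟩⟩⟩
    · rw [h₂, zero_smul, add_zero]
    · have : r * u 0 * (r * (u 0)⁻¹) = 1 := by field_simp; exact hr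
      rw [h₂, h₄, smul_smul, this, one_smul, add_assoc, ← map_add, add_sub_cancel]

/-- The relativistic model given by a frame. -/
theorem Frame.Good.relativisticAxioms [IsEuclidean K] (h : D.Good A e)
    (hW : ∀ k b x, q.W k b x ↔ A.Worldview D.o D.lorMap D.wl k b x) : RelativisticAxioms q := by
  have hT := h.transformations_lor
  have hlight (k) (hk : A.IOb k) : q.LightSpeed k D.c := h.lightSpeed hW hk (h.mink_lorMap hk)
  refine ⟨hT.commonAxioms h.sorted hW, ⟨D.c, hlight⟩, ⟨e, h.base_mem⟩,
    fun k hk c hc x y hxy => ?_⟩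
  rw [hc.unique (hlight k hk)] at hxy
  let u := D.lorMap k (y - x)
  have hu : 0 < mink D.c u := by
    rw [h.mink_lorMap hk, mink_sub_comm, mink, Pi.sub_apply]; linarith
  have hc₀ := h.c_pos
  obtain ⟨r, hr⟩ := IsEuclidean.exists_sq (mink D.c u / D.c ^ 2) (by positivity)
  have hr₀ : r ≠ 0 := fun h₀ => by
    rw [h₀, zero_pow two_ne_zero, eq_comm, div_eq_zero_iff] at hr
    exact hr.elim hu.ne' (by positivity)
  -- The sign of the proper time `t` is chosen so that `u / t` is future directed.
  obtain ⟨t, ht₀, ht, hut⟩ : ∃ t : K, t ≠ 0 ∧ t ^ 2 = mink D.c u / D.c ^ 2 ∧ 0 ≤ t⁻¹ * u 0 := by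
    rcases le_total 0 (r⁻¹ * u 0) with h₀ | h₀
    · exact ⟨r, hr₀, hr, h₀⟩
    · exact ⟨-r, neg_ne_zero.2 hr₀, by rw [neg_sq, hr], by rw [inv_neg, neg_mul]; linarith⟩
  have hv : mink D.c (t⁻¹ • u) = D.c ^ 2 := by
    rw [mink_smul, inv_pow, ht]; field_simp
  have hspace : space (spatial (t⁻¹ • u)) = space (t⁻¹ • u) := by
    simp [spatial, space, timeUnit]
  have hgamma : (t⁻¹ • u) 0 = gamma D.c (spatial (t⁻¹ • u)) := by
    refine eq_gamma hc₀ hut ?_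
    rw [hspace]
    rw [mink] at hv
    linear_combination hv
  obtain ⟨k', hk', h₁, h₂, s, hs, h₃⟩ :=
    h.exists_observer (spatial_zero (t⁻¹ • u)) (D.o k + D.lorMap k x)
  have h₄ : D.lorMap k' timeUnit = (s * t⁻¹) • u := by
    rw [lorMap, LinearMap.comp_apply, h₃, map_smul, h₁, lor_timeUnit hc₀ (spatial_zero _),
      ← hgamma, smul_timeUnit_add_spatial, smul_smul]
  have hB := h.sorted.IOb_B k' hk'
  refine ⟨k', hk', (hW ..).2 ⟨hk, hB, .inl ⟨hk', 0, ?_⟩⟩,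
    (hW ..).2 ⟨hk, hB, .inl ⟨hk', s * t, ?_⟩⟩⟩
  · rw [h₂, zero_smul, add_zero]
  · have : s * t * (s * t⁻¹) = 1 := by field_simp; exact hs
    rw [h₂, h₄, smul_smul, this, one_smul, add_assoc, ← map_add, add_sub_cancel]

end LightSpeedOfWorldview

open Coord

/-! ### Every model comes from a frame -/

section Coordinates

variable {M K : Type u} [Field K] [LinearOrder K] {A : KinStr M} {q : Quantities A K}

theorem Quantities.SameEvent.symm {k h : M} {x y : Fin 4 → K} (H : q.SameEvent k x h y) :
    q.SameEvent h y k x := fun b hb => (H b hb).symm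

theorem Quantities.SameEvent.trans {k h l : M} {x y z : Fin 4 → K} (H : q.SameEvent k x h y)
    (H' : q.SameEvent h y l z) : q.SameEvent k x l z := fun b hb => (H b hb).trans (H' b hb)

/-- The map `f k` is the coordinate transformation from the observer `k` to the observer `e`. -/
structure Quantities.IsCoordinates (q : Quantities A K) (e : M)
    (f : M → (Fin 4 → K) → (Fin 4 → K)) : Prop where
  bij : ∀ k, A.IOb k → Function.Bijective (f k)
  iff : ∀ k, A.IOb k → ∀ x y, q.SameEvent k x e y ↔ y = f k x

/-- An observer does not coordinatize the same event at two points: the trivial transformation `id`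
of its coordinates leads to an observer by whom the events can be told apart. -/
theorem CommonAxioms.eq_of_sameEvent (h : CommonAxioms q) {k : M} (hk : A.IOb k)
    {x y : Fin 4 → K} (hxy : q.SameEvent k x k y) : x = y := by
  obtain ⟨k', -, hk'⟩ := h.triv ![1, 0, 0] ![0, 1, 0] ![0, 0, 1] 0 (by simp) (by simp) (by simp)
    (by simp) (by simp) (by simp) k hk
  have h₁ (x y : Fin 4 → K) : q.SameEvent k x k' y ↔ y = x := by
    rw [hk']
    have : ![x 0, x 1, x 2, x 3] = x := by ext i; fin_cases i <;> rfl
    simp [this]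
  exact ((h₁ x y).1 (hxy.trans ((h₁ y y).2 rfl))).symm

theorem CommonAxioms.exists_coordinates (h : CommonAxioms q) {e : M} (he : A.IOb e) :
    ∃ f, q.IsCoordinates e f := by
  choose! f hf using fun k hk => h.ev k hk e he
  refine ⟨f, fun k hk => ⟨fun x y hxy => h.eq_of_sameEvent hk ?_, fun y => ?_⟩,
    fun k hk x y => ⟨fun hy => h.eq_of_sameEvent he (hy.symm.trans (hf k hk x)), ?_⟩⟩
  · have := (hf k hk y).symm
    rw [← hxy] at this
    exact (hf k hk x).trans this
  · obtain ⟨x, hx⟩ := h.ev e he k hk y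
    exact ⟨x, h.eq_of_sameEvent he ((hf k hk x).symm.trans hx.symm)⟩
  · rintro rfl
    exact hf k hk x

namespace Quantities.IsCoordinates

variable {e : M} {f : M → (Fin 4 → K) → (Fin 4 → K)}

theorem sameEvent_iff (hf : q.IsCoordinates e f) {k h : M} (hk : A.IOb k) (hh : A.IOb h)
    (x y : Fin 4 → K) : q.SameEvent k x h y ↔ f k x = f h y := by
  rw [← hf.iff h hh]
  have h₁ := (hf.iff k hk x _).2 rfl
  exact ⟨fun h => h.symm.trans h₁, fun h => h₁.trans h.symm⟩

theorem base (hf : q.IsCoordinates e f) (he : A.IOb e) (x : Fin 4 → K) : f e x = x :=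
  ((hf.iff e he x x).1 fun _ _ => Iff.rfl).symm

theorem W_iff (hf : q.IsCoordinates e f) {k b : M} (hk : A.IOb k) (hb : A.B b) (x : Fin 4 → K) :
    q.W k b x ↔ q.W e b (f k x) := (hf.iff k hk x _).2 rfl b hb

theorem W_observer_iff (hf : q.IsCoordinates e f) (h : CommonAxioms q) {k b : M} (hk : A.IOb k)
    (hb : A.IOb b) (x : Fin 4 → K) : q.W k b x ↔ ∃ s : K, f k x = f b (s • timeUnit) := by
  obtain ⟨y, hy⟩ := (hf.bij b hb).2 (f k x)
  have hB := h.sorted.IOb_B b hb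
  rw [hf.W_iff hk hB, ← hy, ← hf.W_iff hb hB, h.self b hb]
  simp only [(hf.bij b hb).1.eq_iff]
  constructor
  · rintro ⟨h₁, h₂, h₃⟩
    refine ⟨y 0, ?_⟩
    ext i; fin_cases i <;> simp [timeUnit, h₁, h₂, h₃]
  · rintro ⟨s, rfl⟩
    simp [timeUnit]

/-- The points at which `e` coordinatizes an observer lie on a straight line. -/
theorem _root_.CommonAxioms.exists_smul (h : CommonAxioms q) (he : A.IOb e) {b : M}
    (hb : A.IOb b) {x y : Fin 4 → K} (hxy : x ≠ y) (hx : q.W e b x) (hy : q.W e b y)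
    {z : Fin 4 → K} (hz : q.W e b z) : ∃ a : K, z - x = a • (y - x) := by
  obtain ⟨a, ha | ha⟩ := h.line e he b hb x y z hx hy hz
  · exact ⟨a, ha⟩
  · have ha₀ : a ≠ 0 := by
      rintro rfl
      rw [zero_smul, sub_eq_zero] at ha
      exact hxy ha.symm
    exact ⟨a⁻¹, by rw [ha, inv_smul_smul₀ ha₀]⟩

variable [IsStrictOrderedRing K]

/-- The rows of a trivial transformation are orthonormal. -/
theorem _root_.Coord.IsTrivial.exists_rows
    {σ : (Fin 4 → K) →ₗ[K] (Fin 4 → K)} (hσ : IsTrivial σ) (hσ' : ∀ x, σ x 0 = x 0) :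
    ∃ a b c : Fin 3 → K, a ⬝ᵥ a = 1 ∧ b ⬝ᵥ b = 1 ∧ c ⬝ᵥ c = 1 ∧ a ⬝ᵥ b = 0 ∧ a ⬝ᵥ c = 0 ∧
      b ⬝ᵥ c = 0 ∧ ∀ x, σ x = ![x 0, a ⬝ᵥ ![x 1, x 2, x 3], b ⬝ᵥ ![x 1, x 2, x 3],
        c ⬝ᵥ ![x 1, x 2, x 3]] := by
  obtain ⟨r, m, -, hm, hσm⟩ := hσ.exists_matrix
  have h₁ (i j) : m i ⬝ᵥ m j = (1 : Matrix (Fin 3) (Fin 3) K) i j := by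
    rw [← hm, Matrix.mul_apply]; rfl
  refine ⟨m 0, m 1, m 2, by simp [h₁], by simp [h₁], by simp [h₁], by simp [h₁], by simp [h₁],
    by simp [h₁], fun x => ?_⟩
  ext i
  refine Fin.cases (hσ' x) (fun i => ?_) i
  have hx : Matrix.vecTail x = ![x 1, x 2, x 3] := by ext j; fin_cases j <;> rfl
  rw [hσm, hx]
  fin_cases i <;> rfl

/-- A model comes from a frame as soon as its coordinate transformations are compositions of boosts
and trivial transformations. -/
theorem exists_frame (hf : q.IsCoordinates e f) (h : CommonAxioms q) (he : A.IOb e)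
    (Λ : (Fin 4 → K) → (Fin 4 → K) →ₗ[K] (Fin 4 → K))
    (hinj : ∀ w, w 0 = 0 → Function.Injective (Λ w)) (hzero : Λ 0 = gal 0)
    (hdir : ∀ w w', w 0 = 0 → w' 0 = 0 → ∀ t : K, Λ w timeUnit = t • Λ w' timeUnit → w = w')
    (hlin : ∀ k, A.IOb k → ∃ (w : Fin 4 → K) (ρ : (Fin 4 → K) →ₗ[K] (Fin 4 → K)), w 0 = 0 ∧
      IsTrivial ρ ∧ ∀ x, f k x = f k 0 + Λ w (ρ x))
    (hobs : ∀ w, w 0 = 0 → ∃ k, A.IOb k ∧ q.W e k 0 ∧ q.W e k (Λ w timeUnit)) {c : K}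
    (hc : q.LightSpeed e c) : ∃ D : Frame M K, D.Good A e ∧ D.c = c ∧ ∀ k b x, q.W k b x ↔
      A.Worldview D.o (fun k => Λ (D.w k) ∘ₗ D.ρ k) D.wl k b x := by
  choose! w ρ hw hρ hfk using hlin
  have hunique {k : M} (hk : A.IOb k) {w' : Fin 4 → K} {ρ' : (Fin 4 → K) →ₗ[K] (Fin 4 → K)}
      (hw' : w' 0 = 0) (hρ' : IsTrivial ρ') (hf' : ∀ x, f k x = f k 0 + Λ w' (ρ' x)) :
      w k = w' ∧ ρ k = ρ' := by
    have h₁ (x) : Λ (w k) (ρ k x) = Λ w' (ρ' x) :=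
      add_left_cancel ((hfk k hk x).symm.trans (hf' x))
    obtain ⟨r, hr, hr', -⟩ := (hρ k hk).exists_time
    obtain ⟨r', -, hr'', -⟩ := hρ'.exists_time
    have h₂ : w k = w' := by
      refine hdir _ _ (hw k hk) hw' (r * r') ?_
      have h₃ := h₁ timeUnit
      rw [hr', hr'', map_smul, map_smul] at h₃
      rw [mul_smul, ← h₃, smul_smul, ← sq, hr, one_smul]
    refine ⟨h₂, LinearMap.ext fun x => hinj w' hw' ?_⟩
    rw [← h₁, h₂]
  obtain ⟨hwe, hρe⟩ := hunique he rfl isTrivial_gal_zero fun x => by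
    rw [hf.base he, hf.base he, hzero, gal_gal rfl, zero_add]
  refine ⟨⟨c, fun k => f k 0, w, ρ, fun b => {z | q.W e b z}⟩, ⟨h.sorted, hc.1, he, hf.base he 0,
    hwe, fun x => by change gal 0 (ρ e x) = x; rw [hρe, gal_gal rfl], hw, hρ,
    fun v hv => ?_, fun k hk σ hσ hσ' o => ?_, fun z z' => (hc.2 z z').trans ?_⟩, rfl, fun k b x => ?_⟩
  · obtain ⟨k, hk, h₁, h₂⟩ := hobs v hv
    refine ⟨k, hk, ?_⟩
    rw [hf.W_observer_iff h he hk, hf.base he] at h₁ h₂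
    obtain ⟨s, hs⟩ := h₁
    obtain ⟨t, ht⟩ := h₂
    obtain ⟨r, hr, hr', -⟩ := (hρ k hk).exists_time
    rw [hfk k hk, map_smul, map_smul, hr', map_smul] at hs ht
    refine (hdir v (w k) hv (hw k hk) ((t - s) * r) ?_).symm
    rw [ht, eq_neg_of_add_eq_zero_left hs.symm]
    module
  · obtain ⟨σ', h₁, h₂, h₃⟩ := hσ.exists_inverse
    have h₄ (x) : σ' x 0 = x 0 := by rw [← hσ' (σ' x), h₃]
    obtain ⟨a, b, d, haa, hbb, hdd, hab, had, hbd, hrow⟩ := h₁.exists_rows h₄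
    obtain ⟨z, hz⟩ := (hf.bij k hk).2 o
    obtain ⟨k', hk', h₅⟩ := h.triv a b d (-σ' z) haa hbb hdd hab had hbd k hk
    have h₆ (x) : f k x = f k' (σ' x - σ' z) := by
      rw [← hf.sameEvent_iff hk hk', h₅, sub_eq_add_neg, hrow x]
      ext i; fin_cases i <;> rfl
    have h₇ : f k' 0 = o := by rw [← hz, h₆ z, sub_self]
    refine ⟨k', hk', ?_⟩
    have := hunique hk' (hw k hk) ((hρ k hk).comp hσ) fun y => ?_
    · exact ⟨this.1, this.2, h₇⟩
    · have h₈ := h₆ (σ y + z)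
      rw [map_add, h₂, add_sub_cancel_right] at h₈
      rw [← h₈, h₇, ← hz, hfk k hk, hfk k hk z, map_add, map_add, LinearMap.comp_apply]
      abel
  · rw [mink, Pi.sub_apply, sub_eq_zero, eq_comm]
  · constructor
    · intro hW
      have hk := h.noAcc _ _ _ hW
      have hb : A.B b := (h.sorted.W_sorts _ _ _ _ _ _ hW).2.1
      refine ⟨hk, hb, ?_⟩
      by_cases hb' : A.IOb b
      · obtain ⟨s, hs⟩ := (hf.W_observer_iff h hk hb' x).1 hW
        refine .inl ⟨hb', s, ?_⟩
        rw [hfk k hk, hfk b hb'] at hs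
        rw [← map_smul]
        exact hs
      · refine .inr ⟨hb', ?_⟩
        rw [hf.W_iff hk hb, hfk k hk] at hW
        exact hW
    · rintro ⟨hk, hb, ⟨hb', s, hs⟩ | ⟨-, hW⟩⟩
      · refine (hf.W_observer_iff h hk hb' x).2 ⟨s, ?_⟩
        rw [hfk k hk, hfk b hb']
        rw [← map_smul] at hs
        exact hs
      · rw [hf.W_iff hk hb, hfk k hk]
        exact hW

end Quantities.IsCoordinates

end Coordinates

/-! ### The coordinate transformations are linear -/

section Linearity

variable {M K : Type u} [Field K] [LinearOrder K] [IsStrictOrderedRing K]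
  {A : KinStr M} {q : Quantities A K}

/-- A Galilean boost is determined by the direction of the image of the time axis. -/
theorem gal_direction {w w' : Fin 4 → K} (hw : w 0 = 0) (hw' : w' 0 = 0) {t : K}
    (h : gal w timeUnit = t • gal w' timeUnit) : w = w' := by
  rw [gal_timeUnit, gal_timeUnit] at h
  have ht := congrFun h 0
  simp only [Pi.add_apply, Pi.smul_apply, timeUnit_zero, hw, hw', add_zero, smul_eq_mul,
    mul_one] at ht
  rw [← ht, one_smul] at h
  exact add_left_cancel h

/-- A Lorentz boost is determined by the direction of the image of the time axis. -/
theorem lor_direction [IsEuclidean K] {c : K} (hc : 0 < c) {w w' : Fin 4 → K} (hw : w 0 = 0)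
    (hw' : w' 0 = 0) {t : K} (h : lor c w timeUnit = t • lor c w' timeUnit) : w = w' := by
  have h₁ := mink_lor hc hw timeUnit
  rw [h, mink_smul, mink_lor hc hw', mink_timeUnit] at h₁
  have h₂ : t ^ 2 = 1 := by
    have : c ^ 2 ≠ 0 := pow_ne_zero 2 hc.ne'
    exact mul_right_cancel₀ this (h₁.trans (one_mul _).symm)
  rw [lor_timeUnit hc hw, lor_timeUnit hc hw'] at h
  have ht := congrFun h 0
  simp only [Pi.add_apply, Pi.smul_apply, timeUnit_zero, hw, hw', add_zero, smul_eq_mul,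
    mul_one] at ht
  have h₃ := gamma_pos hc w
  have h₄ := gamma_pos hc w'
  have h₅ : t = 1 := by
    rcases mul_self_eq_one_iff.1 ((sq t).symm.trans h₂) with h₅ | h₅
    · exact h₅
    · rw [h₅] at ht; linarith
  rw [h₅, one_mul] at ht
  rw [h₅, one_smul, ht] at h
  exact add_left_cancel h

variable [IsEuclidean K]

/-- Every model of relativistic kinematics with a distinguished observer comes from a frame. -/
theorem RelativisticAxioms.exists_frame (h : RelativisticAxioms q) {e : M} (he : A.IOb e) :
    ∃ D : Frame M K, D.Good A e ∧
      ∀ k b x, q.W k b x ↔ A.Worldview D.o D.lorMap D.wl k b x := by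
  obtain ⟨f, hf⟩ := h.exists_coordinates he
  obtain ⟨c, hc⟩ := h.phc
  have hc₀ := (hc e he).1
  suffices H : ∃ D : Frame M K, D.Good A e ∧ D.c = c ∧ ∀ k b x, q.W k b x ↔
      A.Worldview D.o (fun k => lor c (D.w k) ∘ₗ D.ρ k) D.wl k b x by
    obtain ⟨D, hD, rfl, hW⟩ := H
    exact ⟨D, hD, hW⟩
  refine hf.exists_frame h.toCommonAxioms he (lor c)
    (fun w hw x y hxy => by rw [← lor_lor hc₀ hw x, hxy, lor_lor hc₀ hw]) (lor_zero hc₀)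
    (fun w w' hw hw' t => lor_direction hc₀ hw hw') (fun k hk => ?_) (fun w hw => ?_) (hc e he)
  · have hnull : NullPreserving c (f k) := ⟨hf.bij k hk, fun x y => by
      have h₁ (x y : Fin 4 → K) : mink c (x - y) = 0 ↔ space (x - y) = c ^ 2 * (x 0 - y 0) ^ 2 := by
        rw [mink, Pi.sub_apply, sub_eq_zero, eq_comm]
      rw [h₁, h₁, ← (hc k hk).2 x y, ← (hc e he).2 (f k x)]
      refine exists_congr fun p => and_congr_right fun hp => and_congr_right fun _ => ?_
      rw [hf.W_iff hk hp x, hf.W_iff hk hp y]⟩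
    have hmem (s : K) : q.W e k (f k (s • timeUnit)) :=
      (hf.W_observer_iff h.toCommonAxioms he hk _).2 ⟨s, hf.base he _⟩
    obtain ⟨L, hL, hfL⟩ := hnull.exists_linear hc₀ (fun a => by
        have h₁ := hmem 0
        have h₂ := hmem 1
        rw [zero_smul] at h₁
        rw [one_smul] at h₂
        refine h.exists_smul he hk (fun h₃ => ?_) h₁ h₂ (hmem a)
        have := congrFun ((hf.bij k hk).1 h₃) 0
        simp [timeUnit] at this)
      (fun x y hxy hfxy => (h.symD k hk e he x y _ _ hxy hfxy ((hf.iff k hk _ _).2 rfl)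
        ((hf.iff k hk _ _).2 rfl)).symm)
    obtain ⟨w, ρ, hw, hρ, hLw⟩ := exists_lor hc₀ hL
    exact ⟨w, ρ, hw, hρ, fun x => by rw [hfL x, hLw]⟩
  · obtain ⟨k, hk, h₁, h₂⟩ := h.thExp.2 e he c (hc e he) 0 (lor c w timeUnit) (by
      have := mink_lor hc₀ hw timeUnit
      rw [mink_timeUnit, mink] at this
      rw [zero_sub, space_neg, Pi.zero_apply, zero_sub, neg_sq]
      have := pow_pos hc₀ 2
      linarith)
    exact ⟨k, hk, h₁, h₂⟩

omit [IsEuclidean K] in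
/-- Every model of classical kinematics with a distinguished ether observer comes from a frame. -/
theorem ClassicalAxioms.exists_frame (h : ClassicalAxioms q) {e : M} (he : A.IOb e) {c : K}
    (hc : q.LightSpeed e c) : ∃ D : Frame M K, D.Good A e ∧ D.c = c ∧
      ∀ k b x, q.W k b x ↔ A.Worldview D.o D.galMap D.wl k b x := by
  obtain ⟨f, hf⟩ := h.exists_coordinates he
  have htime (k) (hk : A.IOb k) (x y) : (f k x 0 - f k y 0) ^ 2 = (x 0 - y 0) ^ 2 :=
    (h.absTime k hk e he x y _ _ ((hf.iff k hk _ _).2 rfl) ((hf.iff k hk _ _).2 rfl)).symm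
  refine hf.exists_frame h.toCommonAxioms he gal
    (fun w hw x y hxy => by rw [← gal_gal hw x, hxy, gal_gal hw]) rfl
    (fun w w' hw hw' t => gal_direction hw hw') (fun k hk => ?_) (fun w hw => ?_) hc
  · have hdist (x y) (hxy : x 0 = y 0) : space (f k x - f k y) = space (x - y) := by
      have h₁ := htime k hk x y
      rw [hxy, sub_self, zero_pow two_ne_zero, sq_eq_zero_iff, sub_eq_zero] at h₁
      exact (h.symD k hk e he x y _ _ hxy h₁ ((hf.iff k hk _ _).2 rfl)
        ((hf.iff k hk _ _).2 rfl)).symm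
    obtain ⟨L, hfL⟩ := exists_linear_of_absolute_time (htime k hk) hdist fun x y hxy a => by
      obtain ⟨k', hk', hx, hy⟩ := h.thExp.2 k hk x y hxy
      have hne : x ≠ y := fun h' => hxy (by rw [h'])
      -- The world line of `k'` contains every point of the line through `x` and `y`.
      have hz : q.W k k' (x + a • (y - x)) := by
        obtain ⟨s, hs⟩ := (hf.W_observer_iff h.toCommonAxioms hk hk' x).1 hx
        obtain ⟨t, ht⟩ := (hf.W_observer_iff h.toCommonAxioms hk hk' y).1 hy
        obtain ⟨z, hz⟩ := (hf.bij k hk).2 (f k' ((s + a * (t - s)) • timeUnit))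
        have hz' := (hf.W_observer_iff h.toCommonAxioms hk hk' z).2 ⟨_, hz⟩
        obtain ⟨b, hb⟩ : ∃ b : K, z - x = b • (y - x) := by
          obtain ⟨b, hb | hb⟩ := h.line k hk k' hk' x y z hx hy hz'
          · exact ⟨b, hb⟩
          · have hb₀ : b ≠ 0 := by
              rintro rfl
              rw [zero_smul, sub_eq_zero] at hb
              exact hne hb.symm
            exact ⟨b⁻¹, by rw [hb, inv_smul_smul₀ hb₀]⟩
        have h₁ (x y : Fin 4 → K) (s t : K) (hx : f k x = f k' (s • timeUnit))
            (hy : f k y = f k' (t • timeUnit)) : (x 0 - y 0) ^ 2 = (s - t) ^ 2 := by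
          rw [← htime k hk, hx, hy, htime k' hk']
          simp [timeUnit]
        have h₂ := h₁ _ _ _ _ hs ht
        have h₃ := h₁ _ _ _ _ hz hs
        have h₄ := h₁ _ _ _ _ hz ht
        have h₅ : z 0 = x 0 + b * (y 0 - x 0) := by
          have := congrFun hb 0
          simp only [Pi.sub_apply, Pi.smul_apply, smul_eq_mul] at this
          linear_combination this
        rw [h₅] at h₃ h₄
        have h₆ : (y 0 - x 0) ^ 2 ≠ 0 := pow_ne_zero 2 (sub_ne_zero.2 hxy.symm)
        have h₇ : a = b := by
          refine mul_left_cancel₀ h₆ (mul_left_cancel₀ (two_ne_zero (α := K)) ?_)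
          linear_combination (2 * a - 1) * h₂ - h₃ + h₄
        rw [h₇, ← hb, add_sub_cancel]
        exact hz'
      have hB := h.sorted.IOb_B k' hk'
      rw [hf.W_iff hk hB] at hx hy hz
      exact h.exists_smul he hk' (fun h' => hne ((hf.bij k hk).1 h')) hx hy hz
    have h₁ (x) : L x = f k x - f k 0 := by rw [hfL x, add_sub_cancel_left]
    obtain ⟨w, ρ, hw, hρ, hLw⟩ := exists_gal (L := L)
      (fun x => by rw [h₁, Pi.sub_apply, htime k hk]; simp)
      (fun x hx => by rw [h₁, hdist _ _ (by rw [hx]; rfl), sub_zero])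
    exact ⟨w, ρ, hw, hρ, fun x => by rw [hfL x, hLw]⟩
  · exact h.thExp.2 e he 0 _ (by simp [gal_time hw, timeUnit])

end Linearity

open Coord

/-! ### Changing the base observer of a frame -/

section Equivariance

variable {K : Type u} [Field K] [LinearOrder K] [IsStrictOrderedRing K]

omit [LinearOrder K] [IsStrictOrderedRing K] in
/-- Trivial transformations permute the Galilean boosts by conjugation. -/
theorem gal_map {θ : (Fin 4 → K) →ₗ[K] (Fin 4 → K)} {r : K} (hr : r ^ 2 = 1)
    (hr' : θ timeUnit = r • timeUnit) (hr'' : ∀ x, θ x 0 = r * x 0) (w x : Fin 4 → K) :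
    gal (r • θ w) (θ x) = θ (gal w x) := by
  have h : (r * x 0) • r • θ w = x 0 • θ w := by
    rw [smul_smul, mul_right_comm, ← sq, hr, one_mul]
  rw [gal_apply, gal_apply, map_sub, map_smul, map_add, map_smul, hr', hr'', smul_add, h]
  module

/-- Trivial transformations permute the Lorentz boosts by conjugation. -/
theorem lor_map [IsEuclidean K] {θ : (Fin 4 → K) →ₗ[K] (Fin 4 → K)} (hθ : IsTrivial θ) {r : K}
    (hr : r ^ 2 = 1) (hr' : θ timeUnit = r • timeUnit) (hr'' : ∀ x, θ x 0 = r * x 0) {c : K}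
    (hc : 0 < c) {w : Fin 4 → K} (hw : w 0 = 0) (x : Fin 4 → K) :
    lor c (r • θ w) (θ x) = θ (lor c w x) := by
  have hw' : (r • θ w) 0 = 0 := by simp [hr'', hw]
  have hg : gamma c (r • θ w) = gamma c w := by
    refine (eq_gamma hc (gamma_spec hc w).1 ?_).symm
    rw [space_smul, hr, one_mul, (hθ w).2]
    exact (gamma_spec hc w).2
  have hs : sdot (r • θ w) (θ x) = r * sdot w x := by
    rw [← hθ.sdot_map w x]
    simp only [sdot, Pi.smul_apply, smul_eq_mul]; ring
  set a := c ^ 2 * (1 + gamma c w)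
  have h : (r * x 0 - r * sdot w x / a) • r • θ w = (x 0 - sdot w x / a) • θ w := by
    rw [smul_smul]
    congr 1
    linear_combination (x 0 - sdot w x / a) * hr
  rw [lor_apply hc hw', lor_apply hc hw, hg, hs, hr'', map_sub, map_smul, map_add, map_smul, hr',
    smul_add, h, mul_div_assoc]
  module

end Equivariance

section Rebase

variable {M K : Type u} [Field K] [LinearOrder K] {A : KinStr M}

omit [LinearOrder K] in
/-- The worldview does not depend on the coordinate system in which it is described. -/
theorem KinStr.worldview_congr {o o' : M → Fin 4 → K} {L L' : M → (Fin 4 → K) →ₗ[K] (Fin 4 → K)}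
    {wl wl' : M → Set (Fin 4 → K)} {θ θ' : (Fin 4 → K) →ₗ[K] (Fin 4 → K)} (a : Fin 4 → K)
    (h : ∀ x, θ (θ' x) = x) (ho : ∀ k, A.IOb k → o' k = θ' (o k - a))
    (hL : ∀ k, A.IOb k → ∀ x, L' k x = θ' (L k x)) (hwl : ∀ b z, z ∈ wl' b ↔ a + θ z ∈ wl b)
    (k b : M) (x : Fin 4 → K) : A.Worldview o' L' wl' k b x ↔ A.Worldview o L wl k b x := by
  refine and_congr_right fun hk => and_congr_right fun _ => or_congr
    (and_congr_right fun hb => exists_congr fun s => ?_) (and_congr_right fun _ => ?_)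
  · have hinj : Function.Injective θ' := Function.LeftInverse.injective h
    rw [ho k hk, ho b hb, hL k hk, hL b hb, ← map_smul, ← map_add, ← map_add, hinj.eq_iff,
      sub_add_eq_add_sub, sub_add_eq_add_sub, sub_left_inj]
  · rw [hwl, ho k hk, hL k hk, ← map_add, h]
    congr! 1
    abel

variable [IsStrictOrderedRing K] [IsEuclidean K]

/-- Every observer at rest with respect to the base observer of a frame is the base observer of a
frame that yields the same models. -/
theorem Frame.Good.exists_rebase {D : Frame M K} {e e' : M} (h : D.Good A e) (he' : A.IOb e')
    (hw : D.w e' = 0) : ∃ D' : Frame M K, D'.Good A e' ∧ D'.c = D.c ∧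
      (∀ k b x, A.Worldview D'.o D'.lorMap D'.wl k b x ↔ A.Worldview D.o D.lorMap D.wl k b x) ∧
      ∀ k b x, A.Worldview D'.o D'.galMap D'.wl k b x ↔ A.Worldview D.o D.galMap D.wl k b x := by
  have hc := h.c_pos
  have hθ : IsTrivial (gal 0 ∘ₗ D.ρ e') := isTrivial_gal_zero.comp (h.trivial e' he')
  set θ := gal 0 ∘ₗ D.ρ e' with hθ_def
  obtain ⟨θ', hθ', h₁, h₂⟩ := hθ.exists_inverse
  obtain ⟨r, hr, hr', hr''⟩ := hθ'.exists_time
  have hr₀ (x) : θ x 0 = r * x 0 := by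
    have := hr'' (θ x)
    rw [h₁] at this
    rw [this, ← mul_assoc, ← sq, hr, one_mul]
  have hG (w x : Fin 4 → K) := gal_map hr hr' hr'' w x
  refine ⟨⟨D.c, fun k => θ' (D.o k - D.o e'), fun k => r • θ' (D.w k), fun k => θ' ∘ₗ D.ρ k,
    fun b => {z | D.o e' + θ z ∈ D.wl b}⟩, ⟨h.sorted, hc, he', ?_, ?_, fun x => ?_,
    fun k hk => ?_, fun k hk => hθ'.comp (h.trivial k hk), fun w hw => ?_,
    fun k hk σ hσ hσ' o => ?_, fun z z' => ?_⟩, rfl, ?_, ?_⟩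
  · change θ' (D.o e' - D.o e') = 0
    rw [sub_self, map_zero]
  · change r • θ' (D.w e') = 0
    rw [hw, map_zero, smul_zero]
  · change gal 0 (θ' (D.ρ e' x)) = x
    have := hG 0 (D.ρ e' x)
    rw [map_zero, smul_zero] at this
    rw [this]
    exact h₁ x
  · change (r • θ' (D.w k)) 0 = 0
    rw [Pi.smul_apply, hr'', h.time_w k hk, mul_zero, smul_zero]
  · obtain ⟨k, hk, hkw⟩ := h.boost (r • θ w) (by rw [Pi.smul_apply, hr₀, hw, mul_zero, smul_zero])
    refine ⟨k, hk, ?_⟩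
    change r • θ' (D.w k) = w
    rw [hkw, map_smul, h₁, smul_smul, ← sq, hr, one_smul]
  · obtain ⟨k', hk', e₁, e₂, e₃⟩ := h.triv k hk σ hσ hσ' (D.o e' + θ o)
    refine ⟨k', hk', ?_, ?_, ?_⟩
    · change r • θ' (D.w k') = r • θ' (D.w k)
      rw [e₁]
    · change θ' ∘ₗ D.ρ k' = (θ' ∘ₗ D.ρ k) ∘ₗ σ
      rw [e₂]; rfl
    · change θ' (D.o k' - D.o e') = o
      rw [e₃, add_sub_cancel_left, h₁]
  · refine (h.light (D.o e' + θ z) (D.o e' + θ z')).trans ?_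
    rw [add_sub_add_left_eq_sub, ← map_sub, hθ.mink]
  · exact KinStr.worldview_congr _ h₂ (fun k _ => rfl)
      (fun k hk x => lor_map hθ' hr hr' hr'' hc (h.time_w k hk) _) fun b z => Iff.rfl
  · exact KinStr.worldview_congr _ h₂ (fun k _ => rfl) (fun k _ x => hG _ _) fun b z => Iff.rfl

end Rebase

open Coord

/-! ### The formulas translating the two worldview relations into each other -/

section Formulas

open KForm Tm

variable {S : Type u}

/-- `y = x + u` in the classical model (`rel = false`) means `y = x + (1, u₁, u₂, u₃)`: the point
reached after unit time by a body with velocity `u`. In the relativistic model `u` is a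
four-velocity. -/
def alongF (rel : Bool) (x u y : Fin 4 → ℕ) : KForm S :=
  (v (y 0) ≐ v (x 0) + bif rel then v (u 0) else 1) ⋏ (v (y 1) ≐ v (x 1) + v (u 1)) ⋏
    (v (y 2) ≐ v (x 2) + v (u 2)) ⋏ (v (y 3) ≐ v (x 3) + v (u 3))

/-- `u` is a future directed four-velocity. -/
def fourVelocityF (c : ℕ) (u : Fin 4 → ℕ) : KForm S :=
  (0 ≼ᶠ v (u 0)) ⋏
    (sq (v c) * sq (v (u 0)) ≐ sq (v c) + (sq (v (u 1)) + sq (v (u 2)) + sq (v (u 3))))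

/-- The Lorentz boost with four-velocity `u` maps `y - o` to the same vector as the Galilean boost
with velocity `(u₁, u₂, u₃)` maps `z - o`. The quantity `a` avoids division. -/
def boostF (c : ℕ) (o u y z : Fin 4 → ℕ) : KForm S :=
  exQ fun a => (v a * (sq (v c) * (1 + v (u 0))) ≐ v (u 1) * (v (y 1) - v (o 1)) +
      v (u 2) * (v (y 2) - v (o 2)) + v (u 3) * (v (y 3) - v (o 3))) ⋏
    ((v (y 0) - v (o 0) - v a) * (1 + v (u 0)) - (v (y 0) - v (o 0)) ≐ v (z 0) - v (o 0)) ⋏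
    ((v (y 0) - v (o 0) - v a) * v (u 1) - (v (y 1) - v (o 1)) ≐
      (v (z 0) - v (o 0)) * v (u 1) - (v (z 1) - v (o 1))) ⋏
    ((v (y 0) - v (o 0) - v a) * v (u 2) - (v (y 2) - v (o 2)) ≐
      (v (z 0) - v (o 0)) * v (u 2) - (v (z 2) - v (o 2))) ⋏
    ((v (y 0) - v (o 0) - v a) * v (u 3) - (v (y 3) - v (o 3)) ≐
      (v (z 0) - v (o 0)) * v (u 3) - (v (z 3) - v (o 3)))

/-- The point `x` of the observer `k` has in the other model the coordinates `z` for the observer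
`e`, who has the speed of light `c`. The given model is relativistic if `rel` is true, and classical
otherwise. -/
def convertF (rel : Bool) (c e k : ℕ) (x z : Fin 4 → ℕ) : KForm S :=
  exQ4 fun t => exQ4 fun o => exQ4 fun u => exQ4 fun p => exQ4 fun y =>
    (v (t 0) ≐ 0) ⋏ (v (t 1) ≐ 0) ⋏ (v (t 2) ≐ 0) ⋏ (v (t 3) ≐ 0) ⋏ Kin.sameEvent k t e o ⋏
    fourVelocityF c u ⋏ alongF rel o u p ⋏ W e k p ⋏ Kin.sameEvent k x e y ⋏
    bif rel then boostF c o u y z else boostF c o u z y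

/-- The observer `k` coordinatizes the body `b` at the point `x` in the other model. -/
def otherWF (rel : Bool) (e k b : ℕ) (x : Fin 4 → ℕ) : KForm S :=
  IOb k ⋏ isB b ⋏ exQ fun c => Kin.lightSpeed e c ⋏ exQ4 fun z => convertF rel c e k x z ⋏
    ((neg (IOb b) ⋏ W e b z) ⋎ (IOb b ⋏ exQ4 fun s =>
      (v (s 1) ≐ 0) ⋏ (v (s 2) ≐ 0) ⋏ (v (s 3) ≐ 0) ⋏ convertF rel c e b s z))

end Formulas

section Meaning

variable {S M K : Type u} [Field K] [LinearOrder K] {A : KinStr M} (q : Quantities A K)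
variable {τ : ℕ → M} {n : ℕ}

/-- The meaning of `boostF`. -/
def Coord.BoostRel (c : K) (o u y z : Fin 4 → K) : Prop :=
  ∃ a, a * (c ^ 2 * (1 + u 0)) = u 1 * (y 1 - o 1) + u 2 * (y 2 - o 2) + u 3 * (y 3 - o 3) ∧
    (y 0 - o 0 - a) * (1 + u 0) - (y 0 - o 0) = z 0 - o 0 ∧
    (y 0 - o 0 - a) * u 1 - (y 1 - o 1) = (z 0 - o 0) * u 1 - (z 1 - o 1) ∧
    (y 0 - o 0 - a) * u 2 - (y 2 - o 2) = (z 0 - o 0) * u 2 - (z 2 - o 2) ∧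
    (y 0 - o 0 - a) * u 3 - (y 3 - o 3) = (z 0 - o 0) * u 3 - (z 3 - o 3)

/-- The meaning of `convertF`. -/
def Quantities.Convert (q : Quantities A K) (rel : Bool) (c : K) (e k : M) (x z : Fin 4 → K) :
    Prop :=
  ∃ t o u p y : Fin 4 → K, t 0 = 0 ∧ t 1 = 0 ∧ t 2 = 0 ∧ t 3 = 0 ∧ q.SameEvent k t e o ∧
    (0 ≤ u 0 ∧ c ^ 2 * u 0 ^ 2 = c ^ 2 + (u 1 ^ 2 + u 2 ^ 2 + u 3 ^ 2)) ∧
    (p 0 = o 0 + (bif rel then u 0 else 1) ∧ p 1 = o 1 + u 1 ∧ p 2 = o 2 + u 2 ∧ p 3 = o 3 + u 3) ∧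
    q.W e k p ∧ q.SameEvent k x e y ∧ bif rel then BoostRel c o u y z else BoostRel c o u z y

attribute [local simp] Quantities.upd4_lt Quantities.upd4_pt Quantities.upd4_pt_lt
  update_pt_lt pt_lt Quantities.vec_upd4 Quantities.vec_upd4_lt
  Quantities.vec_update_lt Quantities.Q_ι_iff sat_conj sat_disj sat_impl sat_equi sat_neg sat_allB
  sat_exB Quantities.eval_v Quantities.eval_zero Quantities.eval_one Quantities.eval_add
  Quantities.eval_sub Quantities.eval_mul Quantities.eval_sq Tm.good_v Tm.good_zero Tm.good_one
  Tm.good_add Tm.good_sub Tm.good_mul Tm.good_sq update_lt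

theorem sat_alongF (rel : Bool) {x u y : Fin 4 → ℕ} (hx : ∀ j, x j < n) (hu : ∀ j, u j < n)
    (hy : ∀ j, y j < n) (hQx : ∀ j, A.Q (τ (x j))) (hQu : ∀ j, A.Q (τ (u j)))
    (hQy : ∀ j, A.Q (τ (y j))) :
    Sat (A.interp S) τ ((alongF rel x u y : KForm S) n) ↔
      q.vec τ y 0 = q.vec τ x 0 + (bif rel then q.vec τ u 0 else 1) ∧
      q.vec τ y 1 = q.vec τ x 1 + q.vec τ u 1 ∧ q.vec τ y 2 = q.vec τ x 2 + q.vec τ u 2 ∧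
      q.vec τ y 3 = q.vec τ x 3 + q.vec τ u 3 := by
  cases rel <;> simp [alongF, q.sat_eqF, hx, hu, hy, hQx, hQu, hQy, Quantities.vec]

theorem sat_fourVelocityF {c : ℕ} {u : Fin 4 → ℕ} (hc : c < n) (hu : ∀ j, u j < n)
    (hQc : A.Q (τ c)) (hQu : ∀ j, A.Q (τ (u j))) :
    Sat (A.interp S) τ ((fourVelocityF c u : KForm S) n) ↔ 0 ≤ q.vec τ u 0 ∧
      q.val (τ c) ^ 2 * q.vec τ u 0 ^ 2 =
        q.val (τ c) ^ 2 + (q.vec τ u 1 ^ 2 + q.vec τ u 2 ^ 2 + q.vec τ u 3 ^ 2) := by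
  simp [fourVelocityF, q.sat_eqF, q.sat_leF, hc, hu, hQc, hQu, Quantities.vec]

theorem sat_boostF {c : ℕ} {o u y z : Fin 4 → ℕ} (hc : c < n) (ho : ∀ j, o j < n)
    (hu : ∀ j, u j < n) (hy : ∀ j, y j < n) (hz : ∀ j, z j < n) (hQc : A.Q (τ c))
    (hQo : ∀ j, A.Q (τ (o j))) (hQu : ∀ j, A.Q (τ (u j))) (hQy : ∀ j, A.Q (τ (y j)))
    (hQz : ∀ j, A.Q (τ (z j))) :
    Sat (A.interp S) τ ((boostF c o u y z : KForm S) n) ↔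
      BoostRel (q.val (τ c)) (q.vec τ o) (q.vec τ u) (q.vec τ y) (q.vec τ z) := by
  have hlt {i : ℕ} (hi : i < n) : i < n + 1 := by omega
  simp [boostF, q.sat_exQ, q.sat_eqF, hc, ho, hu, hy, hz, hQc, hQo, hQu, hQy, hQz, hlt,
    Quantities.vec, BoostRel]

theorem sat_convertF (rel : Bool) {c e k : ℕ} {x z : Fin 4 → ℕ} (hc : c < n) (he : e < n)
    (hk : k < n) (hx : ∀ j, x j < n) (hz : ∀ j, z j < n) (hQc : A.Q (τ c))
    (hQx : ∀ j, A.Q (τ (x j))) (hQz : ∀ j, A.Q (τ (z j))) :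
    Sat (A.interp S) τ ((convertF rel c e k x z : KForm S) n) ↔
      q.Convert rel (q.val (τ c)) (τ e) (τ k) (q.vec τ x) (q.vec τ z) := by
  have hlt₁ {i : ℕ} (hi : i < n) : i < n + 4 := by omega
  have hlt₂ {i : ℕ} (hi : i < n) : i < n + 4 + 4 := by omega
  have hlt₃ {i : ℕ} (hi : i < n) : i < n + 4 + 4 + 4 := by omega
  have hlt₄ {i : ℕ} (hi : i < n) : i < n + 4 + 4 + 4 + 4 := by omega
  have hlt₅ {i : ℕ} (hi : i < n) : i < n + 4 + 4 + 4 + 4 + 4 := by omega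
  simp only [convertF, q.sat_exQ4]
  refine exists_congr fun t => exists_congr fun o => exists_congr fun u => exists_congr fun p =>
    exists_congr fun y => ?_
  cases rel <;>
  simp (maxDischargeDepth := 5) [q.sat_sameEvent, sat_fourVelocityF q, sat_alongF q, sat_boostF q,
    q.sat_W, q.sat_eqF,
    q.vec_upd4_lt', hlt₁, hlt₂, hlt₃, hlt₄, hlt₅, hc, he, hk, hx, hz, hQc, hQx, hQz]

end Meaning

open Coord

section Meaning

variable {S M K : Type u} [Field K] [LinearOrder K] {A : KinStr M} (q : Quantities A K)
variable {τ : ℕ → M} {n : ℕ}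

/-- The meaning of `otherWF`. -/
def Quantities.OtherW (rel : Bool) (e k b : M) (x : Fin 4 → K) : Prop :=
  A.IOb k ∧ A.B b ∧ ∃ c, q.LightSpeed e c ∧ ∃ z, q.Convert rel c e k x z ∧
    ((¬ A.IOb b ∧ q.W e b z) ∨
      (A.IOb b ∧ ∃ s : Fin 4 → K, s 1 = 0 ∧ s 2 = 0 ∧ s 3 = 0 ∧ q.Convert rel c e b s z))

attribute [local simp] Quantities.upd4_lt Quantities.upd4_pt Quantities.upd4_pt_lt
  update_pt_lt pt_lt Quantities.vec_upd4 Quantities.vec_upd4_lt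
  Quantities.vec_update_lt Quantities.Q_ι_iff sat_conj sat_disj sat_neg sat_isB sat_IOb
  Quantities.eval_v Quantities.eval_zero Tm.good_v Tm.good_zero update_lt

theorem sat_otherWF (rel : Bool) {e k b : ℕ} {x : Fin 4 → ℕ} (he : e < n)
    (hk : k < n) (hb : b < n) (hx : ∀ j, x j < n) (hQx : ∀ j, A.Q (τ (x j))) :
    Sat (A.interp S) τ ((otherWF rel e k b x : KForm S) n) ↔
      q.OtherW rel (τ e) (τ k) (τ b) (q.vec τ x) := by
  have hlt₁ {i : ℕ} (hi : i < n) : i < n + 1 := by omega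
  have hlt₂ {i : ℕ} (hi : i < n) : i < n + 1 + 4 := by omega
  have hlt₃ {i : ℕ} (hi : i < n) : i < n + 1 + 4 + 4 := by omega
  have hn₁ : n < n + 1 := by omega
  have hn₂ : n < n + 1 + 4 := by omega
  have hn₃ : n < n + 1 + 4 + 4 := by omega
  simp only [otherWF, Quantities.OtherW, sat_conj, sat_disj, sat_neg, q.sat_exQ,
    q.sat_exQ4, sat_IOb, sat_isB]
  refine and_congr_right fun _ => and_congr_right fun _ => exists_congr fun c =>
    and_congr ?_ (exists_congr fun z => ?_)
  · simp (maxDischargeDepth := 5) [q.sat_lightSpeed, hlt₁, he]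
  · simp (maxDischargeDepth := 5) [q.sat_W, q.sat_eqF, sat_convertF q, q.vec_upd4_lt',
      q.vec_update_lt', hlt₁, hlt₂, hlt₃, hn₁, hn₂, hn₃, he, hk, hb, hx, hQx]

end Meaning

section Conversion

variable {M K : Type u} [Field K] [LinearOrder K] [IsStrictOrderedRing K] [IsEuclidean K]
  {A : KinStr M} {q : Quantities A K}

omit [LinearOrder K] [IsStrictOrderedRing K] [IsEuclidean K] [Field K] in
theorem vec_eq_iff {x y : Fin 4 → K} :
    x = y ↔ x 0 = y 0 ∧ x 1 = y 1 ∧ x 2 = y 2 ∧ x 3 = y 3 := by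
  refine ⟨fun h => by simp [h], fun ⟨h₀, h₁, h₂, h₃⟩ => ?_⟩
  ext i; fin_cases i <;> assumption

theorem boostRel_iff {c : K} (hc : 0 < c) {w : Fin 4 → K} (hw : w 0 = 0) (o y z : Fin 4 → K) :
    BoostRel c o (gamma c w • timeUnit + w) y z ↔ lor c w (y - o) = gal w (z - o) := by
  have hg := gamma_pos hc w
  have hne : c ^ 2 * (1 + gamma c w) ≠ 0 := by positivity
  have hu : gamma c w • timeUnit + w = ![gamma c w, w 1, w 2, w 3] := by
    ext i; fin_cases i <;> simp [timeUnit, hw]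
  have h (a : K) : a * (c ^ 2 * (1 + gamma c w)) = sdot w (y - o) ↔
      a = sdot w (y - o) / (c ^ 2 * (1 + gamma c w)) := (eq_div_iff hne).symm
  rw [lor_apply hc hw, hu, gal_apply]
  set a := sdot w (y - o) / (c ^ 2 * (1 + gamma c w)) with ha
  trans ((y 0 - o 0 - a) * (1 + gamma c w) - (y 0 - o 0) = z 0 - o 0 ∧
    (y 0 - o 0 - a) * w 1 - (y 1 - o 1) = (z 0 - o 0) * w 1 - (z 1 - o 1) ∧
    (y 0 - o 0 - a) * w 2 - (y 2 - o 2) = (z 0 - o 0) * w 2 - (z 2 - o 2) ∧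
    (y 0 - o 0 - a) * w 3 - (y 3 - o 3) = (z 0 - o 0) * w 3 - (z 3 - o 3))
  · constructor
    · rintro ⟨b, hb, h'⟩
      have : b = a := (h b).1 hb
      rw [this] at h'
      exact h'
    · exact fun h' => ⟨a, (h a).2 rfl, h'⟩
  · rw [vec_eq_iff]
    simp only [Pi.add_apply, Pi.sub_apply, Pi.smul_apply, smul_eq_mul, timeUnit_zero, timeUnit_one,
      timeUnit_two, timeUnit_three, hw]
    refine and_congr ?_ (and_congr ?_ (and_congr ?_ ?_)) <;>
      constructor <;> intro h <;> linear_combination h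

namespace Frame

variable {D : Frame M K} {e : M}

/-- The origin and the four-velocity of an observer, from the observer's world line. -/
theorem Good.fourVelocity_iff (h : D.Good A e) {k : M} (hk : A.IOb k) (rel : Bool)
    {u : Fin 4 → K} : (0 ≤ u 0 ∧ D.c ^ 2 * u 0 ^ 2 = D.c ^ 2 + (u 1 ^ 2 + u 2 ^ 2 + u 3 ^ 2) ∧
      ∃ p : Fin 4 → K, (p 0 = D.o k 0 + (bif rel then u 0 else 1) ∧ p 1 = D.o k 1 + u 1 ∧
        p 2 = D.o k 2 + u 2 ∧ p 3 = D.o k 3 + u 3) ∧ ∃ s : K, p = D.o k + s •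
          (bif rel then D.lorMap k else D.galMap k) timeUnit) ↔
    u = gamma D.c (D.w k) • timeUnit + D.w k := by
  have hc := h.c_pos
  have hw := h.time_w k hk
  obtain ⟨r, hr, hr', -⟩ := (h.trivial k hk).exists_time
  have hlor : D.lorMap k timeUnit = r • (gamma D.c (D.w k) • timeUnit + D.w k) := by
    rw [lorMap, LinearMap.comp_apply, hr', map_smul, lor_timeUnit hc hw]
  have hgal : D.galMap k timeUnit = r • (timeUnit + D.w k) := by
    rw [galMap, LinearMap.comp_apply, hr', map_smul, gal_timeUnit]
  have hg := gamma_spec hc (D.w k)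
  have hg' := gamma_pos hc (D.w k)
  constructor
  · rintro ⟨h₀, h₁, p, ⟨p₀, p₁, p₂, p₃⟩, s, hp⟩
    have hp' (i) := congrFun hp i
    cases rel
    · simp only [cond_false] at hp' p₀
      rw [hgal, smul_smul] at hp'
      have e₀ := hp' 0
      have e₁ := hp' 1
      have e₂ := hp' 2
      have e₃ := hp' 3
      simp only [Pi.add_apply, Pi.smul_apply, timeUnit_zero, timeUnit_one, timeUnit_two,
        timeUnit_three, hw, p₀, p₁, p₂, p₃, smul_eq_mul, zero_add, add_zero, mul_one,
        add_right_inj] at e₀ e₁ e₂ e₃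
      rw [← e₀, one_mul] at e₁ e₂ e₃
      have hu : u 0 = gamma D.c (D.w k) := eq_gamma hc h₀ (by rw [h₁, e₁, e₂, e₃]; rfl)
      ext i; fin_cases i <;> simp [timeUnit, hw, hu, e₁, e₂, e₃]
    · simp only [cond_true] at hp' p₀
      rw [hlor, smul_smul] at hp'
      have e₀ := hp' 0
      have e₁ := hp' 1
      have e₂ := hp' 2
      have e₃ := hp' 3
      simp only [Pi.add_apply, Pi.smul_apply, timeUnit_zero, timeUnit_one, timeUnit_two,
        timeUnit_three, hw, p₀, p₁, p₂, p₃, smul_eq_mul, zero_add, add_zero, mul_one, mul_zero,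
        add_right_inj] at e₀ e₁ e₂ e₃
      have hsr : (s * r) ^ 2 = 1 := by
        have hne : D.c ^ 2 ≠ 0 := by positivity
        refine mul_right_cancel₀ hne ?_
        rw [e₀, e₁, e₂, e₃] at h₁
        have h₂ := hg.2
        rw [space] at h₂
        linear_combination h₁ - (s * r) ^ 2 * h₂
      have hsr' : s * r = 1 := by
        rcases mul_self_eq_one_iff.1 ((sq (s * r)).symm.trans hsr) with h₅ | h₅
        · exact h₅
        · rw [e₀, h₅] at h₀; linarith
      rw [hsr', one_mul] at e₀ e₁ e₂ e₃
      ext i; fin_cases i <;> simp [timeUnit, hw, e₀, e₁, e₂, e₃]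
  · rintro rfl
    have e₀ : (gamma D.c (D.w k) • timeUnit + D.w k : Fin 4 → K) 0 = gamma D.c (D.w k) := by
      simp [timeUnit, hw]
    have e₁ : (gamma D.c (D.w k) • timeUnit + D.w k : Fin 4 → K) 1 = D.w k 1 := by simp [timeUnit]
    have e₂ : (gamma D.c (D.w k) • timeUnit + D.w k : Fin 4 → K) 2 = D.w k 2 := by simp [timeUnit]
    have e₃ : (gamma D.c (D.w k) • timeUnit + D.w k : Fin 4 → K) 3 = D.w k 3 := by simp [timeUnit]
    refine ⟨by rw [e₀]; exact hg.1, by rw [e₀, e₁, e₂, e₃]; exact hg.2,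
      D.o k + r • (bif rel then D.lorMap k else D.galMap k) timeUnit, ?_, r, rfl⟩
    rw [e₀, e₁, e₂, e₃]
    cases rel
    · rw [cond_false, cond_false, hgal, smul_smul, ← sq, hr, one_smul]
      simp [timeUnit_zero, timeUnit_one, timeUnit_two, timeUnit_three, hw]
    · rw [cond_true, cond_true, hlor, smul_smul, ← sq, hr, one_smul]
      simp [timeUnit_zero, timeUnit_one, timeUnit_two, timeUnit_three, hw]

/-- The conversion formula defines the coordinate transformations of the other model. -/
theorem Good.convert_iff (h : D.Good A e) {rel : Bool} (hW : ∀ k b x, q.W k b x ↔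
      A.Worldview D.o (bif rel then D.lorMap else D.galMap) D.wl k b x) {k : M} (hk : A.IOb k)
    (x z : Fin 4 → K) : q.Convert rel D.c e k x z ↔
      z = D.o k + (bif rel then D.galMap else D.lorMap) k x := by
  have hc := h.c_pos
  have hw := h.time_w k hk
  have hT : Transformations A D.o (bif rel then D.lorMap else D.galMap) := by
    cases rel
    exacts [h.transformations_gal, h.transformations_lor]
  have hbase (x) : (bif rel then D.lorMap else D.galMap) e x = x := by
    cases rel
    exacts [h.galMap_base x, h.lorMap_base x]
  have hev (x y) : q.SameEvent k x e y ↔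
      y = D.o k + (bif rel then D.lorMap else D.galMap) k x := by
    rw [hT.sameEvent_iff h.sorted hW hk h.base_mem, h.base_o, zero_add, hbase, eq_comm]
  have hline (p) : q.W e k p ↔ ∃ s : K,
      p = D.o k + s • (bif rel then D.lorMap k else D.galMap k) timeUnit := by
    rw [hW, KinStr.Worldview, h.base_o, zero_add, hbase]
    simp only [h.base_mem, h.sorted.IOb_B k hk, hk, not_true, false_and, or_false, true_and]
    cases rel <;> rfl
  have hboost (y : Fin 4 → K) (hy : y = D.o k + (bif rel then D.lorMap else D.galMap) k x) :
      (bif rel then BoostRel D.c (D.o k) (gamma D.c (D.w k) • timeUnit + D.w k) y z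
        else BoostRel D.c (D.o k) (gamma D.c (D.w k) • timeUnit + D.w k) z y) ↔
      z = D.o k + (bif rel then D.galMap else D.lorMap) k x := by
    cases rel
    · simp only [cond_false] at hy ⊢
      rw [boostRel_iff hc hw, hy, add_sub_cancel_left, galMap, LinearMap.comp_apply, gal_gal hw,
        lorMap, LinearMap.comp_apply]
      constructor
      · intro h; rw [← h, lor_lor hc hw, add_sub_cancel]
      · rintro rfl; rw [add_sub_cancel_left, lor_lor hc hw]
    · simp only [cond_true] at hy ⊢
      rw [boostRel_iff hc hw, hy, add_sub_cancel_left, lorMap, LinearMap.comp_apply,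
        lor_lor hc hw, galMap, LinearMap.comp_apply]
      constructor
      · intro h; rw [h, gal_gal hw, add_sub_cancel]
      · rintro rfl; rw [add_sub_cancel_left, gal_gal hw]
  constructor
  · rintro ⟨t, o, u, p, y, t₀, t₁, t₂, t₃, ho, ⟨hu₀, hu⟩, hp, hWp, hy, hb⟩
    have ht : t = 0 := by ext i; fin_cases i <;> assumption
    rw [hev, ht, map_zero, add_zero] at ho
    subst ho
    rw [(h.fourVelocity_iff hk rel).1 ⟨hu₀, hu, p, hp, (hline p).1 hWp⟩] at hb
    exact (hboost y ((hev _ _).1 hy)).1 hb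
  · intro hz
    obtain ⟨hu₀, hu, p, hp, hWp⟩ := (h.fourVelocity_iff hk rel).2 rfl
    exact ⟨0, D.o k, gamma D.c (D.w k) • timeUnit + D.w k, p, _, rfl, rfl, rfl, rfl,
      (hev _ _).2 (by rw [map_zero, add_zero]), ⟨hu₀, hu⟩, hp, (hline p).2 hWp, (hev _ _).2 rfl,
      (hboost _ rfl).2 hz⟩

/-- The translated worldview relation of one of the models given by a frame is the worldview
relation of the other model. -/
theorem Good.otherW_iff (h : D.Good A e) {rel : Bool} (hW : ∀ k b x, q.W k b x ↔
      A.Worldview D.o (bif rel then D.lorMap else D.galMap) D.wl k b x) (k b : M)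
    (x : Fin 4 → K) : q.OtherW rel e k b x ↔
      A.Worldview D.o (bif rel then D.galMap else D.lorMap) D.wl k b x := by
  have hbase (x) : (bif rel then D.lorMap else D.galMap) e x = x := by
    cases rel
    exacts [h.galMap_base x, h.lorMap_base x]
  have hlight : q.LightSpeed e D.c := h.lightSpeed hW h.base_mem fun x => by rw [hbase]
  refine and_congr_right fun hk => and_congr_right fun hb => ?_
  constructor
  · rintro ⟨c, hc, z, hz, hzb⟩
    rw [hc.unique hlight] at hz hzb
    rw [h.convert_iff hW hk] at hz
    rw [← hz]
    rcases hzb with ⟨hb', hzb⟩ | ⟨hb', s, s₁, s₂, s₃, hs⟩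
    · rw [hW, KinStr.Worldview, h.base_o, zero_add, hbase] at hzb
      exact .inr ⟨hb', (hzb.2.2.resolve_left fun h => hb' h.1).2⟩
    · rw [h.convert_iff hW hb'] at hs
      refine .inl ⟨hb', s 0, ?_⟩
      have : s = s 0 • timeUnit := by
        ext i; fin_cases i <;> simp [timeUnit, s₁, s₂, s₃]
      rw [← map_smul, ← this, ← hs]
  · rintro (⟨hb', s, hs⟩ | ⟨hb', hs⟩)
    · refine ⟨D.c, hlight, _, (h.convert_iff hW hk _ _).2 rfl, .inr ⟨hb', s • timeUnit, ?_, ?_, ?_,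
        (h.convert_iff hW hb' _ _).2 ?_⟩⟩
      · simp [timeUnit]
      · simp [timeUnit]
      · simp [timeUnit]
      · rw [hs, map_smul]
    · refine ⟨D.c, hlight, _, (h.convert_iff hW hk _ _).2 rfl, .inl ⟨hb', (hW ..).2
        ⟨h.base_mem, hb, .inr ⟨hb', ?_⟩⟩⟩⟩
      rw [h.base_o, zero_add, hbase]
      exact hs

end Frame

end Conversion

open Coord

/-! ### Translations given by formulas for the relation symbols -/

section Translate

variable {S : Type u} {L L₁ L₂ : RelLanguage S}

/-- The translation that replaces every atomic formula by the given formula. -/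
def Formula.translate (f : ∀ R : L₁, (Fin R.1.rank → ℕ) → Formula L₂) : Formula L₁ → Formula L₂
  | eq i j => eq i j
  | rel R args => f R args
  | and φ ψ => and (translate f φ) (translate f ψ)
  | not φ => not (translate f φ)
  | ex i φ => ex i (translate f φ)

theorem Formula.isTranslation_translate (f : ∀ R : L₁, (Fin R.1.rank → ℕ) → Formula L₂) :
    IsTranslation (translate f) := ⟨fun _ _ => rfl, fun _ => rfl, fun _ _ => rfl, fun _ _ => rfl⟩

/-- The formulas `f` define in `J` the relations of `I`. -/
def Defines {M : Type u} (f : ∀ R : L₁, (Fin R.1.rank → ℕ) → Formula L₂) (J : Interp L₂ M)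
    (I : Interp L₁ M) : Prop :=
  ∀ R args τ, Sat J τ (f R args) ↔ (fun m => τ (args m)) ∈ I R

theorem Defines.sat_translate {M : Type u} {f : ∀ R : L₁, (Fin R.1.rank → ℕ) → Formula L₂}
    {J : Interp L₂ M} {I : Interp L₁ M} (h : Defines f J I) (φ : Formula L₁) :
    ∀ τ, Sat J τ (φ.translate f) ↔ Sat I τ φ := by
  induction φ with
  | eq i j => exact fun τ => Iff.rfl
  | rel R args => exact fun τ => h R args τ
  | and φ ψ hφ hψ => exact fun τ => and_congr (hφ τ) (hψ τ)
  | not φ hφ => exact fun τ => not_congr (hφ τ)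
  | ex i φ hφ => exact fun τ => exists_congr fun a => hφ _

/-- Two theories are definitionally equivalent if their models correspond to each other in such a
way that corresponding models are mutually definable. -/
theorem definitionallyEquivalent_of_correspondence {T₁ T₂ : Theory S}
    (f : ∀ R : T₁.lang, (Fin R.1.rank → ℕ) → Formula T₂.lang)
    (g : ∀ R : T₂.lang, (Fin R.1.rank → ℕ) → Formula T₁.lang)
    (C : ∀ M : Type u, Interp T₁.lang M → Interp T₂.lang M → Prop)
    (h₁ : ∀ M I J, C M I J → T₁.IsModel I) (h₂ : ∀ M I J, C M I J → T₂.IsModel J)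
    (hf : ∀ M I J, C M I J → Defines f J I) (hg : ∀ M I J, C M I J → Defines g I J)
    (hl : ∀ (M : Type u) [Nonempty M] I, T₁.IsModel I → ∃ J, C M I J)
    (hr : ∀ (M : Type u) [Nonempty M] J, T₂.IsModel J → ∃ I, C M I J) :
    DefinitionallyEquivalent T₁ T₂ := by
  refine ⟨Formula.translate f, ⟨Formula.isTranslation_translate f, fun φ hφ M _ J hJ τ => ?_⟩,
    Formula.translate g, ⟨Formula.isTranslation_translate g, fun φ hφ M _ I hI τ => ?_⟩,
    fun φ M _ I hI τ => ?_, fun φ M _ J hJ τ => ?_⟩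
  · obtain ⟨I, hC⟩ := hr M J hJ
    exact ((hf M I J hC).sat_translate φ τ).2 (hφ M I (h₁ M I J hC) τ)
  · obtain ⟨J, hC⟩ := hl M I hI
    exact ((hg M I J hC).sat_translate φ τ).2 (hφ M J (h₂ M I J hC) τ)
  · obtain ⟨J, hC⟩ := hl M I hI
    rw [sat_iff, (hg M I J hC).sat_translate, (hf M I J hC).sat_translate]
  · obtain ⟨I, hC⟩ := hr M J hJ
    rw [sat_iff, (hf M I J hC).sat_translate, (hg M I J hC).sat_translate]

/-- The restriction of a model to a smaller language. -/
def Interp.reduct {M : Type u} (h : L₁ ⊆ L₂) (J : Interp L₂ M) : Interp L₁ M :=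
  fun R => J ⟨R.1, h R.2⟩

theorem sat_incl {M : Type u} (h : L₁ ⊆ L₂) (J : Interp L₂ M) (φ : Formula L₁) :
    ∀ τ, Sat J τ (φ.incl h) ↔ Sat (J.reduct h) τ φ := by
  induction φ with
  | eq i j => exact fun τ => Iff.rfl
  | rel R args => exact fun τ => Iff.rfl
  | and φ ψ hφ hψ => exact fun τ => and_congr (hφ τ) (hψ τ)
  | not φ hφ => exact fun τ => not_congr (hφ τ)
  | ex i φ hφ => exact fun τ => exists_congr fun a => hφ _

end Translate

/-! ### Models of relativistic kinematics with a rest frame -/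

section RestFrame

variable {S M : Type u}

/-- The model with the relations of `A` in which the extension of the symbol `E` is `X`. -/
def KinStr.interpE (S : Type u) (A : KinStr M) (X : M → Prop) : Interp (kinLangE S) M := fun R =>
  match R with
  | ⟨.kin .B, _⟩ => {a : Fin 1 → M | A.B (a 0)}
  | ⟨.kin .Q, _⟩ => {a : Fin 1 → M | A.Q (a 0)}
  | ⟨.kin .IOb, _⟩ => {a : Fin 1 → M | A.IOb (a 0)}
  | ⟨.kin .Ph, _⟩ => {a : Fin 1 → M | A.Ph (a 0)}
  | ⟨.kin .plus, _⟩ => {a : Fin 3 → M | A.plus (a 0) (a 1) (a 2)}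
  | ⟨.kin .times, _⟩ => {a : Fin 3 → M | A.times (a 0) (a 1) (a 2)}
  | ⟨.kin .le, _⟩ => {a : Fin 2 → M | A.le (a 0) (a 1)}
  | ⟨.kin .W, _⟩ => {a : Fin 6 → M | A.W (a 0) (a 1) (a 2) (a 3) (a 4) (a 5)}
  | ⟨.kin .E, _⟩ => {a : Fin 1 → M | X (a 0)}
  | ⟨.other _ _, _⟩ => ∅

theorem KinStr.reduct_interpE (A : KinStr M) (X : M → Prop) :
    (A.interpE S X).reduct (kinLang_subset_kinLangE S) = A.interp S := by
  funext ⟨R, s, hs, hR⟩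
  subst hR
  cases s <;> first | rfl | exact absurd rfl hs

theorem KinStr.sat_incl_iff (A : KinStr M) (X : M → Prop) (φ : Formula (kinLang S)) (τ : ℕ → M) :
    Sat (A.interpE S X) τ (φ.incl (kinLang_subset_kinLangE S)) ↔ Sat (A.interp S) τ φ := by
  rw [sat_incl, reduct_interpE]

/-- Every model is given by its relations and the extension of `E`. -/
theorem KinStr.exists_eq_interpE (J : Interp (kinLangE S) M) :
    ∃ (A : KinStr M) (X : M → Prop), J = A.interpE S X := by
  let A := ofInterp (J.reduct (kinLang_subset_kinLangE S))
  refine ⟨A, fun a => (![a] : Fin 1 → M) ∈ J ⟨.kin .E, Set.mem_insert _ _⟩, ?_⟩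
  funext ⟨R, hR⟩
  by_cases hR' : R ∈ kinLang S
  · have h := congrFun (A.reduct_interpE (S := S)
      fun a => (![a] : Fin 1 → M) ∈ J ⟨.kin .E, Set.mem_insert _ _⟩) ⟨R, hR'⟩
    rw [interp_ofInterp] at h
    exact h.symm
  · obtain rfl := hR.resolve_right hR'
    ext a
    exact iff_of_eq (congrArg (· ∈ J ⟨.kin .E, Set.mem_insert _ _⟩) (vec_eta₁ a).symm)

variable {K : Type u} [Field K] [LinearOrder K]

/-- The observer `h` is at rest with respect to `k`. -/
def Quantities.Stationary {A : KinStr M} (q : Quantities A K) (k h : M) : Prop :=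
  ∀ x y, q.W k h x → q.W k h y → x 1 = y 1 ∧ x 2 = y 2 ∧ x 3 = y 3

variable [IsStrictOrderedRing K]

omit [IsStrictOrderedRing K] in
theorem sat_axPrimitiveEther_iff {A : KinStr M} (q : Quantities A K) {X : M → Prop} {τ : ℕ → M} :
    Sat (A.interpE S X) τ (axPrimitiveEther S) ↔
      ∃ k, A.IOb k ∧ ∀ h, X h ↔ A.IOb h ∧ q.Stationary k h := by
  simp only [axPrimitiveEther, Formula.all, Sat, sat_iff, sat_incl, KinStr.reduct_interpE, sat_IOb,
    sat_stationary_iff q (show 0 < 2 by norm_num) (show 1 < 2 by norm_num), Function.update_self,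
    Function.update_of_ne (show (0 : ℕ) ≠ 1 by norm_num), not_exists, not_not]
  rfl

variable [IsEuclidean K]

theorem isModel_specRelE_iff [Nonempty M] {A : KinStr M} (q : Quantities A K) {X : M → Prop} :
    (specRelE S).IsModel (A.interpE S X) ↔
      RelativisticAxioms q ∧ ∃ k, A.IOb k ∧ ∀ h, X h ↔ A.IOb h ∧ q.Stationary k h := by
  rw [← isModel_specRel_iff (S := S) q]
  constructor
  · intro h
    refine ⟨fun φ hφ τ => ?_, (sat_axPrimitiveEther_iff (S := S) q).1
      (h _ (Or.inr rfl) fun _ => Classical.arbitrary M)⟩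
    exact (A.sat_incl_iff X φ τ).1 (h _ (Or.inl ⟨φ, hφ, rfl⟩) τ)
  · rintro ⟨h, h'⟩ _ (⟨φ, hφ, rfl⟩ | rfl) τ
    · exact (A.sat_incl_iff X φ τ).2 (h φ hφ τ)
    · exact (sat_axPrimitiveEther_iff q).2 h'

omit [Field K] [LinearOrder K] [IsStrictOrderedRing K] [IsEuclidean K] in
theorem isModel_specRel_of_specRelE {A : KinStr M} {X : M → Prop}
    (h : (specRelE S).IsModel (A.interpE S X)) : (specRel S).IsModel (A.interp S) := by
  intro φ hφ τ
  exact (A.sat_incl_iff X φ τ).1 (h _ (Or.inl ⟨φ, hφ, rfl⟩) τ)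

omit [Field K] [LinearOrder K] [IsStrictOrderedRing K] [IsEuclidean K] in
/-- Every model of relativistic kinematics can be expanded by the rest frame of any of its
observers. -/
theorem conservativeExtension_specRelE (S : Type u) :
    ConservativeExtension (specRel S) (specRelE S) := by
  refine ⟨kinLang_subset_kinLangE S, fun φ => ⟨fun hφ M _ I hI τ => ?_, fun hφ M _ J hJ τ => ?_⟩⟩
  · change Interp (kinLang S) M at I
    rw [← KinStr.interp_ofInterp I] at hI ⊢
    obtain ⟨K, _, _, _, _, q, hq⟩ := exists_quantities_of_relativistic hI
    obtain ⟨k, hk⟩ := hq.thExp.1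
    exact (KinStr.sat_incl_iff _ _ φ τ).1 (hφ M ((KinStr.ofInterp I).interpE S fun h =>
      (KinStr.ofInterp I).IOb h ∧ q.Stationary k h)
      ((isModel_specRelE_iff q).2 ⟨hq, k, hk, fun _ => Iff.rfl⟩) τ)
  · change Interp (kinLangE S) M at J
    obtain ⟨A, X, rfl⟩ := KinStr.exists_eq_interpE J
    exact (A.sat_incl_iff X φ τ).2 (hφ M _ (isModel_specRel_of_specRelE hJ) τ)

end RestFrame

/-! ### The definitional equivalence of the two theories -/

section Equivalence

variable {S M K : Type u}

/-- A number greater than all the variables of an atomic formula. -/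
def freshVar {r : ℕ} (args : Fin r → ℕ) : ℕ := Finset.univ.sup args + 1

theorem lt_freshVar {r : ℕ} (args : Fin r → ℕ) (i : Fin r) : args i < freshVar args :=
  Nat.lt_succ_of_le (Finset.le_sup (Finset.mem_univ i))

open KForm in
/-- The formula `W(k, b, x)` of the other model, for an ether observer `e`. -/
def otherAtomF (rel : Bool) (e : ℕ) (args : Fin 6 → ℕ) : KForm S :=
  isQ (args 2) ⋏ isQ (args 3) ⋏ isQ (args 4) ⋏ isQ (args 5) ⋏
    otherWF rel e (args 0) (args 1) ![args 2, args 3, args 4, args 5]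

/-- An inertial observer with some speed of light. -/
def etherObserverF (args : Fin 1 → ℕ) : KForm S :=
  KForm.IOb (args 0) ⋏ KForm.exQ fun c => Kin.lightSpeed (args 0) c

/-- The formulas defining the relations of the model of relativistic kinematics with a rest frame in
the classical model: `E` is the set of the ether observers. -/
def relativisticInClassical : ∀ R : kinLangE S, (Fin R.1.rank → ℕ) → Formula (kinLang S)
  | ⟨.kin .W, _⟩, args => KForm.exO (fun e => otherAtomF false e args) (freshVar args)
  | ⟨.kin .E, _⟩, args => etherObserverF args (freshVar args)
  | ⟨.kin .B, _⟩, args => .rel ⟨.kin .B, KinStr.kin_mem (by simp)⟩ args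
  | ⟨.kin .Q, _⟩, args => .rel ⟨.kin .Q, KinStr.kin_mem (by simp)⟩ args
  | ⟨.kin .IOb, _⟩, args => .rel ⟨.kin .IOb, KinStr.kin_mem (by simp)⟩ args
  | ⟨.kin .Ph, _⟩, args => .rel ⟨.kin .Ph, KinStr.kin_mem (by simp)⟩ args
  | ⟨.kin .plus, _⟩, args => .rel ⟨.kin .plus, KinStr.kin_mem (by simp)⟩ args
  | ⟨.kin .times, _⟩, args => .rel ⟨.kin .times, KinStr.kin_mem (by simp)⟩ args
  | ⟨.kin .le, _⟩, args => .rel ⟨.kin .le, KinStr.kin_mem (by simp)⟩ args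
  | ⟨.other _ _, _⟩, _ => .not (.eq 0 0)

/-- The formulas defining the relations of the classical model in the model of relativistic
kinematics with a rest frame. -/
def classicalInRelativistic : ∀ R : kinLang S, (Fin R.1.rank → ℕ) → Formula (kinLangE S)
  | ⟨.kin .W, _⟩, args => .ex (freshVar args) (.and (isE (freshVar args))
      ((otherAtomF true (freshVar args) args (freshVar args + 1)).incl
        (kinLang_subset_kinLangE S)))
  | ⟨.kin s, h⟩, args => .rel ⟨.kin s, kinLang_subset_kinLangE S h⟩ args
  | ⟨.other _ _, _⟩, _ => .not (.eq 0 0)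

variable [Field K] [LinearOrder K]

theorem sat_otherAtomF {A : KinStr M} (q : Quantities A K) (rel : Bool) {e n : ℕ} {τ : ℕ → M}
    {args : Fin 6 → ℕ} (he : e < n) (hargs : ∀ i, args i < n) :
    Sat (A.interp S) τ ((otherAtomF rel e args : KForm S) n) ↔
      (A.Q (τ (args 2)) ∧ A.Q (τ (args 3)) ∧ A.Q (τ (args 4)) ∧ A.Q (τ (args 5))) ∧
        q.OtherW rel (τ e) (τ (args 0)) (τ (args 1)) ![q.val (τ (args 2)), q.val (τ (args 3)),
          q.val (τ (args 4)), q.val (τ (args 5))] := by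
  simp only [otherAtomF, sat_conj, sat_isQ]
  constructor
  · rintro ⟨h₂, h₃, h₄, h₅, h⟩
    refine ⟨⟨h₂, h₃, h₄, h₅⟩, ?_⟩
    rw [sat_otherWF q rel he (hargs 0) (hargs 1)] at h
    · convert h using 1
      ext i; fin_cases i <;> rfl
    · intro j; fin_cases j <;> exact hargs _
    · intro j; fin_cases j <;> assumption
  · rintro ⟨⟨h₂, h₃, h₄, h₅⟩, h⟩
    refine ⟨h₂, h₃, h₄, h₅, ?_⟩
    rw [sat_otherWF q rel he (hargs 0) (hargs 1)]
    · convert h using 1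
      ext i; fin_cases i <;> rfl
    · intro j; fin_cases j <;> exact hargs _
    · intro j; fin_cases j <;> assumption

variable [IsStrictOrderedRing K] [IsEuclidean K]

omit [IsStrictOrderedRing K] [IsEuclidean K] in
theorem Frame.Good.withW {A : KinStr M} {D : Frame M K}
    {e : M} (h : D.Good A e)
    (q : Quantities A K) (L : M → (Fin 4 → K) →ₗ[K] (Fin 4 → K)) :
    D.Good (q.withW (A.Worldview D.o L D.wl)) e :=
  { h with sorted := q.withW_sorted h.sorted fun _ _ _ h => ⟨h.1, h.2.1⟩ }

/-- The classical model `I` and the relativistic model `J` with a rest frame are given by the same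
frame. -/
def Corresponding (S : Type u) (M : Type u) (J : Interp (kinLangE S) M)
    (I : Interp (kinLang S) M) : Prop :=
  ∃ (K : Type u) (_ : Field K) (_ : LinearOrder K) (_ : IsStrictOrderedRing K)
    (_ : IsEuclidean K) (A : KinStr M) (q : Quantities A K) (D : Frame M K) (e : M), D.Good A e ∧
    I = (q.withW (A.Worldview D.o D.galMap D.wl)).interp S ∧
    J = (q.withW (A.Worldview D.o D.lorMap D.wl)).interpE S fun k => A.IOb k ∧ D.w k = 0

/-- In the relativistic model, the observers stationary with respect to the base observer are those
with vanishing velocity. -/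
theorem Frame.Good.stationary_iff {A : KinStr M} {q : Quantities A K} {D : Frame M K} {e : M}
    (h : D.Good A e) (hW : ∀ k b x, q.W k b x ↔ A.Worldview D.o D.lorMap D.wl k b x) {k : M}
    (hk : A.IOb k) : q.Stationary e k ↔ D.w k = 0 := by
  obtain ⟨r, hr, hr', -⟩ := (h.trivial k hk).exists_time
  have hr₀ : r ≠ 0 := fun h => by simp [h] at hr
  have hline (x) : q.W e k x ↔ ∃ s : K,
      x = D.o k + s • r • (gamma D.c (D.w k) • timeUnit + D.w k) := by
    rw [hW, KinStr.Worldview, h.base_o, zero_add, h.lorMap_base]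
    simp only [h.base_mem, h.sorted.IOb_B k hk, hk, not_true, false_and, or_false, true_and]
    rw [lorMap, LinearMap.comp_apply, hr', map_smul, lor_timeUnit h.c_pos (h.time_w k hk)]
  constructor
  · intro hs
    obtain ⟨h₁, h₂, h₃⟩ := hs (D.o k) (D.o k + (gamma D.c (D.w k) • timeUnit + D.w k))
      ((hline _).2 ⟨0, by rw [zero_smul, add_zero]⟩)
      ((hline _).2 ⟨r, by rw [smul_smul, ← sq, hr, one_smul]⟩)
    refine vec_eq_iff.2 ⟨h.time_w k hk, ?_, ?_, ?_⟩
    · simpa [timeUnit_one] using h₁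
    · simpa [timeUnit_two] using h₂
    · simpa [timeUnit_three] using h₃
  · intro hw x y hx hy
    obtain ⟨s, rfl⟩ := (hline x).1 hx
    obtain ⟨t, rfl⟩ := (hline y).1 hy
    simp [hw, timeUnit_one, timeUnit_two, timeUnit_three]

/-- The translated worldview relation does not depend on the choice of the observer at rest. -/
theorem Frame.Good.otherW_iff_of_rest {A : KinStr M} {q : Quantities A K} {D : Frame M K} {e : M}
    (h : D.Good A e) {rel : Bool} (hW : ∀ k b x, q.W k b x ↔
      A.Worldview D.o (bif rel then D.lorMap else D.galMap) D.wl k b x) {a : M} (ha : A.IOb a)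
    (haw : D.w a = 0) (k b : M) (x : Fin 4 → K) : q.OtherW rel a k b x ↔
      A.Worldview D.o (bif rel then D.galMap else D.lorMap) D.wl k b x := by
  obtain ⟨D', hD', -, hlor, hgal⟩ := h.exists_rebase ha haw
  cases rel
  · rw [hD'.otherW_iff (rel := false) fun k b x => (hW k b x).trans (hgal k b x).symm]
    exact hlor k b x
  · rw [hD'.otherW_iff (rel := true) fun k b x => (hW k b x).trans (hlor k b x).symm]
    exact hgal k b x

section Atoms

variable {A : KinStr M} (q : Quantities A K) {D : Frame M K} {e : M}

omit [IsEuclidean K] in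
theorem Frame.Good.sat_etherObserverF (h : D.Good A e) (args : Fin 1 → ℕ) (τ : ℕ → M) :
    Sat ((q.withW (A.Worldview D.o D.galMap D.wl)).interp S) τ
      (etherObserverF args (freshVar args)) ↔ A.IOb (τ (args 0)) ∧ D.w (τ (args 0)) = 0 := by
  have h' := h.withW q D.galMap
  have hlt := lt_freshVar args
  rw [etherObserverF, sat_conj, (q.withWQuantities (A.Worldview D.o D.galMap D.wl)).sat_exQ]
  refine and_congr_right fun hk =>
    (exists_congr fun c => ?_).trans (h'.exists_lightSpeed_iff (q.withW_W _) hk)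
  rw [(q.withWQuantities (A.Worldview D.o D.galMap D.wl)).sat_lightSpeed
    (Nat.lt_succ_of_lt (hlt 0)) (Nat.lt_succ_self _)]
  · rw [update_lt (hlt 0), Function.update_self, Quantities.val_ι]
  · rw [Function.update_self]
    exact Quantities.Q_ι _ c

omit [IsStrictOrderedRing K] [IsEuclidean K] in
theorem Frame.sat_otherAtomF (D : Frame M K) (rel : Bool) (args : Fin 6 → ℕ) (τ : ℕ → M)
    (a : M) : Sat ((q.withW (A.Worldview D.o (bif rel then D.lorMap else D.galMap) D.wl)).interp S)
      (Function.update τ (freshVar args) a)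
      ((otherAtomF rel (freshVar args) args : KForm S) (freshVar args + 1)) ↔
    (A.Q (τ (args 2)) ∧ A.Q (τ (args 3)) ∧ A.Q (τ (args 4)) ∧ A.Q (τ (args 5))) ∧
      (q.withWQuantities (A.Worldview D.o (bif rel then D.lorMap else D.galMap) D.wl)).OtherW rel a
        (τ (args 0)) (τ (args 1)) ![q.val (τ (args 2)), q.val (τ (args 3)), q.val (τ (args 4)),
          q.val (τ (args 5))] := by
  rw [_root_.sat_otherAtomF (q.withWQuantities _) rel (Nat.lt_succ_self _)
    fun i => Nat.lt_succ_of_lt (lt_freshVar args i)]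
  simp only [Function.update_self, update_lt (lt_freshVar args _)]
  rfl

/-- The worldview relation of the relativistic model is definable in the classical model. -/
theorem Frame.Good.sat_exO_otherAtomF (h : D.Good A e) (args : Fin 6 → ℕ) (τ : ℕ → M) :
    Sat ((q.withW (A.Worldview D.o D.galMap D.wl)).interp S) τ
      (KForm.exO (fun e => otherAtomF false e args) (freshVar args)) ↔
    (q.withW (A.Worldview D.o D.lorMap D.wl)).W (τ (args 0)) (τ (args 1)) (τ (args 2))
      (τ (args 3)) (τ (args 4)) (τ (args 5)) := by
  have h' := h.withW q D.galMap
  rw [sat_exO h'.sorted.IOb_B]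
  constructor
  · rintro ⟨a, ha, hsat⟩
    obtain ⟨hQ, hO⟩ := (D.sat_otherAtomF q false args τ a).1 hsat
    obtain ⟨-, -, c, hc, -⟩ := id hO
    have haw := (h'.exists_lightSpeed_iff (q.withW_W _) ha).1 ⟨c, hc⟩
    exact ⟨hQ, (h'.otherW_iff_of_rest (rel := false) (q.withW_W _) ha haw _ _ _).1 hO⟩
  · rintro ⟨hQ, hO⟩
    exact ⟨e, h.base_mem, (D.sat_otherAtomF q false args τ e).2 ⟨hQ,
      (h'.otherW_iff_of_rest (rel := false) (q.withW_W _) h.base_mem h.base_w _ _ _).2 hO⟩⟩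

/-- The worldview relation of the classical model is definable in the relativistic model with a rest
frame. -/
theorem Frame.Good.sat_exE_otherAtomF (h : D.Good A e) (args : Fin 6 → ℕ) (τ : ℕ → M) :
    Sat ((q.withW (A.Worldview D.o D.lorMap D.wl)).interpE S fun k => A.IOb k ∧ D.w k = 0) τ
      (.ex (freshVar args) (.and (isE (freshVar args))
        ((otherAtomF true (freshVar args) args (freshVar args + 1)).incl
          (kinLang_subset_kinLangE S)))) ↔
    (q.withW (A.Worldview D.o D.galMap D.wl)).W (τ (args 0)) (τ (args 1)) (τ (args 2))
      (τ (args 3)) (τ (args 4)) (τ (args 5)) := by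
  have h' := h.withW q D.lorMap
  have hE (a : M) : Sat ((q.withW (A.Worldview D.o D.lorMap D.wl)).interpE S
      fun k => A.IOb k ∧ D.w k = 0) (Function.update τ (freshVar args) a) (isE (freshVar args)) ↔
      A.IOb a ∧ D.w a = 0 := by
    rw [← Function.update_self (f := τ) (freshVar args) a]
    simp only [Function.update_self]
    change A.IOb (Function.update τ (freshVar args) a (freshVar args)) ∧
      D.w (Function.update τ (freshVar args) a (freshVar args)) = 0 ↔ _
    rw [Function.update_self]
  constructor
  · rintro ⟨a, ha, hsat⟩
    obtain ⟨ha, haw⟩ := (hE a).1 ha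
    obtain ⟨hQ, hO⟩ := (D.sat_otherAtomF q true args τ a).1 ((KinStr.sat_incl_iff _ _ _ _).1 hsat)
    exact ⟨hQ, (h'.otherW_iff_of_rest (rel := true) (q.withW_W _) ha haw _ _ _).1 hO⟩
  · rintro ⟨hQ, hO⟩
    exact ⟨e, (hE e).2 ⟨h.base_mem, h.base_w⟩, (KinStr.sat_incl_iff _ _ _ _).2
      ((D.sat_otherAtomF q true args τ e).2 ⟨hQ,
        (h'.otherW_iff_of_rest (rel := true) (q.withW_W _) h.base_mem h.base_w _ _ _).2 hO⟩)⟩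

end Atoms

/-- Relativistic kinematics with a rest frame is definitionally equivalent to classical
kinematics. -/
theorem definitionallyEquivalent_specRelE_classicalKin (S : Type u) :
    DefinitionallyEquivalent (specRelE S) (classicalKin S) := by
  refine definitionallyEquivalent_of_correspondence (T₁ := specRelE S) (T₂ := classicalKin S)
    relativisticInClassical classicalInRelativistic (Corresponding S) ?_ ?_ ?_ ?_ ?_ ?_
  · rintro M I J ⟨K, _, _, _, _, A, q, D, e, h, rfl, rfl⟩
    have : Nonempty M := ⟨e⟩
    have h' := h.withW q D.lorMap
    have hW := q.withW_W (A.Worldview D.o D.lorMap D.wl)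
    exact (isModel_specRelE_iff (q.withWQuantities _)).2 ⟨h'.relativisticAxioms hW, e, h.base_mem,
      fun k => and_congr_right fun hk => (h'.stationary_iff hW hk).symm⟩
  · rintro M I J ⟨K, _, _, _, _, A, q, D, e, h, rfl, rfl⟩
    exact (isModel_classicalKin_iff (q.withWQuantities _)).2
      ((h.withW q D.galMap).classicalAxioms (q.withW_W _))
  · rintro M I J ⟨K, _, _, _, _, A, q, D, e, h, rfl, rfl⟩ ⟨R, hR⟩ args τ
    rcases R with s | ⟨s, n⟩
    · cases s
      case W => exact h.sat_exO_otherAtomF q args τ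
      case E => exact h.sat_etherObserverF q args τ
      all_goals exact Iff.rfl
    · rcases hR with h | ⟨-, -, h⟩ <;> simp at h
  · rintro M I J ⟨K, _, _, _, _, A, q, D, e, h, rfl, rfl⟩ ⟨_, s, hs, rfl⟩ args τ
    cases s
    case W => exact h.sat_exE_otherAtomF q args τ
    case E => exact absurd rfl hs
    all_goals exact Iff.rfl
  · intro M _ J hJ
    change Interp (kinLangE S) M at J
    obtain ⟨A, X, rfl⟩ := KinStr.exists_eq_interpE J
    obtain ⟨K, _, _, _, _, q, hq⟩ :=
      exists_quantities_of_relativistic (isModel_specRel_of_specRelE hJ)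
    obtain ⟨-, e, he, hX⟩ := (isModel_specRelE_iff q).1 hJ
    obtain ⟨D, hD, hW⟩ := hq.exists_frame he
    refine ⟨_, K, _, _, ‹_›, ‹_›, A, q, D, e, hD, rfl, ?_⟩
    rw [q.withW_eq hD.sorted hW]
    congr 1
    funext k
    rw [hX k]
    exact propext (and_congr_right fun hk => hD.stationary_iff hW hk)
  · intro M _ I hI
    change Interp (kinLang S) M at I
    rw [← KinStr.interp_ofInterp I] at hI ⊢
    obtain ⟨K, _, _, _, _, q, hq⟩ := exists_quantities_of_classical hI
    obtain ⟨e, he, c, hc⟩ := hq.ether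
    obtain ⟨D, hD, -, hW⟩ := hq.exists_frame he hc
    exact ⟨_, K, _, _, ‹_›, ‹_›, _, q, D, e, hD, by rw [q.withW_eq hD.sorted hW], rfl⟩

end Equivalence

open Coord

/-! ### Rotations conjugate to their squares -/

section Rotations

variable {K : Type*} [Field K] [LinearOrder K] [IsStrictOrderedRing K]

/-- The theorem of Cayley and Hamilton for the adjugate of a matrix of size three. -/
theorem Matrix.adjugate_eq_of_fin_three {R : Type*} [CommRing R] (m : Matrix (Fin 3) (Fin 3) R) :
    m.adjugate = m * m - m.trace • m + m.adjugate.trace • (1 : Matrix (Fin 3) (Fin 3) R) := by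
  ext i j
  simp only [Matrix.adjugate_fin_three, Matrix.trace_fin_three, Matrix.add_apply, Matrix.sub_apply,
    Matrix.smul_apply, smul_eq_mul, Matrix.mul_apply, Fin.sum_univ_three]
  fin_cases i <;> fin_cases j <;> simp <;> ring

theorem Matrix.eq_one_of_trace_eq_three {m : Matrix (Fin 3) (Fin 3) K}
    (hm : m * m.transpose = 1) (ht : m.trace = 3) : m = 1 := by
  have hrow (i : Fin 3) : m i 0 ^ 2 + m i 1 ^ 2 + m i 2 ^ 2 = 1 := by
    have := congrFun (congrFun hm i) i
    rw [Matrix.mul_apply, Fin.sum_univ_three] at this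
    simp only [Matrix.transpose_apply, Matrix.one_apply_eq] at this
    linear_combination this
  rw [Matrix.trace_fin_three] at ht
  -- The rows are unit vectors and the sum of the `m i i` is three.
  have hs : ∑ q : Fin 3 × Fin 3, (m q.1 q.2 - (1 : Matrix (Fin 3) (Fin 3) K) q.1 q.2) ^ 2 = 0 := by
    rw [Fintype.sum_prod_type]
    simp only [Fin.sum_univ_three, Matrix.one_apply, Fin.reduceEq, if_true, if_false]
    linear_combination hrow 0 + hrow 1 + hrow 2 - 2 * ht
  ext i j
  have h := (Finset.sum_eq_zero_iff_of_nonneg fun q _ => sq_nonneg _).1 hs (i, j)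
    (Finset.mem_univ _)
  exact sub_eq_zero.1 (pow_eq_zero_iff two_ne_zero |>.1 h)

/-- An orthogonal matrix of size three that is conjugate to its square has order one or three: its
trace `t` satisfies `t = t² - 2t`. -/
theorem Matrix.pow_three_eq_one_of_conj {m p : Matrix (Fin 3) (Fin 3) K}
    (hm : m * m.transpose = 1) (hp : p * p.transpose = 1) (h : p * m = m * m * p) :
    m * m * m = 1 := by
  have hm' : m.transpose * m = 1 := mul_eq_one_comm.1 hm
  have hconj : m * m = p * m * p.transpose := by rw [h, mul_assoc (m * m), hp, mul_one]
  have hdet : m.det = 1 := by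
    have h₁ : m.det * m.det = 1 := by
      have := congrArg Matrix.det hm
      rwa [Matrix.det_mul, Matrix.det_transpose, Matrix.det_one] at this
    have h₂ : m.det * m.det = m.det := by
      have h₃ := congrArg Matrix.det h
      rw [Matrix.det_mul, Matrix.det_mul, Matrix.det_mul, mul_comm p.det] at h₃
      have h₄ : p.det ≠ 0 := fun h₀ => by
        have := congrArg Matrix.det hp
        rw [Matrix.det_mul, h₀, zero_mul, Matrix.det_one] at this
        exact zero_ne_one this
      exact (mul_right_cancel₀ h₄ h₃).symm
    rw [← h₂, h₁]
  have hadj : m.adjugate = m.transpose := by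
    have h₁ : m * m.adjugate = 1 := by rw [Matrix.mul_adjugate, hdet, one_smul]
    rw [← one_mul m.adjugate, ← hm', mul_assoc, h₁, mul_one]
  have hch := m.adjugate_eq_of_fin_three
  rw [hadj, Matrix.trace_transpose] at hch
  have htr : (m * m).trace = m.trace := by
    rw [hconj, Matrix.trace_mul_comm, ← mul_assoc, mul_eq_one_comm.1 hp, one_mul]
  have ht : m.trace * (m.trace - 3) = 0 := by
    have := congrArg Matrix.trace hch
    rw [Matrix.trace_transpose, Matrix.trace_add, Matrix.trace_sub, Matrix.trace_smul,
      Matrix.trace_smul, htr, Matrix.trace_one, Fintype.card_fin] at this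
    simp only [smul_eq_mul, Nat.cast_ofNat] at this
    linear_combination this
  rcases mul_eq_zero.1 ht with ht | ht
  · rw [ht, zero_smul, zero_smul, sub_zero, add_zero] at hch
    rw [← hch, hm']
  · rw [Matrix.eq_one_of_trace_eq_three hm (by linear_combination ht), one_mul, one_mul]

/-- An isometry of time and space that is conjugate to its square has order one or three. -/
theorem Coord.IsTrivial.iterate_three_eq {X T : (Fin 4 → K) →ₗ[K] (Fin 4 → K)} (hX : IsTrivial X)
    (hT : IsTrivial T) {a b : Fin 4 → K}
    (h : ∀ z, a + X (b + T z) = b + T (b + T (a + X z))) (z : Fin 4 → K) :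
    b + T (b + T (b + T z)) = z := by
  have h₀ : a + X b = b + T (b + T a) := by simpa using h 0
  have hlin (z) : X (T z) = T (T (X z)) := by
    have h₁ := h z
    rw [map_add X, ← add_assoc, h₀] at h₁
    have h₂ : b + T (b + T a) + X (T z) = b + T (b + T a) + T (T (X z)) := by
      rw [h₁]; simp only [map_add]; abel
    exact add_left_cancel h₂
  obtain ⟨r, m, hr, hm, hTm⟩ := hT.exists_matrix
  obtain ⟨s, p, hs, hp, hXp⟩ := hX.exists_matrix
  have hs₀ : s ≠ 0 := fun h => by simp [h] at hs
  have hr₁ : r = 1 := by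
    have h₁ := congrFun (hlin timeUnit) 0
    simp only [hTm, hXp, Matrix.cons_val_zero, timeUnit_zero, mul_one] at h₁
    rw [← mul_assoc, ← sq, hr, one_mul] at h₁
    exact mul_left_cancel₀ hs₀ (h₁.trans (mul_one s).symm)
  have hconj : p * m = m * m * p := by
    refine Matrix.ext_of_mulVec_single fun j => ?_
    have h₁ := congrArg Matrix.vecTail (hlin (Matrix.vecCons 0 (Pi.single j 1)))
    simp only [hTm, hXp, Matrix.tail_cons, Matrix.mulVec_mulVec] at h₁
    rw [h₁, mul_assoc]
  have hm₃ := Matrix.pow_three_eq_one_of_conj hm hp hconj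
  have hT₃ (z) : T (T (T z)) = z := by
    simp only [hTm, hr₁, one_mul, Matrix.tail_cons, Matrix.mulVec_mulVec, Matrix.cons_val_zero]
    rw [← mul_assoc, hm₃, Matrix.one_mulVec]
    exact Matrix.cons_head_tail z
  set u := b + T b + T (T b) with hu
  have hY (z) : b + T (b + T (b + T z)) = z + u := by
    simp only [map_add, hT₃, hu]; abel
  have hXu : X u = (2 : K) • u := by
    have h₁ : X u = X b + X (T b) + X (T (T b)) := by rw [hu, map_add, map_add]
    have h₂ : X b = b + T b + T (T a) - a := by
      rw [← add_sub_cancel_left a (X b), h₀, map_add]; abel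
    rw [h₁, hlin, hlin, hlin, h₂]
    simp only [map_sub, map_add, hT₃]
    rw [hu]
    module
  have hu₀ : u = 0 := by
    have h₁ := hX u
    rw [hXu, space_smul, Pi.smul_apply, smul_eq_mul] at h₁
    refine eq_zero_of_space (pow_eq_zero_iff two_ne_zero |>.1 (by linarith [h₁.1])) ?_
    linarith [h₁.2]
  rw [hY, hu₀, add_zero]

end Rotations

open Coord

/-! ### Automorphisms of models -/

section Automorphisms

variable {S M : Type u} {L : RelLanguage S}

/-- The permutation `α` is an automorphism of the model `I`. -/
def Interp.IsAut (I : Interp L M) (α : Equiv.Perm M) : Prop :=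
  ∀ (R : L) (a : Fin R.1.rank → M), (fun m => α (a m)) ∈ I R ↔ a ∈ I R

variable {I : Interp L M} {α β : Equiv.Perm M}

theorem Interp.IsAut.mul (hα : I.IsAut α) (hβ : I.IsAut β) : I.IsAut (α * β) := fun R a =>
  (hα R fun m => β (a m)).trans (hβ R a)

theorem Interp.IsAut.sat (hα : I.IsAut α) (φ : Formula L) (τ : ℕ → M) :
    Sat I (fun i => α (τ i)) φ ↔ Sat I τ φ := by
  induction φ generalizing τ with
  | eq i j => exact α.injective.eq_iff
  | rel R args => exact hα R _
  | and φ ψ h₁ h₂ => exact and_congr (h₁ τ) (h₂ τ)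
  | not φ h => exact not_congr (h τ)
  | ex i φ h =>
    have hu (a : M) : Function.update (fun j => α (τ j)) i (α a) =
        fun j => α (Function.update τ i a j) := by
      funext j
      by_cases hj : j = i
      · subst hj; simp
      · simp [hj]
    constructor
    · rintro ⟨a, ha⟩
      obtain ⟨a, rfl⟩ := α.surjective a
      exact ⟨a, (h _).1 (by rwa [hu] at ha)⟩
    · rintro ⟨a, ha⟩
      exact ⟨α a, by rw [hu]; exact (h _).2 ha⟩

theorem Interp.isAut_of_sat [Nonempty M]
    (h : ∀ (R : L) (args : Fin R.1.rank → ℕ) (τ : ℕ → M),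
      Sat I (fun i => α (τ i)) (.rel R args) ↔ Sat I τ (.rel R args)) : I.IsAut α := fun R a => by
  have ha : a = fun m : Fin R.1.rank =>
      (fun i => if h : i < R.1.rank then a ⟨i, h⟩ else Classical.arbitrary M) m.1 := by
    funext m; simp
  rw [ha]
  exact h R (fun m => m.1) _

theorem Equiv.swap_apply_iff [DecidableEq M] {P : M → Prop} {b b' : M} (h : P b' ↔ P b) (a : M) :
    P (Equiv.swap b b' a) ↔ P a := by
  rw [Equiv.swap_apply_def]
  split_ifs with h₁ h₂
  · rw [h₁, h]
  · rw [h₂, h]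
  · rfl

variable {K : Type u} {A : KinStr M}

/-- Automorphisms of the field of quantities respect the order, hence they are trivial if they have
order two. -/
theorem Quantities.eq_of_involutive [Add K] [Mul K] [LinearOrder K] (q : Quantities A K)
    (h : (A.interp S).IsAut α) (h₂ : ∀ m, α (α m) = m) (s : K) : α (q.ι s) = q.ι s := by
  have hQ : A.Q (α (q.ι s)) ↔ A.Q (q.ι s) := h ⟨.kin .Q, KinStr.kin_mem (by simp)⟩ ![q.ι s]
  have hle (a b : M) : A.le (α a) (α b) ↔ A.le a b :=
    h ⟨.kin .le, KinStr.kin_mem (by simp)⟩ ![a, b]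
  obtain ⟨t, ht⟩ := (q.Q_iff _).1 (hQ.2 (q.Q_ι s))
  have hts : α (q.ι t) = q.ι s := by rw [ht, h₂]
  have h₃ : s ≤ t ↔ t ≤ s := by
    rw [← q.le_ι, ← q.le_ι t, ← hle, hts, ← ht]
  rw [← ht]
  exact congrArg q.ι (le_antisymm (by_contra fun h => h ((h₃.1 (le_of_not_ge h))))
    (by_contra fun h => h (h₃.2 (le_of_not_ge h))))

variable [Field K] [LinearOrder K]

/-- A permutation that fixes the quantities and respects the other relations is an automorphism. -/
theorem Quantities.isAut_interp (q : Quantities A K) (hA : A.Sorted)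
    (hι : ∀ s, α (q.ι s) = q.ι s) (hO : ∀ a, A.IOb (α a) ↔ A.IOb a)
    (hP : ∀ a, A.Ph (α a) ↔ A.Ph a) (hW : ∀ k b x, q.W (α k) (α b) x ↔ q.W k b x) :
    (A.interp S).IsAut α := by
  have hι' (s : K) (a : M) : q.ι s = α a ↔ q.ι s = a := by
    conv_lhs => rw [← hι s]
    exact α.injective.eq_iff
  have hQ (a : M) : A.Q (α a) ↔ A.Q a := by simp only [q.Q_iff, hι']
  have hfix {a : M} (ha : A.Q a) : α a = a := by
    obtain ⟨s, rfl⟩ := (q.Q_iff a).1 ha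
    exact hι s
  have hW' (k b x₀ x₁ x₂ x₃ : M) :
      A.W (α k) (α b) (α x₀) (α x₁) (α x₂) (α x₃) ↔ A.W k b x₀ x₁ x₂ x₃ := by
    by_cases h : A.Q x₀ ∧ A.Q x₁ ∧ A.Q x₂ ∧ A.Q x₃
    · obtain ⟨h₀, h₁, h₂, h₃⟩ := h
      rw [hfix h₀, hfix h₁, hfix h₂, hfix h₃]
      obtain ⟨s₀, rfl⟩ := (q.Q_iff _).1 h₀
      obtain ⟨s₁, rfl⟩ := (q.Q_iff _).1 h₁
      obtain ⟨s₂, rfl⟩ := (q.Q_iff _).1 h₂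
      obtain ⟨s₃, rfl⟩ := (q.Q_iff _).1 h₃
      exact hW k b ![s₀, s₁, s₂, s₃]
    · refine iff_of_false (fun h' => h ?_) fun h' => h (hA.W_sorts _ _ _ _ _ _ h').2.2
      have := (hA.W_sorts _ _ _ _ _ _ h').2.2
      simpa only [hQ] using this
  rintro ⟨R, s, hs, rfl⟩ a
  cases s with
  | B => exact (hA.B_iff _).trans ((not_congr (hQ _)).trans (hA.B_iff _).symm)
  | Q => exact hQ _
  | IOb => exact hO _
  | Ph => exact hP _
  | plus =>
    change A.plus (α (a (0 : Fin 3))) (α (a (1 : Fin 3))) (α (a (2 : Fin 3))) ↔ A.plus _ _ _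
    simp only [q.plus_iff, hι']
  | times =>
    change A.times (α (a (0 : Fin 3))) (α (a (1 : Fin 3))) (α (a (2 : Fin 3))) ↔ A.times _ _ _
    simp only [q.times_iff, hι']
  | le =>
    change A.le (α (a (0 : Fin 2))) (α (a (1 : Fin 2))) ↔ A.le _ _
    simp only [q.le_iff, hι']
  | W => exact hW' _ _ _ _ _ _
  | E => exact absurd rfl hs

end Automorphisms

section ClassicalAutomorphisms

variable {S M K : Type u} [Field K] [LinearOrder K] {A : KinStr M}
  {q : Quantities A K} {α β : Equiv.Perm M} {e : M} {c : K}

/-- The permutation `α` is an automorphism of the structure that fixes every quantity. -/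
structure Quantities.Fixes (S : Type u) (q : Quantities A K) (α : Equiv.Perm M) : Prop where
  isAut : (A.interp S).IsAut α
  fix : ∀ s, α (q.ι s) = q.ι s

namespace Quantities.Fixes

theorem mul (hα : q.Fixes S α) (hβ : q.Fixes S β) : q.Fixes S (α * β) :=
  ⟨hα.isAut.mul hβ.isAut, fun s => by rw [Equiv.Perm.mul_apply, hβ.fix, hα.fix]⟩

theorem B_iff (h : q.Fixes S α) (a : M) : A.B (α a) ↔ A.B a :=
  h.isAut ⟨.kin .B, KinStr.kin_mem (by simp)⟩ ![a]

theorem IOb_iff (h : q.Fixes S α) (a : M) : A.IOb (α a) ↔ A.IOb a :=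
  h.isAut ⟨.kin .IOb, KinStr.kin_mem (by simp)⟩ ![a]

theorem Ph_iff (h : q.Fixes S α) (a : M) : A.Ph (α a) ↔ A.Ph a :=
  h.isAut ⟨.kin .Ph, KinStr.kin_mem (by simp)⟩ ![a]

theorem W_iff (h : q.Fixes S α) (k b : M) (x : Fin 4 → K) : q.W (α k) (α b) x ↔ q.W k b x := by
  have := h.isAut ⟨.kin .W, KinStr.kin_mem (by simp)⟩
    ![k, b, q.ι (x 0), q.ι (x 1), q.ι (x 2), q.ι (x 3)]
  have h' : A.W (α k) (α b) (α (q.ι (x 0))) (α (q.ι (x 1))) (α (q.ι (x 2))) (α (q.ι (x 3))) ↔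
    A.W k b (q.ι (x 0)) (q.ι (x 1)) (q.ι (x 2)) (q.ι (x 3)) := this
  rwa [h.fix, h.fix, h.fix, h.fix] at h'

theorem sameEvent_iff (h : q.Fixes S α) (k k' : M) (x y : Fin 4 → K) :
    q.SameEvent (α k) x (α k') y ↔ q.SameEvent k x k' y := by
  constructor
  · intro H b hb
    rw [← h.W_iff k, ← h.W_iff k']
    exact H _ ((h.B_iff b).2 hb)
  · intro H b hb
    obtain ⟨b, rfl⟩ := α.surjective b
    rw [h.W_iff, h.W_iff]
    exact H b ((h.B_iff b).1 hb)

theorem lightSpeed (h : q.Fixes S α) {k : M} (hc : q.LightSpeed k c) : q.LightSpeed (α k) c := by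
  refine ⟨hc.1, fun x y => ?_⟩
  rw [← hc.2 x y]
  constructor
  · rintro ⟨p, hp⟩
    obtain ⟨p, rfl⟩ := α.surjective p
    exact ⟨p, by simpa only [h.B_iff, h.Ph_iff, h.W_iff] using hp⟩
  · rintro ⟨p, hp⟩
    exact ⟨α p, by simpa only [h.B_iff, h.Ph_iff, h.W_iff] using hp⟩

/-- An automorphism of a classical model that preserves the events of an ether observer preserves
the world line of every body, so that every transposition of a body and its image is an
automorphism. -/
theorem isAut_swap [DecidableEq M] (h : q.Fixes S α) (hq : CommonAxioms q) (he : A.IOb e)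
    (hα : ∀ x, q.SameEvent (α e) x e x) (b : M) : (A.interp S).IsAut (Equiv.swap b (α b)) := by
  have hbody (k b : M) (x : Fin 4 → K) : q.W k (α b) x ↔ q.W k b x := by
    by_cases hb : A.B b
    · by_cases hk : A.IOb k
      · obtain ⟨y, hy⟩ := hq.ev k hk e he x
        rw [hy _ ((h.B_iff b).2 hb), hy b hb, ← hα y _ ((h.B_iff b).2 hb), h.W_iff]
      · exact iff_of_false (fun h' => hk (hq.noAcc _ _ _ h')) fun h' => hk (hq.noAcc _ _ _ h')
    · exact iff_of_false (fun h' => hb ((h.B_iff b).1 (hq.sorted.W_sorts _ _ _ _ _ _ h').2.1))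
        fun h' => hb (hq.sorted.W_sorts _ _ _ _ _ _ h').2.1
  have hobs (k b : M) (x : Fin 4 → K) : q.W (α k) b x ↔ q.W k b x := by
    rw [← hbody (α k), h.W_iff]
  refine q.isAut_interp hq.sorted (fun s => ?_) (fun a => ?_) (fun a => ?_) fun k b' x => ?_
  · by_cases hb : q.ι s = b
    · rw [← hb, h.fix, Equiv.swap_self, Equiv.refl_apply]
    · refine Equiv.swap_apply_of_ne_of_ne hb fun hb' => hb (α.injective ?_)
      rw [h.fix, hb']
  · exact Equiv.swap_apply_iff (P := A.IOb) (h.IOb_iff b) a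
  · exact Equiv.swap_apply_iff (P := A.Ph) (h.Ph_iff b) a
  · rw [Equiv.swap_apply_iff (P := fun k => q.W k _ x) (hobs b _ x),
      Equiv.swap_apply_iff (P := fun b => q.W k b x) (hbody k b x)]

variable [IsStrictOrderedRing K]

/-- In a classical model, an automorphism that fixes the quantities maps an ether observer to one
whose coordinates are related to the original ones by an isometry of time and space. -/
theorem exists_trivial (h : q.Fixes S α) (hq : ClassicalAxioms q) (he : A.IOb e)
    (hc : q.LightSpeed e c) : ∃ (a : Fin 4 → K) (T : (Fin 4 → K) →ₗ[K] (Fin 4 → K)), IsTrivial T ∧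
      ∀ x y, q.SameEvent (α e) x e y ↔ y = a + T x := by
  obtain ⟨D, hD, -, hW⟩ := hq.exists_frame he hc
  have hk : A.IOb (α e) := (h.IOb_iff e).2 he
  have hw : D.w (α e) = 0 := (hD.exists_lightSpeed_iff hW hk).1 ⟨c, h.lightSpeed hc⟩
  refine ⟨D.o (α e), D.galMap (α e), ?_, fun x y => ?_⟩
  · rw [Frame.galMap, hw]
    exact isTrivial_gal_zero.comp (hD.trivial _ hk)
  · rw [hD.transformations_gal.sameEvent_iff hD.sorted hW hk he, hD.base_o, zero_add,
      hD.galMap_base, eq_comm]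

end Quantities.Fixes

/-- If automorphisms `x` and `y` of a classical model are products of involutive automorphisms and
`x y x⁻¹ = y²`, then `y³` preserves all world lines. -/
theorem isAut_swap_of_classicalKin [Nonempty M] [DecidableEq M] {I : Interp (kinLang S) M}
    (hI : (classicalKin S).IsModel I) {r₀ r₁ s₀ s₁ : Equiv.Perm M}
    (hr₀ : I.IsAut r₀) (hr₁ : I.IsAut r₁) (hs₀ : I.IsAut s₀) (hs₁ : I.IsAut s₁)
    (hr₀' : ∀ m, r₀ (r₀ m) = m) (hr₁' : ∀ m, r₁ (r₁ m) = m) (hs₀' : ∀ m, s₀ (s₀ m) = m)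
    (hs₁' : ∀ m, s₁ (s₁ m) = m)
    (hxy : (r₁ * r₀) * (s₁ * s₀) = (s₁ * s₀) * ((s₁ * s₀) * (r₁ * r₀))) (b : M) :
    I.IsAut (Equiv.swap b (((s₁ * s₀) * ((s₁ * s₀) * (s₁ * s₀))) b)) := by
  obtain ⟨A, rfl⟩ : ∃ A : KinStr M, A.interp S = I := ⟨_, KinStr.interp_ofInterp I⟩
  obtain ⟨K, _, _, _, _, q, hq⟩ := exists_quantities_of_classical hI
  have fixes {α : Equiv.Perm M} (h : (A.interp S).IsAut α) (h₂ : ∀ m, α (α m) = m) :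
      q.Fixes S α := ⟨h, q.eq_of_involutive h h₂⟩
  have hx := (fixes hr₁ hr₁').mul (fixes hr₀ hr₀')
  have hy := (fixes hs₁ hs₁').mul (fixes hs₀ hs₀')
  generalize r₁ * r₀ = x at *
  generalize s₁ * s₀ = y at *
  obtain ⟨e, he, c, hc⟩ := hq.ether
  obtain ⟨a, X, hX, hX'⟩ := hx.exists_trivial hq he hc
  obtain ⟨d, T, hT, hT'⟩ := hy.exists_trivial hq he hc
  have hcomp {α β : Equiv.Perm M} (hβ : q.Fixes S β) {f g : (Fin 4 → K) → (Fin 4 → K)}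
      (hf : ∀ z, q.SameEvent (α e) z e (f z)) (hg : ∀ z, q.SameEvent (β e) z e (g z)) (z) :
      q.SameEvent ((β * α) e) z e (g (f z)) :=
    ((hβ.sameEvent_iff (α e) e z (f z)).2 (hf z)).trans (hg _)
  have hfx (z) : q.SameEvent (x e) z e (a + X z) := (hX' z _).2 rfl
  have hfy (z) : q.SameEvent (y e) z e (d + T z) := (hT' z _).2 rfl
  have hrel (z) : a + X (d + T z) = d + T (d + T (a + X z)) := by
    have h₁ := hcomp hx hfy hfx z
    have h₂ := hcomp hy (hcomp hy hfx hfy) hfy z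
    rw [hxy] at h₁
    exact hq.eq_of_sameEvent he (h₁.symm.trans h₂)
  refine (hy.mul (hy.mul hy)).isAut_swap hq.toCommonAxioms he (fun z => ?_) b
  have h₁ := hcomp hy (hcomp hy hfy hfy) hfy z
  rwa [hX.iterate_three_eq hT hrel] at h₁

end ClassicalAutomorphisms

/-! ### Interpretations and automorphisms -/

section Interpretations

variable {S M : Type u} {L : RelLanguage S} {T₁ T₂ : Theory S}
  {tr : Formula T₁.lang → Formula T₂.lang}

/-- The truth value of a formula depends on the values of finitely many variables. -/
theorem exists_sat_congr (I : Interp L M) (φ : Formula L) :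
    ∃ N : ℕ, ∀ τ τ' : ℕ → M, (∀ i < N, τ i = τ' i) → (Sat I τ φ ↔ Sat I τ' φ) := by
  induction φ with
  | eq i j =>
    refine ⟨max i j + 1, fun τ τ' h => ?_⟩
    rw [Sat, Sat, h i (by omega), h j (by omega)]
  | rel R args =>
    refine ⟨Finset.univ.sup args + 1, fun τ τ' h => ?_⟩
    rw [Sat, Sat]
    have : (fun m => τ (args m)) = fun m => τ' (args m) := funext fun m =>
      h _ (Nat.lt_succ_of_le (Finset.le_sup (Finset.mem_univ m)))
    rw [this]
  | and φ ψ h₁ h₂ =>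
    obtain ⟨N₁, h₁⟩ := h₁
    obtain ⟨N₂, h₂⟩ := h₂
    exact ⟨max N₁ N₂, fun τ τ' h => and_congr (h₁ τ τ' fun i hi => h i (by omega))
      (h₂ τ τ' fun i hi => h i (by omega))⟩
  | not φ h =>
    obtain ⟨N, h⟩ := h
    exact ⟨N, fun τ τ' h' => not_congr (h τ τ' h')⟩
  | ex i φ h =>
    obtain ⟨N, h⟩ := h
    refine ⟨N, fun τ τ' h' => exists_congr fun a => h _ _ fun j hj => ?_⟩
    by_cases hji : j = i
    · subst hji; simp
    · simp [hji, h' j hj]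

variable [Nonempty M] {J : Interp T₂.lang M}

/-- The translation of an atomic formula does not depend on variables that do not occur in the
atomic formula. -/
theorem IsInterpretation.sat_update_iff (h : IsInterpretation T₁ T₂ tr) (hJ : T₂.IsModel J)
    (R : T₁.lang) (args : Fin R.1.rank → ℕ) {i : ℕ} (hi : ∀ m, args m ≠ i) (τ : ℕ → M) (a : M) :
    Sat J (Function.update τ i a) (tr (.rel R args)) ↔ Sat J τ (tr (.rel R args)) := by
  have h₁ : T₁.Entails (.iff (.ex i (.rel R args)) (.rel R args)) := fun N _ I _ σ => by
    rw [sat_iff]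
    have h₂ (b : N) : (fun m => Function.update σ i b (args m)) = fun m => σ (args m) :=
      funext fun m => Function.update_of_ne (hi m) _ _
    simp only [Sat, h₂]
    exact exists_const N
  have h₂ := h.entails _ h₁ M J hJ
  rw [h.isTranslation.map_iff, h.isTranslation.map_ex] at h₂
  have h₃ (σ : ℕ → M) := (sat_iff _ _ _ _).1 (h₂ σ)
  rw [← h₃, ← h₃ τ]
  simp only [Sat, Function.update_idem]

/-- The translation of an atomic formula depends on the values of the variables of the atomic
formula only. -/
theorem IsInterpretation.sat_congr (h : IsInterpretation T₁ T₂ tr) (hJ : T₂.IsModel J)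
    (R : T₁.lang) (args : Fin R.1.rank → ℕ) {τ τ' : ℕ → M} (hτ : ∀ m, τ (args m) = τ' (args m)) :
    Sat J τ (tr (.rel R args)) ↔ Sat J τ' (tr (.rel R args)) := by
  have h₁ (n : ℕ) : Sat J (fun i => if i < n then τ' i else τ i) (tr (.rel R args)) ↔
      Sat J τ (tr (.rel R args)) := by
    induction n with
    | zero => simp
    | succ n ih =>
      rw [← ih]
      have h₂ : (fun i => if i < n + 1 then τ' i else τ i) =
          Function.update (fun i => if i < n then τ' i else τ i) n (τ' n) := by
        funext i
        rcases lt_trichotomy i n with hi | rfl | hi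
        · simp [hi.ne, hi, hi.trans (Nat.lt_succ_self n)]
        · simp
        · simp [hi.ne', hi.not_gt, (Nat.succ_le_of_lt hi).not_gt]
      rw [h₂]
      by_cases hn : ∃ m, args m = n
      · obtain ⟨m, rfl⟩ := hn
        rw [Function.update_eq_self_iff.2]
        simp [hτ]
      · exact h.sat_update_iff hJ R args (fun m hm => hn ⟨m, hm⟩) _ _
  obtain ⟨N, hN⟩ := exists_sat_congr J (tr (.rel R args))
  rw [← h₁ N]
  exact hN _ _ fun i hi => by simp [hi]

/-- Variables with equal values can be replaced in the translation of an atomic formula. -/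
theorem IsInterpretation.sat_args_congr (h : IsInterpretation T₁ T₂ tr) (hJ : T₂.IsModel J)
    (R : T₁.lang) (args args' : Fin R.1.rank → ℕ) {τ : ℕ → M}
    (hτ : ∀ m, τ (args m) = τ (args' m)) :
    Sat J τ (tr (.rel R args)) ↔ Sat J τ (tr (.rel R args')) := by
  have h₁ (args : Fin R.1.rank → ℕ) (m : Fin R.1.rank) (j : ℕ) (hj : τ (args m) = τ j) :
      Sat J τ (tr (.rel R args)) ↔ Sat J τ (tr (.rel R (Function.update args m j))) := by
    have h₂ : T₁.Entails (.not (.and (.eq (args m) j)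
        (.not (.iff (.rel R args) (.rel R (Function.update args m j)))))) := fun N _ I _ σ => by
      simp only [Sat, sat_iff, not_and, not_not]
      intro hσ
      have : (fun l => σ (Function.update args m j l)) = fun l => σ (args l) := by
        funext l
        by_cases hl : l = m
        · subst hl; simp [hσ]
        · simp [hl]
      rw [this]
    have h₃ := h.entails _ h₂ M J hJ τ
    rw [h.isTranslation.map_not, h.isTranslation.map_and, h.isTranslation.map_not,
      h.isTranslation.map_eq, h.isTranslation.map_iff] at h₃
    simp only [Sat, sat_iff, not_and, not_not] at h₃
    exact h₃ hj
  have h₂ (s : Finset (Fin R.1.rank)) : Sat J τ (tr (.rel R args)) ↔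
      Sat J τ (tr (.rel R (s.piecewise args' args))) := by
    induction s using Finset.induction_on with
    | empty => rw [Finset.piecewise_empty]
    | insert m s hm ih =>
      rw [ih, Finset.piecewise_insert]
      exact h₁ _ m _ (by rw [Finset.piecewise_eq_of_notMem _ _ _ hm, hτ])
  rw [h₂ Finset.univ, Finset.piecewise_univ]

/-- The truth value of the translation of an atomic formula is a function of the values of its
arguments. -/
theorem IsInterpretation.sat_rel_congr (h : IsInterpretation T₁ T₂ tr) (hJ : T₂.IsModel J)
    (R : T₁.lang) (args args' : Fin R.1.rank → ℕ) {τ τ' : ℕ → M}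
    (hτ : ∀ m, τ (args m) = τ' (args' m)) :
    Sat J τ (tr (.rel R args)) ↔ Sat J τ' (tr (.rel R args')) := by
  -- Both sides are compared with the atomic formula in the fresh variables `N, N + 1, …`.
  obtain ⟨N, hN, hN'⟩ : ∃ N, (∀ m, args m < N) ∧ ∀ m, args' m < N := by
    refine ⟨max (Finset.univ.sup args) (Finset.univ.sup args') + 1, fun m => ?_, fun m => ?_⟩
    · have := Finset.le_sup (f := args) (Finset.mem_univ m); omega
    · have := Finset.le_sup (f := args') (Finset.mem_univ m); omega
  have key (args : Fin R.1.rank → ℕ) (hN : ∀ m, args m < N) (τ σ : ℕ → M)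
      (hσ : ∀ m : Fin R.1.rank, σ (N + m) = τ (args m)) :
      Sat J τ (tr (.rel R args)) ↔ Sat J σ (tr (.rel R fun m => N + m)) := by
    let ρ : ℕ → M := fun i => if i < N then τ i else σ i
    rw [h.sat_congr hJ R args (τ' := ρ) fun m => by simp [ρ, hN],
      h.sat_args_congr hJ R args (fun m => N + m) fun m => by simp [ρ, hN, hσ]]
    exact h.sat_congr hJ R _ fun m => by simp [ρ]
  let σ : ℕ → M := fun i => if hi : i - N < R.1.rank then τ (args ⟨i - N, hi⟩) else τ i
  have hσ (m : Fin R.1.rank) : σ (N + m) = τ (args m) := by simp [σ]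
  rw [key args hN τ σ hσ, key args' hN' τ' σ fun m => (hσ m).trans (hτ m)]

/-- An interpretation of `T₁` into `T₂` defines a model of `T₁` in every model of `T₂`. -/
theorem IsInterpretation.exists_model (h : IsInterpretation T₁ T₂ tr) (hJ : T₂.IsModel J) :
    ∃ I : Interp T₁.lang M, T₁.IsModel I ∧ ∀ φ τ, Sat I τ φ ↔ Sat J τ (tr φ) := by
  let I : Interp T₁.lang M := fun R => {a | ∃ (args : Fin R.1.rank → ℕ) (τ : ℕ → M),
    (∀ m, τ (args m) = a m) ∧ Sat J τ (tr (.rel R args))}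
  have hI (φ : Formula T₁.lang) (τ : ℕ → M) : Sat I τ φ ↔ Sat J τ (tr φ) := by
    induction φ generalizing τ with
    | eq i j => rw [h.isTranslation.map_eq]; rfl
    | rel R args =>
      constructor
      · rintro ⟨args', τ', hτ, h'⟩
        exact (h.sat_rel_congr hJ R _ _ hτ).1 h'
      · exact fun h' => ⟨args, τ, fun _ => rfl, h'⟩
    | and φ ψ h₁ h₂ => rw [h.isTranslation.map_and]; exact and_congr (h₁ τ) (h₂ τ)
    | not φ h₁ => rw [h.isTranslation.map_not]; exact not_congr (h₁ τ)
    | ex i φ h₁ => rw [h.isTranslation.map_ex]; exact exists_congr fun a => h₁ _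
  exact ⟨I, fun ψ hψ τ => (hI ψ τ).2 (h.entails ψ (fun N _ I' hI' => hI' ψ hψ) M J hJ τ), hI⟩

/-- A model of one of two definitionally equivalent theories yields a model of the other one with
the same automorphisms. -/
theorem DefinitionallyEquivalent.exists_model (h : DefinitionallyEquivalent T₁ T₂)
    (hJ : T₂.IsModel J) : ∃ I : Interp T₁.lang M, T₁.IsModel I ∧ ∀ α, I.IsAut α ↔ J.IsAut α := by
  obtain ⟨tr, htr, tr', -, -, h₂⟩ := h
  obtain ⟨I, hI, hIJ⟩ := htr.exists_model hJ
  refine ⟨I, hI, fun α => ⟨fun hα => Interp.isAut_of_sat fun R args τ => ?_,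
    fun hα => Interp.isAut_of_sat fun R args τ => ?_⟩⟩
  · have h₃ (σ : ℕ → M) : Sat J σ (.rel R args) ↔ Sat I σ (tr' (.rel R args)) :=
      ((sat_iff _ _ _ _).1 (h₂ _ M J hJ σ)).symm.trans (hIJ _ _).symm
    rw [h₃, h₃, hα.sat]
  · rw [hIJ, hIJ, hα.sat]

end Interpretations

open Coord

/-! ### A model of relativistic kinematics with all Poincaré transformations -/

/-- The linear Lorentz transformations for the speed of light `1`. -/
def lorentz (K : Type*) [Field K] : Submonoid (Module.End K (Fin 4 → K)) where
  carrier := {L | ∀ x, mink 1 (L x) = mink 1 x}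
  mul_mem' h h' x := (h _).trans (h' x)
  one_mem' _ := rfl

/-- The objects of the standard model: the quantities, the observers, given by their Poincaré
transformations `x ↦ o + L x`, and the light signals `{z + s u | s : K}`, where `u` is a null
vector. -/
inductive Poincare (K : Type*) [Field K] : Type _
  | quantity (s : K)
  | observer (o : Fin 4 → K) (L : lorentz K)
  | signal (z u : Fin 4 → K) (hu : mink 1 u = 0)

namespace Poincare

variable {K : Type u} [Field K]

/-- The Poincaré transformation `x ↦ a + G x` acts on the objects. -/
def act (a : Fin 4 → K) (G : lorentz K) : Poincare K → Poincare K
  | quantity s => quantity s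
  | observer o L => observer (a + G.1 o) (G * L)
  | signal z u hu => signal (a + G.1 z) (G.1 u) ((G.2 u).trans hu)

theorem act_act (a b : Fin 4 → K) (G H : lorentz K) (m : Poincare K) :
    act a G (act b H m) = act (a + G.1 b) (G * H) m := by
  cases m with
  | quantity s => rfl
  | observer o L =>
    simp only [act, map_add, add_assoc, mul_assoc]; rfl
  | signal z u hu =>
    simp only [act, map_add, add_assoc]; rfl

theorem act_zero_one (m : Poincare K) : act 0 1 m = m := by
  cases m <;> simp [act]

/-- The permutation given by a Poincaré transformation of order two. -/
def actEquiv (a : Fin 4 → K) (G : lorentz K) (ha : a + G.1 a = 0) (hG : G * G = 1) :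
    Equiv.Perm (Poincare K) :=
  Function.Involutive.toPerm (act a G) fun m => by rw [act_act, ha, hG, act_zero_one]

variable [LinearOrder K]

/-- The sorts, the field of quantities, the observers and the light signals of the standard
model. -/
def sorts (K : Type u) [Field K] [LinearOrder K] : KinStr (Poincare K) where
  B m := ¬ ∃ s, quantity s = m
  Q m := ∃ s, quantity s = m
  IOb m := ∃ o L, observer o L = m
  Ph m := ∃ z u hu, signal z u hu = m
  plus a b c := ∃ x y, quantity x = a ∧ quantity y = b ∧ quantity (x + y) = c
  times a b c := ∃ x y, quantity x = a ∧ quantity y = b ∧ quantity (x * y) = c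
  le a b := ∃ x y, quantity x = a ∧ quantity y = b ∧ x ≤ y
  W _ _ _ _ _ _ := False

/-- The field of quantities of the standard model is `K`. -/
def quantities (K : Type u) [Field K] [LinearOrder K] : Quantities (sorts K) K where
  ι := quantity
  inj _ _ h := by injection h
  Q_iff _ := Iff.rfl
  plus_iff _ _ _ := Iff.rfl
  times_iff _ _ _ := Iff.rfl
  le_iff _ _ := Iff.rfl

theorem sorts_sorted : (sorts K).Sorted where
  B_iff _ := Iff.rfl
  IOb_B := by rintro _ ⟨o, L, rfl⟩ ⟨s, h⟩; cases h
  Ph_B := by rintro _ ⟨z, u, hu, rfl⟩ ⟨s, h⟩; cases h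
  IOb_Ph := by rintro _ ⟨⟨o, L, rfl⟩, z, u, hu, h⟩; cases h
  W_sorts _ _ _ _ _ _ h := h.elim

/-- The world line of a light signal. -/
def line : Poincare K → Set (Fin 4 → K)
  | signal z u _ => {x | ∃ s : K, x = z + s • u}
  | _ => ∅

variable (K) [IsStrictOrderedRing K] [IsEuclidean K]

/-- The frame of the standard model: the boost and the trivial transformation of an observer are
the factors of its Lorentz transformation. -/
theorem exists_frame : ∃ D : Frame (Poincare K) K, D.Good (sorts K) (observer 0 1) ∧
    D.wl = line ∧ ∀ o L, D.o (observer o L) = o ∧ ∀ x, D.lorMap (observer o L) x = L.1 x := by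
  choose w ρ hw hρ hL using fun L : lorentz K => exists_lor one_pos L.2
  let D : Frame (Poincare K) K :=
    { c := 1
      o := fun m => match m with | observer o _ => o | _ => 0
      w := fun m => match m with | observer _ L => w L | _ => 0
      ρ := fun m => match m with | observer _ L => ρ L | _ => 0
      wl := line }
  have hdir (L : lorentz K) {v : Fin 4 → K} (hv : v 0 = 0) {t : K}
      (h : L.1 timeUnit = t • lor 1 v timeUnit) : w L = v := by
    obtain ⟨r, hr, hr', -⟩ := (hρ L).exists_time
    rw [hL, hr', map_smul] at h
    refine lor_direction one_pos (hw L) hv (t := r * t) ?_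
    rw [mul_smul, ← h, smul_smul, ← sq, hr, one_smul]
  have hbase : w 1 = 0 := hdir 1 rfl (t := 1) (by
    rw [one_smul, lor_zero one_pos, gal_timeUnit, add_zero]; rfl)
  have hD : D.Good (sorts K) (observer 0 1) :=
    { sorted := sorts_sorted
      c_pos := one_pos
      base_mem := ⟨0, 1, rfl⟩
      base_o := rfl
      base_w := hbase
      base := fun x => by
        have := hL 1 x
        rw [hbase, lor_zero one_pos] at this
        exact this.symm
      time_w := by rintro _ ⟨o, L, rfl⟩; exact hw L
      trivial := by rintro _ ⟨o, L, rfl⟩; exact hρ L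
      boost := fun v hv => ⟨observer 0 ⟨lor 1 v, mink_lor one_pos hv⟩, ⟨_, _, rfl⟩,
        hdir _ hv (t := 1) (one_smul ..).symm⟩
      triv := by
        rintro _ ⟨o, L, rfl⟩ σ hσ - o'
        let L' : lorentz K := L * ⟨σ, hσ.mink 1⟩
        obtain ⟨r, -, hr, -⟩ := hσ.exists_time
        obtain ⟨r', -, hr', -⟩ := (hρ L).exists_time
        have hL' (x) : L'.1 x = L.1 (σ x) := rfl
        have hw' : w L' = w L := hdir L' (hw L) (t := r * r') (by
          rw [hL', hr, map_smul, hL, hr', map_smul, smul_smul])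
        refine ⟨observer o' L', ⟨_, _, rfl⟩, hw', LinearMap.ext fun x => ?_, rfl⟩
        have h := hL L' x
        rw [hL', hL, hw'] at h
        change ρ L' x = ρ L (σ x)
        rw [← lor_lor one_pos (hw L) (ρ L' x), ← h, lor_lor one_pos (hw L)]
      light := fun z z' => by
        constructor
        · rintro ⟨_, -, ⟨y, u, hu, rfl⟩, ⟨s, rfl⟩, t, rfl⟩
          rw [add_sub_add_left_eq_sub, ← sub_smul, mink_smul]
          exact (congrArg _ hu).trans (mul_zero _)
        · intro h
          refine ⟨signal z (z - z') h, sorts_sorted.Ph_B _ ⟨_, _, _, rfl⟩, ⟨_, _, _, rfl⟩,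
            ⟨0, ?_⟩, -1, ?_⟩
          · rw [zero_smul, add_zero]
          · module }
  exact ⟨D, hD, rfl, fun o L => ⟨rfl, fun x => (hL L x).symm⟩⟩

theorem lorentz_injective {K : Type u} [Field K] [LinearOrder K] [IsStrictOrderedRing K]
    (G : lorentz K) : Function.Injective G.1 := by
  refine (injective_iff_map_eq_zero G.1).2 fun x hx => ?_
  have h (y) : mprod 1 x y = 0 := by
    rw [← mprod_map G.2, hx]; simp [mprod, sdot]
  ext i
  have := h (Pi.single i 1)
  fin_cases i <;> simpa [mprod, sdot] using this

/-- A model of relativistic kinematics for which all Poincaré transformations are automorphisms. -/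
theorem exists_model (S : Type u) : ∃ (A : KinStr (Poincare K)) (q : Quantities A K),
    (specRel S).IsModel (A.interp S) ∧
    (∀ a G ha hG, (A.interp S).IsAut (actEquiv a G ha hG)) ∧
    ∀ o L o' L' x, q.W (observer o L) (observer o' L') x ↔
      ∃ s : K, o + L.1 x = o' + s • L'.1 timeUnit := by
  obtain ⟨D, hD, hwl, hobs⟩ := exists_frame K
  let F := (sorts K).Worldview D.o D.lorMap D.wl
  let q := (quantities K).withWQuantities F
  have hW (k b x) : q.W k b x ↔ F k b x := (quantities K).withW_W F k b x
  have hD' := hD.withW (quantities K) D.lorMap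
  refine ⟨(quantities K).withW F, q, (isModel_specRel_iff q).2 (hD'.relativisticAxioms hW),
    fun a G ha hG => ?_, fun o L o' L' x => ?_⟩
  · have hO (m) : (sorts K).IOb (act a G m) ↔ (sorts K).IOb m := by
      cases m <;> simp [sorts, act]
    have hB (m) : (sorts K).B (act a G m) ↔ (sorts K).B m := by
      cases m <;> simp [sorts, act]
    refine q.isAut_interp hD'.sorted (fun s => rfl) hO (fun m => ?_) fun k b x => ?_
    · change (sorts K).Ph (act a G m) ↔ (sorts K).Ph m
      cases m with
      | signal z u hu => exact iff_of_true ⟨_, _, _, rfl⟩ ⟨_, _, _, rfl⟩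
      | _ => simp [sorts, act]
    · change q.W (act a G k) (act a G b) x ↔ _
      rw [hW, hW]
      change (sorts K).Worldview D.o D.lorMap D.wl _ _ x ↔
        (sorts K).Worldview D.o D.lorMap D.wl _ _ x
      rw [KinStr.Worldview, KinStr.Worldview, hO, hO, hB]
      refine and_congr_right ?_
      rintro ⟨o, L, rfl⟩
      have key (y z : Fin 4 → K) : a + G.1 o + (G * L).1 x = a + G.1 y + G.1 z ↔
          o + L.1 x = y + z := by
        rw [← (lorentz_injective G).eq_iff (a := o + L.1 x), map_add, map_add, add_assoc, add_assoc,
          add_right_inj]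
        rfl
      refine and_congr_right fun _ => or_congr ?_ ?_
      · refine and_congr_right ?_
        rintro ⟨o', L', rfl⟩
        refine exists_congr fun s => ?_
        simp only [act, hobs]
        rw [← key, map_smul]
        rfl
      · refine and_congr_right fun _ => ?_
        simp only [act, hobs, hwl]
        cases b with
        | quantity s => exact Iff.rfl
        | observer o' L' => exact Iff.rfl
        | signal z u hu => exact exists_congr fun s => by rw [← map_smul, key]
  · rw [hW]
    change (sorts K).Worldview D.o D.lorMap D.wl _ _ x ↔ _
    have hO : (sorts K).IOb (observer o' L') := ⟨_, _, rfl⟩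
    rw [KinStr.Worldview]
    simp only [hobs]
    exact ⟨fun h => h.2.2.elim And.right fun h => absurd hO h.1,
      fun h => ⟨⟨_, _, rfl⟩, sorts_sorted.IOb_B _ hO, .inl ⟨hO, h⟩⟩⟩

end Poincare

open Coord

/-! ### The theories are not definitionally equivalent -/

namespace Poincare

/-- The reflection in a line that is not null. -/
def reflection {K : Type u} [Field K] (n : Fin 4 → K) (hn : mink 1 n ≠ 0) : lorentz K :=
  ⟨refl 1 n, mink_refl hn⟩

theorem reflection_mul_self {K : Type u} [Field K] (n : Fin 4 → K) (hn : mink 1 n ≠ 0) :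
    reflection n hn * reflection n hn = 1 := Subtype.ext (LinearMap.ext (refl_refl hn))

/-- The map `x ↦ -x`. -/
def negation (K : Type u) [Field K] : lorentz K := ⟨-1, mink_neg 1⟩

theorem negation_mul_self (K : Type u) [Field K] : negation K * negation K = 1 :=
  Subtype.ext (LinearMap.ext fun x => neg_neg x)

/-- A boost `x` maps some null vector to its double, so that `x y x⁻¹ = y²` for the corresponding
translation `y`. Both are products of two involutions. In a classical model with these
automorphisms, every body could be exchanged with its image under `y³`; this is not an automorphism
of the relativistic model. -/
theorem not_definitionallyEquivalent (K : Type u) [Field K] [LinearOrder K]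
    [IsStrictOrderedRing K] [IsEuclidean K] (S : Type u) :
    ¬ DefinitionallyEquivalent (classicalKin S) (specRel S) := by
  classical
  intro h
  have : Nonempty (Poincare K) := ⟨observer 0 1⟩
  obtain ⟨A, q, hJ, haut, hW⟩ := exists_model K S
  obtain ⟨I, hI, hIJ⟩ := h.exists_model hJ
  let n : Fin 4 → K := ![1, 1, 0, 0]
  have h₀ : mink 1 (timeUnit : Fin 4 → K) ≠ 0 := by rw [mink_timeUnit]; norm_num
  have h₁ : mink 1 (![3, 1, 0, 0] : Fin 4 → K) ≠ 0 := by
    simp only [mink, space, Matrix.cons_val]; norm_num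
  let R₀ : lorentz K := reflection timeUnit h₀
  let R₁ : lorentz K := reflection ![3, 1, 0, 0] h₁
  let N : lorentz K := negation K
  have hn : R₁.1 (R₀.1 n) = n + n := by
    change refl 1 ![3, 1, 0, 0] (refl 1 timeUnit n) = _
    rw [refl_apply 1 timeUnit, refl_apply]
    ext i
    fin_cases i <;> simp [n, mink, mprod, sdot, space, timeUnit] <;> norm_num
  have hR₀ : (0 : Fin 4 → K) + R₀.1 0 = 0 := by simp
  have hR₁ : (0 : Fin 4 → K) + R₁.1 0 = 0 := by simp
  have hN₀ : (0 : Fin 4 → K) + N.1 0 = 0 := by simp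
  have hN₁ : n + N.1 n = 0 := add_neg_cancel n
  have hNN : N * N = 1 := negation_mul_self K
  let r₀ := actEquiv 0 R₀ hR₀ (reflection_mul_self _ _)
  let r₁ := actEquiv 0 R₁ hR₁ (reflection_mul_self _ _)
  let s₀ := actEquiv 0 N hN₀ hNN
  let s₁ := actEquiv n N hN₁ hNN
  have hinv (a : Fin 4 → K) (G ha hG m) : actEquiv a G ha hG (actEquiv a G ha hG m) = m :=
    (actEquiv a G ha hG).symm_apply_apply m
  have hx (m) : (r₁ * r₀) m = act 0 (R₁ * R₀) m := by
    change act 0 R₁ (act 0 R₀ m) = _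
    rw [act_act, hR₁]
  have hy (m) : (s₁ * s₀) m = act n 1 m := by
    change act n N (act 0 N m) = _
    rw [act_act, map_zero, add_zero, hNN]
  have hxy : (r₁ * r₀) * (s₁ * s₀) = (s₁ * s₀) * ((s₁ * s₀) * (r₁ * r₀)) := by
    refine Equiv.ext fun m => ?_
    rw [Equiv.Perm.mul_apply, Equiv.Perm.mul_apply (s₁ * s₀), Equiv.Perm.mul_apply (s₁ * s₀), hx,
      hx, hy, hy, hy, act_act, act_act, act_act]
    have : (R₁ * R₀).1 n = n + n := hn
    rw [this, zero_add, mul_one, one_mul, one_mul, map_zero, add_zero]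
    rfl
  have hswap := (hIJ _).1 (isAut_swap_of_classicalKin hI ((hIJ _).2 (haut 0 R₀ hR₀ _))
    ((hIJ _).2 (haut 0 R₁ hR₁ _)) ((hIJ _).2 (haut 0 N hN₀ hNN)) ((hIJ _).2 (haut n N hN₁ hNN))
    (hinv _ _ _ _) (hinv _ _ _ _) (hinv _ _ _ _)
    (hinv _ _ _ _) hxy (observer 0 1))
  let b : Poincare K := observer 0 1
  let b' : Poincare K := observer (n + (n + n)) 1
  have hb' : ((s₁ * s₀) * ((s₁ * s₀) * (s₁ * s₀))) (observer 0 1) = b' := by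
    rw [Equiv.Perm.mul_apply, Equiv.Perm.mul_apply (s₁ * s₀), hy, hy, hy]
    simp [act, b']
  -- The observer `d` at rest with reversed space axes meets `b` at the origin, but not `b'`.
  let d : Poincare K := observer 0 R₀
  have hR₀e : R₀.1 timeUnit = timeUnit := by
    change refl 1 timeUnit timeUnit = _
    rw [refl_apply, mprod_self, mul_div_assoc, div_self h₀, mul_one, two_smul, add_sub_cancel_right]
  have hd : d ≠ b := fun h => by
    injection h with _ h
    have h' : refl 1 timeUnit n = n := congrArg (fun L : lorentz K => L.1 n) h
    have := congrFun h' 1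
    norm_num [refl_apply, n, timeUnit] at this
  have hd' : d ≠ b' := fun h => by
    injection h with h _
    have := congrFun h 1
    norm_num [n] at this
  rw [hb'] at hswap
  have hfix : q.Fixes S (Equiv.swap b b') :=
    ⟨hswap, q.eq_of_involutive hswap (Equiv.congr_fun (Equiv.swap_swap b b'))⟩
  have h₂ := hfix.W_iff b d 0
  rw [Equiv.swap_apply_left, Equiv.swap_apply_of_ne_of_ne hd hd', hW, hW] at h₂
  obtain ⟨s, hs⟩ := h₂.2 ⟨0, by simp⟩
  rw [hR₀e] at hs
  have := congrFun hs 1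
  norm_num [n, timeUnit] at this

end Poincare

instance : IsStrictOrderedRing (ULift.{u} ℝ) :=
  Function.Injective.isStrictOrderedRing ULift.down rfl rfl (fun _ _ => rfl) (fun _ _ => rfl)
    Iff.rfl Iff.rfl

instance : IsEuclidean (ULift.{u} ℝ) where
  exists_sq x hx := ⟨⟨√x.down⟩, ULift.ext _ _ (Real.sq_sqrt hx)⟩

/-! ### The conceptual distance -/

section Distance

variable (S : Type u)

theorem oneConceptExtension_specRelE : OneConceptExtension (specRel S) (specRelE S) :=
  ⟨⟨.kin .E, rfl⟩, conservativeExtension_specRelE S⟩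

/-- A path without ones stays within one class of definitionally equivalent theories. -/
theorem ClusterNetwork.IsPath.equiv_of_count_eq_zero {X : Type u} {N : ClusterNetwork X} {T T' : X}
    {b : List Bool} (h : N.IsPath T T' b) (hb : b.count true = 0) : N.E T T' := by
  induction h with
  | nil T => exact N.equivalence.refl T
  | zero h _ ih => exact N.equivalence.trans h (ih (by simpa using hb))
  | one h _ ih => simp at hb

theorem conceptualDistance_classicalKin_specRel :
    conceptualDistance (classicalKin S) (specRel S) = 1 := by
  apply le_antisymm
  · refine sInf_le ⟨[false, true], .zero (T₁ := specRelE S) ?_ (.one ?_ (.nil _)), by simp⟩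
    · exact (definitionallyEquivalent_equivalence S).symm
        (definitionallyEquivalent_specRelE_classicalKin S)
    · exact .inr (oneConceptExtension_specRelE S)
  · refine le_sInf ?_
    rintro _ ⟨b, hb, rfl⟩
    rw [Order.one_le_iff_ne_zero, Ne, Nat.cast_eq_zero]
    exact fun h => Poincare.not_definitionallyEquivalent (ULift.{u} ℝ) S
      (hb.equiv_of_count_eq_zero h)

end Distance

theorem theorem5p1 (S : Type u) :
    conceptualDistance (classicalKin S) (specRel S) = 1 ∧
    RelSymbol.rank (RelSymbol.kin KinSymbol.E : RelSymbol S) = 1 ∧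
    (RelSymbol.kin KinSymbol.E : RelSymbol S) ∉ (specRel S).lang ∧
    (specRelE S).lang = insert (RelSymbol.kin KinSymbol.E) (specRel S).lang ∧
    ConservativeExtension (specRel S) (specRelE S) ∧
    DefinitionallyEquivalent (specRelE S) (classicalKin S) := by
  refine ⟨conceptualDistance_classicalKin_specRel S, rfl, ?_, rfl,
    conservativeExtension_specRelE S, definitionallyEquivalent_specRelE_classicalKin S⟩
  rintro ⟨s, hs, h⟩
  cases h
  exact hs rfl
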